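/- **The continuous-time joint replenishment problem.** A *dynamic policy* for one item consists of ordering points $0=\tau_0<\tau_1<\tau_2<\cdots$ with $\tau_k\to\infty$ and real ordering quantities $q_0,q_1,\ldots$. Under unit demand rate its inventory level at time $t$ is $I(\mathcal P,t)=\sum_{k:\tau_k\le t}q_k-t$, and it is *feasible* if $I(\mathcal P,t)\ge 0$ for all $t\ge 0$. An instance $\mathcal I$ consists of a number $n$ of items, a joint ordering cost $K_0$, and for each item $i\in[n]$ an ordering cost $K_i$ and a holding cost $2H_i$; all are rational, with $K_0,K_i\ge 0$, $K_0+K_i>0$ and $H_i>0$ for every $i$. The long-run average cost of a vector $\mathcal P=(\mathcal P_1,\ldots,\mathcal P_n)$ of feasible dynamic policies is $$F(\mathcal P)=K_0\cdot\limsup_{t\to\infty}\frac{N(\mathcal P,[0,t))}{t}+\sum_{i=1}^n\limsup_{t\to\infty}\frac{K_i\,N(\mathcal P_i,[0,t))+2H_i\int_{[0,t)}I(\mathcal P_i,s)\,\mathrm ds}{t}\in[0,\infty],$$ where $N(\mathcal P_i,[0,t))$ is the number of ordering points of $\mathcal P_i$ in $[0,t)$, and $N(\mathcal P,[0,t))$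 is the number of distinct times in $[0,t)$ at which at least one item is ordered. Let $|\mathcal I|$ be the size of $\mathcal I$ in binary representation. **Theorem.** There are a deterministic algorithm and a universal constant $C$ such that the following holds for every real $\epsilon>0$ and every instance $\mathcal I$. Given $\lceil 1/\epsilon\rceil$ and $\mathcal I$, the algorithm outputs a feasible joint replenishment policy $\mathcal P$ with $$F(\mathcal P)\le(1+\epsilon)\cdot F(\mathcal Q)\qquad\text{for every vector }\mathcal Q=(\mathcal Q_1,\ldots,\mathcal Q_n)\text{ of feasible dynamic policies,}$$ and its running time is at most $$C\cdot 2^{\,C\,\epsilon^{-4}\,(\log(2+1/\epsilon))^{C}}\cdot|\mathcal I|^{C}=O\bigl(2^{\tilde O(1/\epsilon^4)}\cdot|\mathcal I|^{O(1)}\bigr).$$ The policy is output compactly: for each item, a finite list of positive rational durations that is repeated cyclically, each order covering exactly the demand until the next order of this item. Running time is counted in bit operations up to polynomial factors: the algorithm is a while-program on binary trees with binary natural numbers at the leaves, and each elementary operation (projections, pairing, shape test, $+$, truncated $-$, $\times$, integer division) is charged the bit sizes of its argument and result. -/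

import Mathlib

open Filter MeasureTheory
open scoped ENNReal

noncomputable section

namespace JRP

/-! ### Dynamic replenishment policies and their long-run average costs -/

/-- The data of a single-item dynamic policy: the ordering points `τ 0, τ 1, …` and the
ordering quantities `q 0, q 1, …`. -/
structure Policy where
  τ : ℕ → ℝ
  q : ℕ → ℝ

namespace Policy

/-- The inventory level at time `t`, under a unit demand rate: everything ordered up to and
including time `t`, minus `t`. (A finite sum as soon as `τ` tends to infinity.) -/
def inventory (P : Policy) (t : ℝ) : ℝ :=
  (∑ᶠ (k : ℕ) (_ : P.τ k ≤ t), P.q k) - t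

/-- The ordering points satisfy `0 = τ 0 < τ 1 < ⋯` and cover `[0,∞)`, and demand is always met. -/
structure Feasible (P : Policy) : Prop where
  zero : P.τ 0 = 0
  strictMono : StrictMono P.τ
  tendsto : Tendsto P.τ atTop atTop
  inventory_nonneg : ∀ t : ℝ, 0 ≤ t → 0 ≤ P.inventory t

/-- The number of orders placed along `[0,t)`. -/
def orders (P : Policy) (t : ℝ) : ℕ :=
  {k : ℕ | P.τ k < t}.ncard

/-- The combined ordering and holding cost along `[0,t)`, with cost `K` per order and `2 * H` per
inventory unit and time unit. -/
def costUpTo (K H : ℝ) (P : Policy) (t : ℝ) : ℝ :=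
  K * P.orders t + 2 * H * ∫ s in Set.Ico 0 t, P.inventory s

/-- The long-run average cost, possibly infinite. For feasible policies and `K, H ≥ 0` the
quotient is nonnegative for `t > 0`, so that `ENNReal.ofReal` does not change it. -/
def cost (K H : ℝ) (P : Policy) : ℝ≥0∞ :=
  limsup (fun t : ℝ => ENNReal.ofReal (P.costUpTo K H t / t)) atTop

end Policy

/-- The number of joint orders along `[0,t)`: the distinct times at which some item is ordered. -/
def jointOrders {n : ℕ} (P : Fin n → Policy) (t : ℝ) : ℕ :=
  {s : ℝ | 0 ≤ s ∧ s < t ∧ ∃ i k, (P i).τ k = s}.ncard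

/-- An instance with `n` items: the joint ordering cost `K₀`, and for each item `i` an ordering
cost `K i` and a holding cost `2 * H i`. All costs are nonnegative rationals. -/
structure Inst where
  n : ℕ
  K₀ : ℚ≥0
  K : Fin n → ℚ≥0
  H : Fin n → ℚ≥0

/-- Holding costs are positive, and so is the cost of ordering any single item. -/
def Inst.Valid (I : Inst) : Prop :=
  ∀ i, 0 < I.K₀ + I.K i ∧ 0 < I.H i

/-- The long-run average cost of a joint replenishment policy: average joint ordering cost plus the
sum of the average costs of the items. -/
def Inst.F (I : Inst) (P : Fin I.n → Policy) : ℝ≥0∞ :=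
  ENNReal.ofReal (I.K₀ : ℝ) *
      limsup (fun t : ℝ => ENNReal.ofReal ((jointOrders P t : ℝ) / t)) atTop
    + ∑ i, (P i).cost (I.K i : ℝ) (I.H i : ℝ)

/-! ### A deterministic machine model with bit costs

While-programs on binary trees whose leaves are natural numbers written in binary. Every elementary
operation is charged the bit sizes of its argument and of its result, and control costs one unit, so
running times are polynomially related to those of deterministic Turing machines. -/

inductive Data where
  | num (n : ℕ)
  | pair (a b : Data)

/-- The number of bits, up to a constant factor. -/
def Data.size : Data → ℕ
  | .num n => Nat.size n + 1
  | .pair a b => a.size + b.size + 1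

inductive Op where
  | id
  | const (n : ℕ)
  | fst
  | snd
  | isPair
  | add
  | sub
  | mul
  | div

/-- Subtraction is truncated and division rounds down, with `a / 0 = 0`; an operation that is applied
to an argument of the wrong shape returns `0`. -/
def Op.apply : Op → Data → Data
  | .id, v => v
  | .const n, _ => .num n
  | .fst, .pair a _ => a
  | .snd, .pair _ b => b
  | .isPair, .pair _ _ => .num 1
  | .add, .pair (.num a) (.num b) => .num (a + b)
  | .sub, .pair (.num a) (.num b) => .num (a - b)
  | .mul, .pair (.num a) (.num b) => .num (a * b)
  | .div, .pair (.num a) (.num b) => .num (a / b)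
  | _, _ => .num 0

inductive Prog where
  | op (o : Op)
  /-- First `f`, then `g` on the result. -/
  | comp (f g : Prog)
  /-- Run `f` and `g` on the same argument and pair the results. -/
  | pair (f g : Prog)
  /-- `g` if `c` returns `0`, and `f` otherwise. -/
  | cond (c f g : Prog)
  /-- Replace the argument by its image under `f` as long as `c` does not return `0` on it. -/
  | loop (c f : Prog)

/-- `Eval p v w t`: on input `v`, the program `p` halts with output `w` after time `t`. -/
inductive Eval : Prog → Data → Data → ℕ → Prop where
  | op (o : Op) (v : Data) : Eval (.op o) v (o.apply v) (1 + v.size + (o.apply v).size)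
  | comp {f g : Prog} {v u w : Data} {s t : ℕ} :
      Eval f v u s → Eval g u w t → Eval (.comp f g) v w (1 + s + t)
  | pair {f g : Prog} {v a b : Data} {s t : ℕ} :
      Eval f v a s → Eval g v b t → Eval (.pair f g) v (.pair a b) (1 + s + t)
  | condTrue {c f g : Prog} {v b w : Data} {s t : ℕ} :
      Eval c v b s → b ≠ .num 0 → Eval f v w t → Eval (.cond c f g) v w (1 + s + t)
  | condFalse {c f g : Prog} {v w : Data} {s t : ℕ} :
      Eval c v (.num 0) s → Eval g v w t → Eval (.cond c f g) v w (1 + s + t)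
  | loopStop {c f : Prog} {v : Data} {s : ℕ} :
      Eval c v (.num 0) s → Eval (.loop c f) v v (1 + s)
  | loopStep {c f : Prog} {v b u w : Data} {s t r : ℕ} :
      Eval c v b s → b ≠ .num 0 → Eval f v u t → Eval (.loop c f) u w r →
        Eval (.loop c f) v w (1 + s + t + r)

/-- Programs are deterministic, in their output and in their running time. -/
theorem Eval.deterministic {p : Prog} {v w w' : Data} {t t' : ℕ}
    (h : Eval p v w t) (h' : Eval p v w' t') : w = w' ∧ t = t' := by
  induction h generalizing w' t' with
  | op o v => cases h'; exact ⟨rfl, rfl⟩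
  | comp _ _ ih₁ ih₂ =>
    cases h' with
    | comp a b =>
      obtain ⟨rfl, rfl⟩ := ih₁ a
      obtain ⟨rfl, rfl⟩ := ih₂ b
      exact ⟨rfl, rfl⟩
  | pair _ _ ih₁ ih₂ =>
    cases h' with
    | pair a b =>
      obtain ⟨rfl, rfl⟩ := ih₁ a
      obtain ⟨rfl, rfl⟩ := ih₂ b
      exact ⟨rfl, rfl⟩
  | condTrue _ hb _ ih₁ ih₂ =>
    cases h' with
    | condTrue a _ b =>
      obtain ⟨rfl, rfl⟩ := ih₁ a
      obtain ⟨rfl, rfl⟩ := ih₂ b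
      exact ⟨rfl, rfl⟩
    | condFalse a _ => exact absurd (ih₁ a).1 hb
  | condFalse _ _ ih₁ ih₂ =>
    cases h' with
    | condTrue a hb _ => exact absurd (ih₁ a).1.symm hb
    | condFalse a b =>
      obtain ⟨-, rfl⟩ := ih₁ a
      obtain ⟨rfl, rfl⟩ := ih₂ b
      exact ⟨rfl, rfl⟩
  | loopStop _ ih =>
    cases h' with
    | loopStop a =>
      obtain ⟨-, rfl⟩ := ih a
      exact ⟨rfl, rfl⟩
    | loopStep a hb _ _ => exact absurd (ih a).1.symm hb
  | loopStep _ hb _ _ ih₁ ih₂ ih₃ =>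
    cases h' with
    | loopStop a => exact absurd (ih₁ a).1 hb
    | loopStep a _ b c =>
      obtain ⟨rfl, rfl⟩ := ih₁ a
      obtain ⟨rfl, rfl⟩ := ih₂ b
      obtain ⟨rfl, rfl⟩ := ih₃ c
      exact ⟨rfl, rfl⟩

/-! ### Input and output encodings -/

/-- A nonnegative rational is given by its numerator and denominator in lowest terms. -/
def encodeRat (x : ℚ≥0) : Data :=
  .pair (.num x.num) (.num x.den)

/-- Lists are nested pairs, ending in the leaf `0`. -/
def encodeList : List Data → Data
  | [] => .num 0
  | d :: l => .pair d (encodeList l)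

/-- The joint ordering cost, followed by the list of pairs of item costs. -/
def Inst.encode (I : Inst) : Data :=
  .pair (encodeRat I.K₀)
    (encodeList (List.ofFn fun i => Data.pair (encodeRat (I.K i)) (encodeRat (I.H i))))

/-- The input size `|I|` in binary representation. -/
def Inst.size (I : Inst) : ℕ := I.encode.size

/-- Output fractions need not be in lowest terms. -/
def decodeRat : Data → ℚ≥0
  | .pair (.num a) (.num b) => (a : ℚ≥0) / (b : ℚ≥0)
  | _ => 0

def decodeList : Data → List Data
  | .num _ => []
  | .pair d l => d :: decodeList l

/-- The cyclic policy with successive order durations `L = [d₀, …, d_{m-1}]`, repeated forever: the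
`k`-th order is followed by the next one after `d_{k mod m}` time units, and its quantity is the
demand until then. (It is not feasible if `L` is empty or has a zero entry.) -/
def cyclicPolicy (L : List ℚ≥0) : Policy where
  τ k := ∑ j ∈ Finset.range k, ((L.getD (j % L.length) 0 : ℚ≥0) : ℝ)
  q k := ((L.getD (k % L.length) 0 : ℚ≥0) : ℝ)

/-- The joint policy described by an output: the list, over all items, of the lists of order durations
of their cyclic policies. -/
def decodePolicy (n : ℕ) (d : Data) : Fin n → Policy := fun i =>
  cyclicPolicy ((decodeList ((decodeList d).getD i (.num 0))).map decodeRat)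

end JRP

end

namespace JRP

/-! ### Typed polynomial-time functions -/

/-! The algorithm searches exhaustively for the best cycle on a coarse time grid. Let all costs be
integers, with $B=\sum_i H_i$ and $r=\lfloor\sqrt{k_0B}\rfloor$. Merging all items into one with
ordering cost $k_0$ and holding cost $2B$ shows that every feasible vector costs at least $2r$ per
time unit: an interval of length $d$ between orders costs at least $k_0+Bd^2\ge 2\sqrt{k_0B}\,d$.
Hence any loss of order $r/M$ per time unit is affordable. The grid step is $\delta=r/(BM)$, a cycle
has $M^4$ steps, and $M=16\lceil1/\epsilon\rceil$.

Items with $\sqrt{K_i/H_i}\ge M^3\delta$ are long. Each is ordered periodically, at its ideal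
interval rounded down to a multiple of $M^2\delta$. The rounding costs a factor $1+O(1/M)$, and even
if every multiple of $M^2\delta$ is paid for as a joint order, this amounts to $k_0/(M^2\delta)\le
4r/M$ per time unit. The long items thus decouple from the rest.

For the short items, a bit mask says which grid points of the cycle carry joint orders. For each of
the $2^{M^4-1}$ masks and each item, the best sub-mask is again found by enumeration, so the time is
polynomial in the input and in the size of the list of masks. To compare with a policy vector $Q$,
cut the time axis into windows of one cycle length and round the orders of $Q$ down to the grid.
Each window becomes a candidate cycle, so the cycle found costs at most the average over the
windows. The rounding costs $3H_i\delta$ per time unit, in total $3r/M$. Ordering everything anew at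
the start of a window costs $k_0/(M^4\delta)$ jointly, and $K_i/(M^4\delta)$ for a short item, which
is $O(1/M)$ times its own lower bound $2\sqrt{K_iH_i}$.

The losses add up to a factor $1+7/M$ (`rate_le`). Its ingredients are `mul_le_card_add_integral`
(lower bounds), `sumSq_gapsFrom_mask_le` (rounding), `mul_totalCost_le` (averaging), `long_cost_le`
and `short_restart_le`. Passing from rational to integral costs loses another factor $1+1/M$
(`Inst.natCost_le`). Since $F$ is a sum of upper limits, it suffices to compare costs at the ends of
windows (`Inst.le_F`). The running time is handled by a small calculus of polynomial-time functions,
`PolyTime`. -/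

theorem Data.one_le_size (v : Data) : 1 ≤ v.size := by
  cases v <;> simp [Data.size]

theorem Eval.size_input_le {p : Prog} {v w : Data} {t : ℕ} (h : Eval p v w t) : v.size ≤ t := by
  induction h <;> omega

/-- Every elementary operation is charged for its result. A time bound is therefore also a bound on
output size, which makes polynomial time closed under composition. -/
theorem Eval.size_output_le {p : Prog} {v w : Data} {t : ℕ} (h : Eval p v w t) : w.size ≤ t := by
  induction h with
  | op o v => omega
  | pair _ _ h₁ h₂ => simp only [Data.size]; omega
  | loopStop h _ => have := h.size_input_le; omega
  | _ => omega

/-- Types whose elements are represented by data of the machine. -/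
class Enc (α : Type) where
  enc : α → Data

open Enc

instance : Enc ℕ := ⟨Data.num⟩

instance {α β : Type} [Enc α] [Enc β] : Enc (α × β) := ⟨fun x => .pair (enc x.1) (enc x.2)⟩

instance {α : Type} [Enc α] : Enc (List α) := ⟨fun l => encodeList (l.map enc)⟩

/-- The size of the representation. -/
def esize {α : Type} [Enc α] (a : α) : ℕ := (enc a).size

section Size

variable {α β : Type} [Enc α] [Enc β]

theorem one_le_esize (a : α) : 1 ≤ esize a := Data.one_le_size _

theorem esize_nat (n : ℕ) : esize n = Nat.size n + 1 := rfl

theorem esize_pair (a : α) (b : β) : esize (a, b) = esize a + esize b + 1 := rfl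

theorem esize_nil : esize ([] : List α) = 1 := rfl

theorem esize_cons (a : α) (l : List α) : esize (a :: l) = esize a + esize l + 1 := rfl

theorem esize_le_of_mem {a : α} {l : List α} (h : a ∈ l) : esize a ≤ esize l := by
  induction l with
  | nil => cases h
  | cons b l ih =>
    rw [esize_cons]
    rcases List.mem_cons.1 h with rfl | h
    · omega
    · have := ih h; omega

theorem length_lt_esize (l : List α) : l.length < esize l := by
  induction l with
  | nil => simp [esize_nil]
  | cons b l ih => rw [esize_cons, List.length_cons]; omega

theorem esize_tail_le (l : List α) : esize l.tail ≤ esize l := by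
  cases l with
  | nil => simp
  | cons b l => rw [esize_cons, List.tail_cons]; omega

/-- The carry is absorbed by the extra unit that each leaf is charged. -/
theorem esize_add_le (a b : ℕ) : esize (a + b) ≤ esize a + esize b := by
  simp only [esize_nat]
  have : Nat.size (a + b) ≤ Nat.size a + Nat.size b + 1 := by
    rw [Nat.size_le]
    have ha := Nat.lt_size_self a
    have hb := Nat.lt_size_self b
    have h1 : 2 ^ a.size ≤ 2 ^ (a.size + b.size) := Nat.pow_le_pow_right (by norm_num) (by omega)
    have h2 : 2 ^ b.size ≤ 2 ^ (a.size + b.size) := Nat.pow_le_pow_right (by norm_num) (by omega)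
    rw [pow_succ]
    omega
  omega

theorem esize_mul_le (a b : ℕ) : esize (a * b) ≤ esize a + esize b := by
  simp only [esize_nat]
  have : Nat.size (a * b) ≤ Nat.size a + Nat.size b := by
    rw [Nat.size_le, pow_add]
    exact Nat.mul_lt_mul'' (Nat.lt_size_self a) (Nat.lt_size_self b)
  omega

theorem esize_mono {a b : ℕ} (h : a ≤ b) : esize a ≤ esize b := by
  simpa [esize_nat] using Nat.size_le_size h

end Size

theorem eval_le_eval (P : Polynomial ℕ) {x y : ℕ} (h : x ≤ y) : P.eval x ≤ P.eval y := by
  induction P using Polynomial.induction_on' with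
  | add p q hp hq => simpa using add_le_add hp hq
  | monomial n a =>
    simpa using Nat.mul_le_mul_left a (Nat.pow_le_pow_left h n)

/-- A single constant serves as coefficient and exponent, the form required of the final time bound.
-/
theorem exists_eval_le_mul_pow (P : Polynomial ℕ) : ∃ c : ℕ, ∀ x : ℕ, 1 ≤ x → P.eval x ≤ c * x ^ c := by
  induction P using Polynomial.induction_on' with
  | add p q hp hq =>
    obtain ⟨c, hc⟩ := hp
    obtain ⟨d, hd⟩ := hq
    refine ⟨c + d, fun x hx => ?_⟩
    have h1 : x ^ c ≤ x ^ (c + d) := Nat.pow_le_pow_right hx (by omega)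
    have h2 : x ^ d ≤ x ^ (c + d) := Nat.pow_le_pow_right hx (by omega)
    calc (p + q).eval x = p.eval x + q.eval x := by simp
      _ ≤ c * x ^ c + d * x ^ d := add_le_add (hc x hx) (hd x hx)
      _ ≤ c * x ^ (c + d) + d * x ^ (c + d) := by gcongr
      _ = (c + d) * x ^ (c + d) := by ring
  | monomial n a =>
    refine ⟨a + n, fun x hx => ?_⟩
    simp only [Polynomial.eval_monomial]
    exact Nat.mul_le_mul (by omega) (Nat.pow_le_pow_right hx (by omega))

/-- `f` is computed by a program whose running time is polynomial in the size of the argument. -/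
def PolyTime {α β : Type} [Enc α] [Enc β] (f : α → β) : Prop :=
  ∃ (p : Prog) (P : Polynomial ℕ), ∀ a, ∃ t, Eval p (enc a) (enc (f a)) t ∧ t ≤ P.eval (esize a)

namespace PolyTime

variable {σ α β γ : Type} [Enc σ] [Enc α] [Enc β] [Enc γ]

theorem exists_esize_le {f : α → β} (hf : PolyTime f) :
    ∃ P : Polynomial ℕ, ∀ a, esize (f a) ≤ P.eval (esize a) := by
  obtain ⟨p, P, h⟩ := hf
  refine ⟨P, fun a => ?_⟩
  obtain ⟨t, ht, hle⟩ := h a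
  exact ht.size_output_le.trans hle

theorem comp {g : β → γ} {f : α → β} (hg : PolyTime g) (hf : PolyTime f) :
    PolyTime fun a => g (f a) := by
  obtain ⟨p, P, hp⟩ := hf
  obtain ⟨q, Q, hq⟩ := hg
  refine ⟨.comp p q, 1 + P + Q.comp P, fun a => ?_⟩
  obtain ⟨s, hs, hsP⟩ := hp a
  obtain ⟨t, ht, htQ⟩ := hq (f a)
  refine ⟨_, .comp hs ht, ?_⟩
  have : Q.eval (esize (f a)) ≤ Q.eval (P.eval (esize a)) :=
    eval_le_eval Q (hs.size_output_le.trans hsP)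
  simp only [Polynomial.eval_add, Polynomial.eval_one, Polynomial.eval_comp]
  omega

theorem pair {f : α → β} {g : α → γ} (hf : PolyTime f) (hg : PolyTime g) :
    PolyTime fun a => (f a, g a) := by
  obtain ⟨p, P, hp⟩ := hf
  obtain ⟨q, Q, hq⟩ := hg
  refine ⟨.pair p q, 1 + P + Q, fun a => ?_⟩
  obtain ⟨s, hs, hsP⟩ := hp a
  obtain ⟨t, ht, htQ⟩ := hq a
  refine ⟨_, .pair hs ht, ?_⟩
  simp only [Polynomial.eval_add, Polynomial.eval_one]
  omega

theorem of_op {f : α → β} (o : Op) (P : Polynomial ℕ) (h : ∀ a, o.apply (enc a) = enc (f a))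
    (hP : ∀ a, esize (f a) ≤ P.eval (esize a)) : PolyTime f := by
  refine ⟨.op o, 1 + Polynomial.X + P, fun a => ⟨1 + esize a + esize (f a), ?_, ?_⟩⟩
  · have h1 := Eval.op o (enc a)
    rwa [h a] at h1
  · simpa using hP a

protected theorem id : PolyTime fun a : α => a :=
  of_op .id Polynomial.X (fun _ => rfl) (by simp)

theorem const (n : ℕ) : PolyTime fun _ : α => n :=
  of_op (.const n) (Polynomial.C (esize n)) (fun _ => rfl) (by simp)

theorem nil : PolyTime fun _ : α => ([] : List β) :=
  of_op (.const 0) 1 (fun _ => rfl) (by simp [esize_nil])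

theorem fst {f : α → β × γ} (hf : PolyTime f) : PolyTime fun a => (f a).1 :=
  comp (of_op .fst Polynomial.X (fun _ => rfl) (by rintro ⟨a, b⟩; simp [esize_pair]; omega)) hf

theorem snd {f : α → β × γ} (hf : PolyTime f) : PolyTime fun a => (f a).2 :=
  comp (of_op .snd Polynomial.X (fun _ => rfl) (by rintro ⟨a, b⟩; simp [esize_pair]; omega)) hf

theorem add {f g : α → ℕ} (hf : PolyTime f) (hg : PolyTime g) : PolyTime fun a => f a + g a :=
  comp (g := fun x : ℕ × ℕ => x.1 + x.2) (of_op .add Polynomial.X (fun _ => rfl) (by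
    rintro ⟨a, b⟩; have := esize_add_le a b; simp [esize_pair]; omega)) (hf.pair hg)

theorem mul {f g : α → ℕ} (hf : PolyTime f) (hg : PolyTime g) : PolyTime fun a => f a * g a :=
  comp (g := fun x : ℕ × ℕ => x.1 * x.2) (of_op .mul Polynomial.X (fun _ => rfl) (by
    rintro ⟨a, b⟩; have := esize_mul_le a b; simp [esize_pair]; omega)) (hf.pair hg)

theorem sub {f g : α → ℕ} (hf : PolyTime f) (hg : PolyTime g) : PolyTime fun a => f a - g a :=
  comp (g := fun x : ℕ × ℕ => x.1 - x.2) (of_op .sub Polynomial.X (fun _ => rfl) (by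
    rintro ⟨a, b⟩; have := esize_mono (Nat.sub_le a b); simp [esize_pair]; omega)) (hf.pair hg)

theorem div {f g : α → ℕ} (hf : PolyTime f) (hg : PolyTime g) : PolyTime fun a => f a / g a :=
  comp (g := fun x : ℕ × ℕ => x.1 / x.2) (of_op .div Polynomial.X (fun _ => rfl) (by
    rintro ⟨a, b⟩; have := esize_mono (Nat.div_le_self a b); simp [esize_pair]; omega)) (hf.pair hg)

/-- A nonempty list and the pair of its head and tail have the same encoding, so no work beyond
pairing is needed. -/
theorem cons {f : α → β} {g : α → List β} (hf : PolyTime f) (hg : PolyTime g) :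
    PolyTime fun a => f a :: g a :=
  comp (g := fun x : β × List β => x.1 :: x.2)
    (of_op .id Polynomial.X (fun _ => rfl) (by rintro ⟨a, b⟩; simp [esize_pair, esize_cons]))
    (hf.pair hg)

/-- The empty list is the leaf `0`, on which the projection returns its default `0`; this is also
the encoding of the default value here and in the two lemmas below. -/
theorem headD_zero {f : α → List ℕ} (hf : PolyTime f) : PolyTime fun a => (f a).headD 0 :=
  comp (g := fun l : List ℕ => l.headD 0) (of_op .fst Polynomial.X
    (by rintro (_ | ⟨b, l⟩) <;> rfl)
    (by rintro (_ | ⟨b, l⟩) <;> simp [esize_nil, esize_cons, esize_nat]; omega)) hf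

theorem headD_nil {f : α → List (List β)} (hf : PolyTime f) : PolyTime fun a => (f a).headD [] :=
  comp (g := fun l : List (List β) => l.headD []) (of_op .fst Polynomial.X
    (by rintro (_ | ⟨b, l⟩) <;> rfl)
    (by rintro (_ | ⟨b, l⟩) <;> simp [esize_nil, esize_cons]; omega)) hf

theorem tail {f : α → List β} (hf : PolyTime f) : PolyTime fun a => (f a).tail :=
  comp (g := fun l : List β => l.tail) (of_op .snd Polynomial.X
    (by rintro (_ | ⟨b, l⟩) <;> rfl)
    (fun l => by simpa using esize_tail_le l)) hf

/-- The test is the truncated difference `g a - f a`, which is nonzero exactly when `f a < g a`. -/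
theorem ite_lt {f g : α → ℕ} {u v : α → β} (hf : PolyTime f) (hg : PolyTime g) (hu : PolyTime u)
    (hv : PolyTime v) : PolyTime fun a => if f a < g a then u a else v a := by
  obtain ⟨c, C, hc⟩ := hg.sub hf
  obtain ⟨p, P, hp⟩ := hu
  obtain ⟨q, Q, hq⟩ := hv
  refine ⟨.cond c p q, 1 + C + P + Q, fun a => ?_⟩
  obtain ⟨r, hr, hrC⟩ := hc a
  obtain ⟨s, hs, hsP⟩ := hp a
  obtain ⟨t, ht, htQ⟩ := hq a
  simp only [Polynomial.eval_add, Polynomial.eval_one]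
  by_cases h : f a < g a
  · rw [if_pos h]
    refine ⟨_, .condTrue hr ?_ hs, by omega⟩
    intro h0
    have : g a - f a = 0 := Data.num.inj h0
    omega
  · rw [if_neg h]
    have h0 : g a - f a = 0 := by omega
    have hr' : Eval c (enc a) (.num (g a - f a)) r := hr
    rw [h0] at hr'
    exact ⟨_, .condFalse hr' ht, by omega⟩

end PolyTime

/-- A loop whose states all have size at most `B` runs for a time polynomial in `B`, multiplied by
the number of its rounds. -/
theorem exists_eval_loop {σ : Type} [Enc σ] {test : σ → ℕ} {step : σ → σ} {c f : Prog}
    {T : Polynomial ℕ} (hc : ∀ s, ∃ t, Eval c (enc s) (.num (test s)) t ∧ t ≤ T.eval (esize s))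
    (hf : ∀ s, test s ≠ 0 → ∃ t, Eval f (enc s) (enc (step s)) t ∧ t ≤ T.eval (esize s))
    (N : ℕ) (s : σ) (B : ℕ) (hlt : ∀ k < N, test (step^[k] s) ≠ 0) (hN : test (step^[N] s) = 0)
    (hB : ∀ k ≤ N, esize (step^[k] s) ≤ B) :
    ∃ t, Eval (.loop c f) (enc s) (enc (step^[N] s)) t ∧ t ≤ (N + 1) * (1 + 2 * T.eval B) := by
  induction N generalizing s with
  | zero =>
    obtain ⟨t, ht, hle⟩ := hc s
    rw [Function.iterate_zero, id] at hN
    rw [hN] at ht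
    refine ⟨_, .loopStop ht, ?_⟩
    have := hle.trans (eval_le_eval T (hB 0 le_rfl))
    omega
  | succ N ih =>
    obtain ⟨t, ht, htle⟩ := hc s
    have h0 : test s ≠ 0 := hlt 0 (by omega)
    obtain ⟨r, hr, hrle⟩ := hf s h0
    obtain ⟨u, hu, hule⟩ := ih (step s) (fun k hk => hlt (k + 1) (by omega)) hN
      (fun k hk => hB (k + 1) (by omega))
    refine ⟨_, .loopStep ht (fun h => h0 (Data.num.inj h)) hr hu, ?_⟩
    have h1 := htle.trans (eval_le_eval T (hB 0 (by omega)))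
    have h2 := hrle.trans (eval_le_eval T (hB 0 (by omega)))
    calc 1 + t + r + u ≤ 1 + T.eval B + T.eval B + (N + 1) * (1 + 2 * T.eval B) := by omega
      _ = (N + 1 + 1) * (1 + 2 * T.eval B) := by ring

/-- Iterating a polynomial-time function a number of times given in binary. -/
theorem PolyTime.exists_eval_iterate {α : Type} [Enc α] {f : α → α} (hf : PolyTime f) :
    ∃ (p : Prog) (P : Polynomial ℕ), ∀ (N : ℕ) (a : α) (B : ℕ), N ≤ B →
      (∀ k ≤ N, esize (f^[k] a) ≤ B) →
        ∃ t, Eval p (enc (N, a)) (enc (f^[N] a)) t ∧ t ≤ P.eval B := by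
  have hstep : PolyTime fun s : ℕ × α => (s.1 - 1, f s.2) :=
    (PolyTime.id.fst.sub (const 1)).pair (hf.comp PolyTime.id.snd)
  have htest : PolyTime fun s : ℕ × α => s.1 := PolyTime.id.fst
  obtain ⟨p, P, hp⟩ := hstep
  obtain ⟨c, C, hc⟩ := htest
  obtain ⟨q, Q, hq⟩ := PolyTime.snd (PolyTime.id (α := ℕ × α))
  have hiter : ∀ (k N : ℕ) (a : α),
      (fun s : ℕ × α => (s.1 - 1, f s.2))^[k] (N, a) = (N - k, f^[k] a) := by
    intro k
    induction k with
    | zero => intro N a; rfl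
    | succ k ih =>
      intro N a
      rw [Function.iterate_succ_apply, ih, Function.iterate_succ_apply, Nat.sub_sub, add_comm 1 k]
  -- The state is a counter and a value. Both have at most about `B` bits, hence the bound `2 * B +
  -- 2` on its size.
  refine ⟨.comp (.loop c p) q, 1 + (Polynomial.X + 1) * (1 + 2 * (C + P).comp
    (2 * Polynomial.X + 2)) + Q.comp (2 * Polynomial.X + 2), fun N a B hN hB => ?_⟩
  have hsz : ∀ k ≤ N, esize ((fun s : ℕ × α => (s.1 - 1, f s.2))^[k] (N, a)) ≤ 2 * B + 2 := by
    intro k hk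
    rw [hiter, esize_pair, esize_nat]
    have h1 := hB k hk
    have h2 : Nat.size (N - k) ≤ B := Nat.size_le.2 (by
      calc N - k ≤ B := by omega
        _ < 2 ^ B := Nat.lt_two_pow_self)
    omega
  obtain ⟨t, ht, hle⟩ := exists_eval_loop (test := fun s : ℕ × α => s.1)
    (step := fun s => (s.1 - 1, f s.2)) (c := c) (f := p) (T := C + P)
    (fun s => by
      obtain ⟨t, h1, h2⟩ := hc s
      exact ⟨t, h1, h2.trans (by simp)⟩)
    (fun s _ => by
      obtain ⟨t, h1, h2⟩ := hp s
      exact ⟨t, h1, h2.trans (by simp)⟩) N (N, a) (2 * B + 2)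
    (fun k hk => by rw [hiter]; simp only; omega) (by rw [hiter]; simp) hsz
  rw [hiter] at ht
  obtain ⟨u, hu, hule⟩ := hq (N - N, f^[N] a)
  refine ⟨_, .comp ht hu, ?_⟩
  have hlast := hsz N le_rfl
  rw [hiter] at hlast
  have h1 := hule.trans (eval_le_eval Q hlast)
  have h2 : (N + 1) * (1 + 2 * (C + P).eval (2 * B + 2))
      ≤ (B + 1) * (1 + 2 * (C + P).eval (2 * B + 2)) := Nat.mul_le_mul_right _ (by omega)
  simp only [Polynomial.eval_add, Polynomial.eval_one, Polynomial.eval_mul, Polynomial.eval_X,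
    Polynomial.eval_comp, Polynomial.eval_ofNat] at h1 h2 hle ⊢
  omega

theorem esize_foldl_le {α β : Type} [Enc α] [Enc β] {f : β → α → β} {g : ℕ} {l : List α}
    (h : ∀ b, ∀ a ∈ l, esize (f b a) ≤ esize b + g) (b : β) :
    esize (l.foldl f b) ≤ esize b + l.length * g := by
  induction l generalizing b with
  | nil => simp
  | cons a l ih =>
    have h1 := ih (fun b a ha => h b a (by simp [ha])) (f b a)
    have h2 := h b a (by simp)
    rw [List.foldl_cons, List.length_cons, add_mul]
    omega

namespace PolyTime

variable {σ α β γ : Type} [Enc σ] [Enc α] [Enc β] [Enc γ]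

/-- A fold takes polynomial time if every step increases the size of the accumulator by a
polynomial amount only. -/
theorem foldl {f : σ → β → α → β} {b₀ : σ → β} {l : σ → List α}
    (hf : PolyTime fun y : σ × β × α => f y.1 y.2.1 y.2.2)
    (hb : PolyTime b₀) (hl : PolyTime l) (G : Polynomial ℕ)
    (hG : ∀ x b a, esize (f x b a) ≤ esize b + G.eval (esize x + esize a)) :
    PolyTime fun x => (l x).foldl (f x) (b₀ x) := by
  obtain ⟨p, P, hp⟩ := hf
  let step : σ × β × List α → σ × β × List α := fun s =>
    match s with
    | (x, b, []) => (x, b, [])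
    | (x, b, a :: l) => (x, f x b a, l)
  let test : σ × β × List α → ℕ := fun s => match s.2.2 with | [] => 0 | _ => 1
  -- The loop state consists of the parameter, the accumulator and the rest of the list. The rest is
  -- nonempty exactly when it is a pair.
  let o : Op → Prog := Prog.op
  let c : Prog := .comp (o .snd) (.comp (o .snd) (o .isPair))
  let arg : Prog := .pair (o .fst) (.pair (.comp (o .snd) (o .fst))
    (.comp (o .snd) (.comp (o .snd) (o .fst))))
  let body : Prog := .pair (o .fst) (.pair (.comp arg p) (.comp (o .snd) (.comp (o .snd) (o .snd))))
  have hc : ∀ s, ∃ t, Eval c (enc s) (.num (test s)) t ∧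
      t ≤ (20 + 20 * Polynomial.X + P).eval (esize s) := by
    rintro ⟨x, b, _ | ⟨a, l⟩⟩
    · refine ⟨_, .comp (.op _ _) (.comp (.op _ _) (.op _ _)), ?_⟩
      simp [enc, Op.apply, esize, Data.size, encodeList]
      omega
    · refine ⟨_, .comp (.op _ _) (.comp (.op _ _) (.op _ _)), ?_⟩
      simp [enc, Op.apply, esize, Data.size, encodeList]
      omega
  have hbody : ∀ s, test s ≠ 0 → ∃ t, Eval body (enc s) (enc (step s)) t ∧
      t ≤ (20 + 20 * Polynomial.X + P).eval (esize s) := by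
    rintro ⟨x, b, _ | ⟨a, l⟩⟩ h
    · exact absurd rfl h
    · obtain ⟨t, ht, hle⟩ := hp (x, b, a)
      have harg : ∃ t, Eval arg (enc (x, b, a :: l)) (enc (x, b, a)) t ∧
          t ≤ 10 + 12 * esize (x, b, a :: l) := by
        refine ⟨_, .pair (.op _ _) (.pair (.comp (.op _ _) (.op _ _))
          (.comp (.op _ _) (.comp (.op _ _) (.op _ _)))), ?_⟩
        simp [enc, Op.apply, esize, Data.size, encodeList]
        omega
      obtain ⟨u, hu, hule⟩ := harg
      refine ⟨_, .pair (.op _ _) (.pair (.comp hu ht)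
        (.comp (.op _ _) (.comp (.op _ _) (.op _ _)))), ?_⟩
      have hle' := hle.trans (eval_le_eval P (show esize (x, b, a) ≤ esize (x, b, a :: l) by
        simp only [esize_pair, esize_cons]; omega))
      simp only [Polynomial.eval_add, Polynomial.eval_mul, Polynomial.eval_X,
        Polynomial.eval_ofNat] at hle' ⊢
      simp [enc, Op.apply, esize, Data.size, encodeList] at hule hle' ⊢
      omega
  have hiter : ∀ (l : List α) (k : ℕ) (x : σ) (b : β), k ≤ l.length →
      step^[k] (x, b, l) = (x, (l.take k).foldl (f x) b, l.drop k) := by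
    intro l k
    induction k generalizing l with
    | zero => intro x b _; simp
    | succ k ih =>
      intro x b hk
      cases l with
      | nil => simp at hk
      | cons a l =>
        rw [Function.iterate_succ_apply]
        simpa using ih l x (f x b a) (by simpa using hk)
  have hdrop : ∀ (l : List α) (k : ℕ), esize (l.drop k) ≤ esize l := by
    intro l k
    induction k generalizing l with
    | zero => simp
    | succ k ih =>
      rw [← List.drop_tail]
      exact (ih _).trans (esize_tail_le l)
  have hloop : PolyTime fun s : σ × β × List α => s.2.2.foldl (f s.1) s.2.1 := by
    -- Size of all loop states: the accumulator gains at most the value of `G` at the input size in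
    -- each round, and there are fewer rounds than the input size.
    let BB : Polynomial ℕ := 2 * Polynomial.X + Polynomial.X * G.comp Polynomial.X
    let R : Polynomial ℕ := 20 + 20 * Polynomial.X + P
    obtain ⟨q, Q, hq⟩ := PolyTime.fst (PolyTime.snd (PolyTime.id (α := σ × β × List α)))
    refine ⟨.comp (.loop c body) q,
      1 + (Polynomial.X + 1) * (1 + 2 * R.comp BB) + Q.comp BB, ?_⟩
    rintro ⟨x, b, l⟩
    have hsz : ∀ k ≤ l.length, esize (step^[k] (x, b, l)) ≤ BB.eval (esize (x, b, l)) := by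
      intro k hk
      rw [hiter l k x b hk]
      have h1 := esize_foldl_le (f := f x) (g := G.eval (esize (x, b, l))) (l := l.take k)
        (fun b' a ha => (hG x b' a).trans (Nat.add_le_add_left (eval_le_eval G (by
          have := esize_le_of_mem (List.mem_of_mem_take ha)
          simp only [esize_pair]; omega)) _)) b
      have h2 : (l.take k).length * G.eval (esize (x, b, l))
          ≤ esize (x, b, l) * G.eval (esize (x, b, l)) := Nat.mul_le_mul_right _ (by
            have := length_lt_esize l
            simp only [esize_pair, List.length_take]; omega)
      have h3 := hdrop l k
      simp only [BB, Polynomial.eval_add, Polynomial.eval_mul, Polynomial.eval_X,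
        Polynomial.eval_ofNat, Polynomial.comp_X]
      have h4 : esize (x, b, l) = esize x + (esize b + esize l + 1) + 1 := rfl
      have h5 : esize (x, (l.take k).foldl (f x) b, l.drop k)
        = esize x + (esize ((l.take k).foldl (f x) b) + esize (l.drop k) + 1) + 1 := rfl
      omega
    obtain ⟨t, ht, hle⟩ := exists_eval_loop hc hbody l.length (x, b, l)
      (BB.eval (esize (x, b, l)))
      (fun k hk => by
        rw [hiter l k x b hk.le]
        cases h : l.drop k with
        | nil => rw [List.drop_eq_nil_iff] at h; omega
        | cons a l => exact one_ne_zero)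
      (by rw [hiter l _ x b le_rfl, List.drop_length]) hsz
    have hlast := hsz _ le_rfl
    rw [hiter l _ x b le_rfl, List.take_length, List.drop_length] at ht hlast
    obtain ⟨u, hu, hule⟩ := hq (x, l.foldl (f x) b, [])
    refine ⟨_, .comp ht hu, ?_⟩
    have h1 := hule.trans (eval_le_eval Q hlast)
    have h2 : (l.length + 1) * (1 + 2 * R.eval (BB.eval (esize (x, b, l))))
        ≤ (esize (x, b, l) + 1) * (1 + 2 * R.eval (BB.eval (esize (x, b, l)))) :=
      Nat.mul_le_mul_right _ (by
        have := length_lt_esize l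
        simp only [esize_pair]; omega)
    have h3 := hle.trans h2
    simp only [Polynomial.eval_add, Polynomial.eval_one, Polynomial.eval_mul, Polynomial.eval_X,
      Polynomial.eval_comp, Polynomial.eval_ofNat] at h1 h3 ⊢
    omega
  exact hloop.comp (PolyTime.id.pair (hb.pair hl))

theorem reverse {l : σ → List α} (hl : PolyTime l) : PolyTime fun x => (l x).reverse := by
  have h := foldl (f := fun (_ : σ) (b : List α) (a : α) => a :: b) (b₀ := fun _ => [])
    (cons PolyTime.id.snd.snd PolyTime.id.snd.fst) nil hl (Polynomial.X + 1)
    (fun x b a => by simp only [esize_cons, Polynomial.eval_add, Polynomial.eval_X,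
      Polynomial.eval_one]; omega)
  convert h using 2 with x
  simp [List.foldl_flip_cons_eq_append]

theorem map {g : σ → α → β} {l : σ → List α} (hg : PolyTime fun y : σ × α => g y.1 y.2)
    (hl : PolyTime l) : PolyTime fun x => (l x).map (g x) := by
  obtain ⟨P, hP⟩ := hg.exists_esize_le
  have h := foldl (f := fun x (b : List β) a => g x a :: b) (b₀ := fun _ => [])
    (cons (hg.comp (PolyTime.id.fst.pair PolyTime.id.snd.snd)) PolyTime.id.snd.fst) nil hl
    (P.comp (Polynomial.X + 1) + 1) (fun x b a => by
      have := hP (x, a)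
      simp only [esize_pair] at this
      simp only [esize_cons, Polynomial.eval_add, Polynomial.eval_X, Polynomial.eval_one,
        Polynomial.eval_comp]
      omega)
  convert h.reverse using 2 with x
  have : ∀ (l : List α) (b : List β),
      l.foldl (fun b a => g x a :: b) b = (l.map (g x)).reverse ++ b := by
    intro l
    induction l with
    | nil => simp
    | cons a l ih => intro b; simp [ih]
  simp [this]

theorem sum {l : σ → List ℕ} (hl : PolyTime l) : PolyTime fun x => (l x).sum := by
  have h := foldl (f := fun (_ : σ) (b a : ℕ) => b + a) (b₀ := fun _ => 0)
    (add PolyTime.id.snd.fst PolyTime.id.snd.snd) (const 0) hl Polynomial.X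
    (fun x b a => by
      have := esize_add_le b a
      simp only [Polynomial.eval_X]; omega)
  convert h using 2 with x
  exact List.sum_eq_foldl

theorem prod {l : σ → List ℕ} (hl : PolyTime l) : PolyTime fun x => (l x).prod := by
  have h := foldl (f := fun (_ : σ) (b a : ℕ) => b * a) (b₀ := fun _ => 1)
    (mul PolyTime.id.snd.fst PolyTime.id.snd.snd) (const 1) hl Polynomial.X
    (fun x b a => by
      have := esize_mul_le b a
      simp only [Polynomial.eval_X]; omega)
  convert h using 2 with x
  exact List.prod_eq_foldl

end PolyTime

/-- An element of smallest value among `a₀` and the elements of `l`. -/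
def argmin {α : Type} (g : α → ℕ) (a₀ : α) (l : List α) : α :=
  l.foldl (fun b a => if g a < g b then a else b) a₀

theorem argmin_mem {α : Type} (g : α → ℕ) (a₀ : α) (l : List α) :
    argmin g a₀ l = a₀ ∨ argmin g a₀ l ∈ l := by
  induction l generalizing a₀ with
  | nil => exact Or.inl rfl
  | cons a l ih =>
    change argmin g (if g a < g a₀ then a else a₀) l = a₀ ∨
      argmin g (if g a < g a₀ then a else a₀) l ∈ a :: l
    rcases ih (if g a < g a₀ then a else a₀) with h | h
    · rw [h]
      split_ifs <;> simp
    · exact Or.inr (List.mem_cons_of_mem _ h)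

theorem argmin_le {α : Type} (g : α → ℕ) (a₀ : α) (l : List α) :
    g (argmin g a₀ l) ≤ g a₀ ∧ ∀ a ∈ l, g (argmin g a₀ l) ≤ g a := by
  induction l generalizing a₀ with
  | nil => exact ⟨le_rfl, by simp⟩
  | cons a l ih =>
    obtain ⟨h1, h2⟩ := ih (if g a < g a₀ then a else a₀)
    change g (argmin g (if g a < g a₀ then a else a₀) l) ≤ g a₀ ∧
      ∀ c ∈ a :: l, g (argmin g (if g a < g a₀ then a else a₀) l) ≤ g c
    have h3 : g (if g a < g a₀ then a else a₀) ≤ g a ∧ g (if g a < g a₀ then a else a₀) ≤ g a₀ := by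
      split_ifs <;> omega
    refine ⟨h1.trans h3.2, fun c hc => ?_⟩
    rcases List.mem_cons.1 hc with rfl | hc
    · exact h1.trans h3.1
    · exact h2 c hc

theorem PolyTime.argmin {σ α : Type} [Enc σ] [Enc α] {g : σ → α → ℕ} {a₀ : σ → α}
    {l : σ → List α} (hg : PolyTime fun y : σ × α => g y.1 y.2) (ha : PolyTime a₀)
    (hl : PolyTime l) : PolyTime fun x => argmin (g x) (a₀ x) (l x) :=
  foldl (f := fun x b a => if g x a < g x b then a else b)
    (ite_lt (hg.comp (PolyTime.id.fst.pair PolyTime.id.snd.snd))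
      (hg.comp (PolyTime.id.fst.pair PolyTime.id.snd.fst)) PolyTime.id.snd.snd PolyTime.id.snd.fst)
    ha hl Polynomial.X (fun x b a => by
      simp only [Polynomial.eval_X]
      split_ifs <;> omega)

/-! ### Integer square roots -/

/-- The numbers `n / 4 ^ k` until they vanish, in increasing order, followed by `l`. -/
def quarters (n : ℕ) (l : List ℕ) : List ℕ :=
  if h : n = 0 then l else quarters (n / 4) (n :: l)
termination_by n
decreasing_by omega

/-- Binary digits of the root: $\lfloor\sqrt n\rfloor$ is $2r$ or $2r+1$ for $r=\lfloor\sqrt{\lfloor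
n/4\rfloor}\rfloor$, and comparing $n$ with $(2r+1)^2$ decides which. -/
theorem foldl_quarters (n : ℕ) (l : List ℕ) :
    (quarters n l).foldl (fun r x => if x < (2 * r + 1) * (2 * r + 1) then 2 * r else 2 * r + 1) 0
      = l.foldl (fun r x => if x < (2 * r + 1) * (2 * r + 1) then 2 * r else 2 * r + 1)
          (Nat.sqrt n) := by
  induction n using Nat.strong_induction_on generalizing l with
  | _ n ih =>
    rw [quarters]
    split_ifs with h
    · simp [h]
    · rw [ih (n / 4) (by omega), List.foldl_cons]
      congr 1
      set r := Nat.sqrt (n / 4) with hr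
      have h1 : r * r ≤ n / 4 := Nat.sqrt_le _
      have h2 : n / 4 < (r + 1) * (r + 1) := Nat.lt_succ_sqrt _
      have h4 := Nat.div_add_mod n 4
      have h5 := Nat.mod_lt n (show 4 > 0 by norm_num)
      split_ifs with h3
      · have h6 : 2 * r * (2 * r) = 4 * (r * r) := by ring
        exact Nat.eq_sqrt.2 ⟨by omega, h3⟩
      · exact Nat.eq_sqrt.2 ⟨by omega, by nlinarith⟩

/-- A positive number loses at least one bit when divided by 4, so there are at most `Nat.size n`
rounds, each adding one entry of at most `M` bits. -/
theorem exists_iterate_eq_quarters (n M : ℕ) (hM : Nat.size n ≤ M) (l : List ℕ) :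
    ∃ N ≤ Nat.size n,
      (fun s : ℕ × List ℕ => (s.1 / 4, s.1 :: s.2))^[N] (n, l) = (0, quarters n l) ∧
      (∀ k < N, ((fun s : ℕ × List ℕ => (s.1 / 4, s.1 :: s.2))^[k] (n, l)).1 ≠ 0) ∧
      ∀ k ≤ N, esize ((fun s : ℕ × List ℕ => (s.1 / 4, s.1 :: s.2))^[k] (n, l))
        ≤ esize l + (Nat.size n + 1) * (M + 3) := by
  induction n using Nat.strong_induction_on generalizing l with
  | _ n ih =>
    rcases Nat.eq_zero_or_pos n with h | h
    · subst h
      refine ⟨0, le_rfl, by rw [quarters]; simp, by simp, ?_⟩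
      intro k hk
      obtain rfl : k = 0 := by omega
      simp [esize_pair, esize_nat]
      omega
    · have hlt : Nat.size (n / 4) + 1 ≤ Nat.size n := by
        rw [Nat.succ_le_iff, Nat.lt_size, ← Nat.succ_le_succ_iff]
        by_contra hcon
        have h1 : n < 2 ^ Nat.size (n / 4) := by omega
        rcases Nat.eq_zero_or_pos (Nat.size (n / 4)) with h0 | h0
        · rw [h0] at h1; omega
        · obtain ⟨j, hj⟩ : ∃ j, Nat.size (n / 4) = j + 1 := ⟨_, (Nat.succ_pred_eq_of_pos h0).symm⟩
          have h2 : 2 ^ j ≤ n / 4 := Nat.lt_size.1 (by omega)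
          rw [hj, pow_succ] at h1
          omega
      obtain ⟨N, hN, h1, h2, h3⟩ := ih (n / 4) (by omega) (by omega) (n :: l)
      refine ⟨N + 1, by omega, ?_, ?_, ?_⟩
      · rw [Function.iterate_succ_apply, h1]
        conv_rhs => rw [quarters, dif_neg h.ne']
      · rintro (_ | k) hk
        · exact h.ne'
        · exact h2 k (by omega)
      · rintro (_ | k) hk
        · simp [esize_pair, esize_nat]
          nlinarith
        · refine (h3 k (by omega)).trans ?_
          have : (Nat.size (n / 4) + 1) * (M + 3) + (M + 3) ≤ (Nat.size n + 1) * (M + 3) := by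
            nlinarith
          rw [esize_cons, esize_nat]
          omega

namespace PolyTime

variable {σ : Type} [Enc σ]

theorem quarters : PolyTime fun n : ℕ => quarters n [] := by
  have hstep : PolyTime fun s : ℕ × List ℕ => (s.1 / 4, s.1 :: s.2) :=
    (PolyTime.id.fst.div (const 4)).pair (cons PolyTime.id.fst PolyTime.id.snd)
  have htest : PolyTime fun s : ℕ × List ℕ => s.1 := PolyTime.id.fst
  obtain ⟨p, P, hp⟩ := hstep
  obtain ⟨c, C, hc⟩ := htest
  obtain ⟨q, Q, hq⟩ := PolyTime.snd (PolyTime.id (α := ℕ × List ℕ))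
  obtain ⟨u, U, hu⟩ := (PolyTime.id (α := ℕ)).pair (nil (β := ℕ))
  let B : Polynomial ℕ := 1 + (Polynomial.X + 1) * (Polynomial.X + 3)
  refine ⟨.comp u (.comp (.loop c p) q),
    2 + U + (Polynomial.X + 1) * (1 + 2 * (C + P).comp B) + Q.comp B, fun n => ?_⟩
  obtain ⟨N, hN, h1, h2, h3⟩ := exists_iterate_eq_quarters n (esize n) (by simp [esize_nat]) []
  have hB : ∀ k ≤ N, esize ((fun s : ℕ × List ℕ => (s.1 / 4, s.1 :: s.2))^[k] (n, []))
      ≤ B.eval (esize n) := by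
    intro k hk
    refine (h3 k hk).trans ?_
    simp only [B, Polynomial.eval_add, Polynomial.eval_one, Polynomial.eval_mul,
      Polynomial.eval_X, Polynomial.eval_ofNat, esize_nil]
    gcongr
    simp [esize_nat]
  obtain ⟨t, ht, hle⟩ := exists_eval_loop (test := fun s : ℕ × List ℕ => s.1)
    (step := fun s => (s.1 / 4, s.1 :: s.2)) (c := c) (f := p) (T := C + P)
    (fun s => by
      obtain ⟨t, h1, h2⟩ := hc s
      exact ⟨t, h1, h2.trans (by simp)⟩)
    (fun s _ => by
      obtain ⟨t, h1, h2⟩ := hp s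
      exact ⟨t, h1, h2.trans (by simp)⟩) N (n, []) (B.eval (esize n)) h2 (by rw [h1]) hB
  have hlast := hB N le_rfl
  rw [h1] at ht hlast
  obtain ⟨a, ha, hale⟩ := hu n
  obtain ⟨b, hb, hble⟩ := hq (0, JRP.quarters n [])
  refine ⟨_, .comp ha (.comp ht hb), ?_⟩
  have h4 := hble.trans (eval_le_eval Q hlast)
  have h5 : (N + 1) * (1 + 2 * (C + P).eval (B.eval (esize n)))
      ≤ (esize n + 1) * (1 + 2 * (C + P).eval (B.eval (esize n))) :=
    Nat.mul_le_mul_right _ (by rw [esize_nat]; omega)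
  have h6 := hle.trans h5
  simp only [Polynomial.eval_add, Polynomial.eval_one, Polynomial.eval_mul, Polynomial.eval_X,
    Polynomial.eval_comp, Polynomial.eval_ofNat] at h4 h6 ⊢
  omega

theorem sqrt {f : σ → ℕ} (hf : PolyTime f) : PolyTime fun x => Nat.sqrt (f x) := by
  have hr : PolyTime fun y : σ × ℕ × ℕ => 2 * y.2.1 := (const 2).mul PolyTime.id.snd.fst
  have h := foldl (f := fun (_ : σ) (r x : ℕ) =>
      if x < (2 * r + 1) * (2 * r + 1) then 2 * r else 2 * r + 1) (b₀ := fun _ => 0)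
    (l := fun x => JRP.quarters (f x) [])
    (ite_lt PolyTime.id.snd.snd ((hr.add (const 1)).mul (hr.add (const 1))) hr (hr.add (const 1)))
    (const 0) (quarters.comp hf) 10 (fun x b a => by
      have h1 := esize_mul_le 2 b
      have h2 := esize_add_le (2 * b) 1
      have h3 : esize 2 = 3 := rfl
      have h4 : esize 1 = 2 := rfl
      simp only [Polynomial.eval_ofNat]
      split_ifs <;> omega)
  convert h using 2 with x
  rw [foldl_quarters]
  rfl

end PolyTime

end JRP

namespace JRP

open Enc

/-! ### The algorithm -/

/-- Prepends each of the two bits to each of the masks. -/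
def extendMasks (l : List (List ℕ)) : List (List ℕ) :=
  l.foldl (fun b x => (0 :: x) :: (1 :: x) :: b) []

/-- All lists of `k` bits. -/
def masks (k : ℕ) : List (List ℕ) := extendMasks^[k] [[]]

/-- One step of reading off the gaps between the positions that are marked both in a mask `R` and in
the mask `S`, both listed from the last position to the first one. The state consists of the rest
of `S`, the number of unmarked positions before the previously marked one, and the gaps after it. -/
def gapStep (s : List ℕ × ℕ × List ℕ) (b : ℕ) : List ℕ × ℕ × List ℕ :=
  (s.1.tail, if 0 < b * s.1.headD 0 then (0, (s.2.1 + 1) :: s.2.2) else (s.2.1 + 1, s.2.2))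

/-- Positions are read from last to first, so the gap still open at the end of the fold starts at
position `0`. It is closed here and comes first in the list. -/
def gapsFrom (s : List ℕ × ℕ × List ℕ) (R : List ℕ) : List ℕ :=
  ((R.foldl gapStep s).2.1 + 1) :: (R.foldl gapStep s).2.2

/-- The gaps between position `0`, the positions marked in both masks, and the position after the
last one. -/
def gaps (S R : List ℕ) : List ℕ := gapsFrom (S, 0, []) R

/-- The cost of a cycle with durations `g`, at cost `it.1` per order and holding cost `2 * it.2`. -/
def cycleCost (it : ℕ × ℕ) (g : List ℕ) : ℕ := (g.map fun x => it.1 + it.2 * (x * x)).sum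

/-- An item whose ideal order interval is less than `M ^ 3`. -/
def IsShort (M : ℕ) (it : ℕ × ℕ) : Prop := it.1 < it.2 * (M * M * M * (M * M * M))

instance (M : ℕ) (it : ℕ × ℕ) : Decidable (IsShort M it) := Nat.decLt _ _

/-- The cheapest cycle that uses only the joint orders marked in `S`. -/
def itemGaps (mk : List (List ℕ)) (S : List ℕ) (it : ℕ × ℕ) : List ℕ :=
  gaps S (argmin (fun R => cycleCost it (gaps S R)) (mk.headD []) mk)

def shortCost (M : ℕ) (mk : List (List ℕ)) (S : List ℕ) (it : ℕ × ℕ) : ℕ :=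
  if IsShort M it then cycleCost it (itemGaps mk S it) else 0

/-- The summand `1` is the order at position `0`, which every cycle contains and no mask records.
Long items do not influence the choice of the mask. -/
def totalCost (u₀ M : ℕ) (items : List (ℕ × ℕ)) (mk : List (List ℕ)) (S : List ℕ) : ℕ :=
  u₀ * (1 + S.sum) + (items.map (shortCost M mk S)).sum

def bestMask (u₀ M : ℕ) (items : List (ℕ × ℕ)) (mk : List (List ℕ)) : List ℕ :=
  argmin (totalCost u₀ M items mk) (mk.headD []) mk

/-- For a long item, this is the ideal interval $\sqrt{K/H}$, in grid steps, rounded down to a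
multiple of $M^2$. All long items then share the joint orders at multiples of $M^2$ steps. -/
def itemPlan (M : ℕ) (mk : List (List ℕ)) (S : List ℕ) (it : ℕ × ℕ) : List ℕ :=
  if IsShort M it then itemGaps mk S it
  else [Nat.sqrt (it.1 / (it.2 * (M * M * (M * M)))) * (M * M)]

/-- The instance as the machine receives it. -/
abbrev RawInst : Type := (ℕ × ℕ) × List ((ℕ × ℕ) × (ℕ × ℕ))

def commonDen (x : RawInst) : ℕ := x.1.2 * (x.2.map fun it => it.1.2 * it.2.2).prod

def clearDen (D : ℕ) (a : ℕ × ℕ) : ℕ := a.1 * (D / a.2)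

/-- Integral multiples of all costs, with a positive joint ordering cost. -/
def intJoint (M : ℕ) (x : RawInst) : ℕ :=
  M * clearDen (commonDen x) x.1 + (1 - clearDen (commonDen x) x.1)

def intItems (M : ℕ) (x : RawInst) : List (ℕ × ℕ) :=
  x.2.map fun it => (M * clearDen (commonDen x) it.1, M * clearDen (commonDen x) it.2)

def totalHolding (items : List (ℕ × ℕ)) : ℕ := (items.map Prod.snd).sum

/-- The costs when time is measured in grid steps of length `r / (H * M)`. -/
def gridItems (H M r : ℕ) (items : List (ℕ × ℕ)) : List (ℕ × ℕ) :=
  items.map fun it => (it.1 * (H * M * (H * M)), it.2 * (r * r))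

/-- The grid step $r/(HM)$ is about $1/M$ times $\sqrt{k_0/H}$, the ideal interval of all items
merged. Costs are multiplied by $(HM)^2$ to stay integral. -/
def solveInt (k₀ M : ℕ) (items : List (ℕ × ℕ)) (mk : List (List ℕ)) : List (List (ℕ × ℕ)) :=
  let H := totalHolding items
  let r := Nat.sqrt (k₀ * H)
  let its := gridItems H M r items
  let S := bestMask (k₀ * (H * M * (H * M))) M its mk
  its.map fun it => (itemPlan M mk S it).map fun x => (x * r, H * M)

def solve (M : ℕ) (x : RawInst) (mk : List (List ℕ)) : List (List (ℕ × ℕ)) :=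
  solveInt (intJoint M x) M (intItems M x) mk

/-! ### Its running time -/

namespace PolyTime

variable {σ : Type} [Enc σ]

theorem extendMasks : PolyTime extendMasks :=
  foldl (f := fun _ b x => (0 :: x) :: (1 :: x) :: b) (b₀ := fun _ : List (List ℕ) => [])
    (l := fun l => l)
    (by apply_rules [cons, const, PolyTime.id, fst, snd]) nil PolyTime.id (2 * Polynomial.X + 7)
    (fun x b a => by
      have h1 : esize 0 = 1 := rfl
      have h2 : esize 1 = 2 := rfl
      simp only [esize_cons, Polynomial.eval_add, Polynomial.eval_mul, Polynomial.eval_X,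
        Polynomial.eval_ofNat]
      omega)

theorem gaps {S R : σ → List ℕ} (hS : PolyTime S) (hR : PolyTime R) :
    PolyTime fun x => gaps (S x) (R x) := by
  have hs : PolyTime fun y : σ × (List ℕ × ℕ × List ℕ) × ℕ => y.2.1 := PolyTime.id.snd.fst
  have hc := hs.snd.fst.add (const 1)
  have h : PolyTime fun x : σ => (R x).foldl gapStep (S x, 0, []) :=
    foldl (f := fun (_ : σ) s b => gapStep s b) (b₀ := fun x => (S x, 0, []))
      (hs.fst.tail.pair (ite_lt (const 0) (PolyTime.id.snd.snd.mul hs.fst.headD_zero)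
        ((const 0).pair (cons hc hs.snd.snd)) (hc.pair hs.snd.snd)))
      (hS.pair ((const 0).pair nil)) hR 10 (fun _ s b => by
        obtain ⟨s, c, g⟩ := s
        have h1 := esize_tail_le s
        have h2 := esize_add_le c 1
        have h3 : esize 0 = 1 := rfl
        have h4 : esize 1 = 2 := rfl
        simp only [gapStep, Polynomial.eval_ofNat]
        split_ifs
        · simp only [esize_pair, esize_cons]; omega
        · simp only [esize_pair]; omega)
  exact cons (h.snd.fst.add (const 1)) h.snd.snd

theorem cycleCost {it : σ → ℕ × ℕ} {g : σ → List ℕ} (hi : PolyTime it) (hg : PolyTime g) :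
    PolyTime fun x => cycleCost (it x) (g x) :=
  sum (map (by
    have hi' : PolyTime fun y : σ × ℕ => it y.1 := hi.comp PolyTime.id.fst
    apply_rules [PolyTime.id, fst, snd, mul, add]) hg)

theorem ite_isShort {β : Type} [Enc β] {M : σ → ℕ} {it : σ → ℕ × ℕ} {u v : σ → β}
    (hM : PolyTime M) (hi : PolyTime it) (hu : PolyTime u) (hv : PolyTime v) :
    PolyTime fun x => if IsShort (M x) (it x) then u x else v x :=
  ite_lt hi.fst (hi.snd.mul (((hM.mul hM).mul hM).mul ((hM.mul hM).mul hM))) hu hv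

theorem itemGaps {mk : σ → List (List ℕ)} {S : σ → List ℕ} {it : σ → ℕ × ℕ}
    (hm : PolyTime mk) (hS : PolyTime S) (hi : PolyTime it) :
    PolyTime fun x => itemGaps (mk x) (S x) (it x) :=
  gaps hS (argmin (cycleCost (hi.comp PolyTime.id.fst)
    (gaps (hS.comp PolyTime.id.fst) PolyTime.id.snd)) hm.headD_nil hm)

theorem shortCost {M : σ → ℕ} {mk : σ → List (List ℕ)} {S : σ → List ℕ} {it : σ → ℕ × ℕ}
    (hM : PolyTime M) (hm : PolyTime mk) (hS : PolyTime S) (hi : PolyTime it) :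
    PolyTime fun x => shortCost (M x) (mk x) (S x) (it x) :=
  ite_isShort hM hi (cycleCost hi (itemGaps hm hS hi)) (const 0)

theorem bestMask {u₀ M : σ → ℕ} {items : σ → List (ℕ × ℕ)} {mk : σ → List (List ℕ)}
    (hu : PolyTime u₀) (hM : PolyTime M) (hi : PolyTime items) (hm : PolyTime mk) :
    PolyTime fun x => bestMask (u₀ x) (M x) (items x) (mk x) := by
  refine argmin ?_ hm.headD_nil hm
  have h1 : PolyTime fun y : σ × List ℕ => y.1 := PolyTime.id.fst
  have h2 : PolyTime fun z : (σ × List ℕ) × (ℕ × ℕ) => z.1 := PolyTime.id.fst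
  exact ((hu.comp h1).mul ((const 1).add PolyTime.id.snd.sum)).add
    (sum (map (shortCost (hM.comp h2.fst) (hm.comp h2.fst) h2.snd PolyTime.id.snd) (hi.comp h1)))

theorem itemPlan {M : σ → ℕ} {mk : σ → List (List ℕ)} {S : σ → List ℕ} {it : σ → ℕ × ℕ}
    (hM : PolyTime M) (hm : PolyTime mk) (hS : PolyTime S) (hi : PolyTime it) :
    PolyTime fun x => itemPlan (M x) (mk x) (S x) (it x) :=
  ite_isShort hM hi (itemGaps hm hS hi)
    (cons ((sqrt (hi.fst.div (hi.snd.mul ((hM.mul hM).mul (hM.mul hM))))).mul (hM.mul hM)) nil)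

theorem solveInt {k₀ M : σ → ℕ} {items : σ → List (ℕ × ℕ)} {mk : σ → List (List ℕ)}
    (hk : PolyTime k₀) (hM : PolyTime M) (hi : PolyTime items) (hm : PolyTime mk) :
    PolyTime fun x => solveInt (k₀ x) (M x) (items x) (mk x) := by
  have h1 : PolyTime fun y : σ × (ℕ × ℕ) => y.1 := PolyTime.id.fst
  have hH : PolyTime fun x => totalHolding (items x) := sum (map PolyTime.id.snd.snd hi)
  have hr := (hk.mul hH).sqrt
  have hHM := (hH.mul hM).mul (hH.mul hM)
  have hits : PolyTime fun x => gridItems (totalHolding (items x)) (M x)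
      (Nat.sqrt (k₀ x * totalHolding (items x))) (items x) :=
    map ((PolyTime.id.snd.fst.mul (hHM.comp h1)).pair
      (PolyTime.id.snd.snd.mul ((hr.mul hr).comp h1))) hi
  have hS := bestMask (hk.mul hHM) hM hits hm
  have h2 : PolyTime fun y : (σ × (ℕ × ℕ)) × ℕ => y.1.1 := PolyTime.id.fst.fst
  exact map (map ((PolyTime.id.snd.mul (hr.comp h2)).pair ((hH.mul hM).comp h2))
    (itemPlan (hM.comp h1) (hm.comp h1) (hS.comp h1) PolyTime.id.snd)) hits

theorem solve : PolyTime fun y : (ℕ × RawInst) × List (List ℕ) => solve y.1.1 y.1.2 y.2 := by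
  have hx : PolyTime fun y : (ℕ × RawInst) × List (List ℕ) => y.1.2 := PolyTime.id.fst.snd
  have hM : PolyTime fun y : (ℕ × RawInst) × List (List ℕ) => y.1.1 := PolyTime.id.fst.fst
  have hD : PolyTime fun y : (ℕ × RawInst) × List (List ℕ) => commonDen y.1.2 :=
    hx.fst.snd.mul (prod (map (PolyTime.id.snd.fst.snd.mul PolyTime.id.snd.snd.snd) hx.snd))
  have hc : PolyTime fun y : (ℕ × RawInst) × List (List ℕ) => clearDen (commonDen y.1.2) y.1.2.1 :=
    hx.fst.fst.mul (hD.div hx.fst.snd)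
  have hp : PolyTime fun z : ((ℕ × RawInst) × List (List ℕ)) × ((ℕ × ℕ) × (ℕ × ℕ)) => z.1 :=
    PolyTime.id.fst
  refine solveInt ((hM.mul hc).add ((const 1).sub hc)) hM (map (pair ?_ ?_) hx.snd)
    PolyTime.id.snd
  · exact (hM.comp hp).mul (PolyTime.id.snd.fst.fst.mul
      ((hD.comp hp).div PolyTime.id.snd.fst.snd))
  · exact (hM.comp hp).mul (PolyTime.id.snd.snd.fst.mul
      ((hD.comp hp).div PolyTime.id.snd.snd.snd))

end PolyTime

/-! ### Size of the enumeration and total running time. -/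

/-- An entry of size $s$ contributes $s+1$ before and $2s+7\le 9(s+1)$ after the extension. -/
theorem esize_extendMasks_le (l : List (List ℕ)) : esize (extendMasks l) ≤ 9 * esize l := by
  have h : ∀ (l b : List (List ℕ)),
      esize (l.foldl (fun b x => (0 :: x) :: (1 :: x) :: b) b) + 9 ≤ esize b + 9 * esize l := by
    intro l
    induction l with
    | nil => intro b; simp [esize_nil]
    | cons x l ih =>
      intro b
      have h0 : esize 0 = 1 := rfl
      have h1 : esize 1 = 2 := rfl
      have h2 := ih ((0 :: x) :: (1 :: x) :: b)
      simp only [esize_cons, List.foldl_cons] at h2 ⊢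
      omega
  have := h l []
  rw [esize_nil] at this
  exact le_trans (by rw [extendMasks]; omega) (le_refl (9 * esize l))

theorem esize_masks_le (k : ℕ) : esize (masks k) ≤ 3 * 9 ^ k := by
  induction k with
  | zero => exact le_rfl
  | succ k ih =>
    rw [masks, Function.iterate_succ_apply', pow_succ]
    have := esize_extendMasks_le (masks k)
    rw [masks] at this ih
    omega

/-- The number of grid steps in a cycle. -/
def cycleLength (M : ℕ) : ℕ := M * M * (M * M)

/-- The list of masks is exponentially long in the number of grid steps. Its construction is charged
to its own size, and everything else is polynomial in that size and the input. -/
theorem exists_program : ∃ (A : Prog) (c : ℕ), ∀ (m : ℕ) (x : RawInst), ∃ t,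
    Eval A (enc (m, x)) (enc (solve (16 * m) x (masks (cycleLength (16 * m) - 1)))) t ∧
      t ≤ c * (esize (m, x) + 3 * 9 ^ (cycleLength (16 * m) - 1)) ^ c := by
  have hm : PolyTime fun y : ℕ × RawInst => 16 * y.1 := (PolyTime.const 16).mul PolyTime.id.fst
  have hin : PolyTime fun y : ℕ × RawInst =>
      ((16 * y.1, y.2), (cycleLength (16 * y.1) - 1, ([[]] : List (List ℕ)))) :=
    (hm.pair PolyTime.id.snd).pair
      ((((hm.mul hm).mul (hm.mul hm)).sub (PolyTime.const 1)).pair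
        (PolyTime.cons PolyTime.nil PolyTime.nil))
  obtain ⟨p, P, hp⟩ := hin
  obtain ⟨a, Pa, ha⟩ :=
    PolyTime.fst (PolyTime.id (α := (ℕ × RawInst) × (ℕ × List (List ℕ))))
  obtain ⟨b, Pb, hb⟩ :=
    PolyTime.snd (PolyTime.id (α := (ℕ × RawInst) × (ℕ × List (List ℕ))))
  obtain ⟨i, Pi, hi⟩ := PolyTime.extendMasks.exists_eval_iterate
  obtain ⟨s, Ps, hs⟩ := PolyTime.solve
  let R : Polynomial ℕ := 4 + P + Pa.comp P + Pb.comp P + Pi + Ps.comp (1 + P + Polynomial.X)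
  obtain ⟨c, hc⟩ := exists_eval_le_mul_pow R
  refine ⟨.comp p (.comp (.pair a (.comp b i)) s), c, fun m x => ?_⟩
  set N := cycleLength (16 * m) - 1 with hN
  set X := esize (m, x) + 3 * 9 ^ N with hX
  obtain ⟨t₁, h₁, l₁⟩ := hp (m, x)
  obtain ⟨t₂, h₂, l₂⟩ := ha ((16 * m, x), (N, [[]]))
  obtain ⟨t₃, h₃, l₃⟩ := hb ((16 * m, x), (N, [[]]))
  have hpow : ∀ k ≤ N, 3 * 9 ^ k ≤ X := fun k hk => by
    have : 9 ^ k ≤ 9 ^ N := Nat.pow_le_pow_right (by norm_num) hk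
    omega
  have hNX : N ≤ X := by
    have h1 : N < 9 ^ N := Nat.lt_pow_self (by norm_num)
    omega
  obtain ⟨t₄, h₄, l₄⟩ := hi N [[]] X hNX (fun k hk => (esize_masks_le k).trans (hpow k hk))
  obtain ⟨t₅, h₅, l₅⟩ := hs ((16 * m, x), masks N)
  refine ⟨_, .comp h₁ (.comp (.pair h₂ (.comp h₃ h₄)) h₅), ?_⟩
  refine le_trans ?_ (hc X (by have := one_le_esize (m, x); omega))
  have hPX : P.eval (esize (m, x)) ≤ P.eval X := eval_le_eval P (by omega)
  have hsz : esize ((16 * m, x), (N, ([[]] : List (List ℕ)))) ≤ P.eval X :=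
    (h₁.size_output_le.trans l₁).trans hPX
  have hsz' : esize ((16 * m, x), masks N) ≤ 1 + P.eval X + X := by
    have h6 := (esize_masks_le N).trans (hpow N le_rfl)
    have h7 : esize ((16 * m, x), (N, ([[]] : List (List ℕ))))
      = esize (16 * m, x) + esize (N, ([[]] : List (List ℕ))) + 1 := rfl
    have h8 : esize ((16 * m, x), masks N) = esize (16 * m, x) + esize (masks N) + 1 := rfl
    omega
  have e₂ := l₂.trans (eval_le_eval Pa hsz)
  have e₃ := l₃.trans (eval_le_eval Pb hsz)
  have e₅ := l₅.trans (eval_le_eval Ps hsz')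
  simp only [R, Polynomial.eval_add, Polynomial.eval_comp, Polynomial.eval_ofNat,
    Polynomial.eval_one, Polynomial.eval_X]
  omega

/-- The bound of `exists_program`, in terms of the accuracy. -/
theorem exists_time_bound (c : ℕ) : ∃ C : ℕ, ∀ (ε : ℝ) (s t : ℕ), 0 < ε → 1 ≤ s →
    t ≤ c * (esize ⌈1 / ε⌉₊ + s + 1 + 3 * 9 ^ (cycleLength (16 * ⌈1 / ε⌉₊) - 1)) ^ c →
      (t : ℝ) ≤ C * (2 : ℝ) ^ ((C : ℝ) * (1 / ε) ^ 4 * Real.log (2 + 1 / ε) ^ C) * (s : ℝ) ^ C := by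
  -- Here $65536=16^4$ comes from the cycle length $(16m)^4$, the factor 5 from bounding powers of 9
  -- and the remaining summands by powers of 2, and $16=2^4$ from $m\le 2/\epsilon$. The summand `c
  -- * 2 ^ d` of `C` serves the case $\epsilon\ge1$.
  obtain ⟨d, hd⟩ : ∃ d : ℕ, d = 5 * 65536 * 16 * c := ⟨_, rfl⟩
  obtain ⟨C, hC⟩ : ∃ C : ℕ, C = c * 2 ^ d + d + c := ⟨_, rfl⟩
  refine ⟨C, fun ε s t hε hs ht => ?_⟩
  set m := ⌈1 / ε⌉₊ with hm
  have hm1 : 1 ≤ m := Nat.one_le_ceil_iff.2 (by positivity)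
  have hG : cycleLength (16 * m) = 65536 * m ^ 4 := by rw [cycleLength]; ring
  rw [hG] at ht
  have hm4 : m ≤ m ^ 4 := Nat.le_self_pow (by norm_num) m
  have h1 : esize m + s + 1 + 3 * 9 ^ (65536 * m ^ 4 - 1) ≤ 2 ^ (5 * 65536 * m ^ 4) * s := by
    set g := 65536 * m ^ 4 with hg
    clear_value g
    have hg1 : m ≤ g := by omega
    have h2 : esize m ≤ 2 ^ g := by
      rw [esize_nat]
      have h3 : Nat.size m ≤ m := Nat.size_le.2 Nat.lt_two_pow_self
      have h4 : g < 2 ^ g := Nat.lt_two_pow_self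
      omega
    have h3 : 3 * 9 ^ (g - 1) ≤ 2 ^ (4 * g) := by
      calc 3 * 9 ^ (g - 1) ≤ 16 * 16 ^ (g - 1) := by gcongr <;> norm_num
        _ = 16 ^ (g - 1 + 1) := (pow_succ' 16 (g - 1)).symm
        _ = 2 ^ (4 * g) := by rw [Nat.sub_add_cancel (by omega), pow_mul]; norm_num
    have h4 : 2 ^ g ≤ 2 ^ (4 * g) := Nat.pow_le_pow_right (by norm_num) (by omega)
    have h5 : 2 ^ (5 * 65536 * m ^ 4) = 2 ^ (4 * g) * 2 ^ g := by
      rw [← pow_add]; congr 1; omega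
    have h6 : 4 ≤ 2 ^ g := by
      calc 4 = 2 ^ 2 := by norm_num
        _ ≤ 2 ^ g := Nat.pow_le_pow_right (by norm_num) (by omega)
    rw [h5]
    have h7 : 2 ^ (4 * g) * 4 * s ≤ 2 ^ (4 * g) * 2 ^ g * s := by gcongr
    have h8 : 1 ≤ 2 ^ (4 * g) := Nat.one_le_two_pow
    have h9 : 2 ^ (4 * g) * 1 ≤ 2 ^ (4 * g) * s := Nat.mul_le_mul_left _ hs
    have h10 : 1 * s ≤ 2 ^ (4 * g) * s := Nat.mul_le_mul_right _ h8
    have h11 : 2 ^ (4 * g) * 4 * s = 4 * (2 ^ (4 * g) * s) := by ring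
    omega
  have h2 : t ≤ c * 2 ^ (5 * 65536 * c * m ^ 4) * s ^ c := by
    refine ht.trans ((Nat.mul_le_mul_left c (Nat.pow_le_pow_left h1 c)).trans_eq ?_)
    rw [mul_pow, ← pow_mul, mul_right_comm (5 * 65536) c, mul_assoc c]
  have hsc : s ^ c ≤ s ^ C := Nat.pow_le_pow_right hs (by omega)
  have h3 : (t : ℝ) ≤ c * 2 ^ (5 * 65536 * c * m ^ 4) * (s : ℝ) ^ C := by
    exact_mod_cast h2.trans (Nat.mul_le_mul_left _ hsc)
  refine h3.trans (mul_le_mul_of_nonneg_right ?_ (by positivity))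
  -- For large $\epsilon$ the exponent in the claim may be close to $0$. But then $m=1$, and the
  -- factor in front is a constant.
  by_cases h1ε : 1 ≤ ε
  · have hme : m = 1 := le_antisymm (Nat.ceil_le.2 (by
      rw [Nat.cast_one]; exact (div_le_one hε).2 h1ε)) hm1
    have h4 : (c * 2 ^ (5 * 65536 * c * m ^ 4) : ℝ) ≤ C := by
      have : c * 2 ^ (5 * 65536 * c * m ^ 4) ≤ C := by
        rw [hC, hme]
        have : 2 ^ (5 * 65536 * c * 1 ^ 4) ≤ 2 ^ d :=
          Nat.pow_le_pow_right (by norm_num) (by rw [hd]; omega)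
        have := Nat.mul_le_mul_left c this
        omega
      exact_mod_cast this
    refine h4.trans (le_mul_of_one_le_right (by positivity) ?_)
    refine Real.one_le_rpow (by norm_num) ?_
    have : 0 ≤ Real.log (2 + 1 / ε) := Real.log_nonneg (by
      have : 0 < 1 / ε := by positivity
      linarith)
    positivity
  · have hε1 : 1 ≤ 1 / ε := (one_le_div hε).2 (le_of_not_ge h1ε)
    have hm2 : (m : ℝ) ≤ 2 * (1 / ε) := by
      have := Nat.ceil_lt_add_one (show 0 ≤ 1 / ε by positivity)
      linarith
    -- Since $2+1/\epsilon\ge3>e$, the logarithmic factor can only increase the bound.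
    have hlog : 1 ≤ Real.log (2 + 1 / ε) := by
      rw [Real.le_log_iff_exp_le (by linarith)]
      have := Real.exp_one_lt_d9
      linarith
    have hlogC : 1 ≤ Real.log (2 + 1 / ε) ^ C := one_le_pow₀ hlog
    have h4 : (c : ℝ) ≤ C := by
      have : c ≤ C := by omega
      exact_mod_cast this
    refine mul_le_mul h4 ?_ (by positivity) (by positivity)
    rw [← Real.rpow_natCast]
    refine Real.rpow_le_rpow_of_exponent_le (by norm_num) ?_
    have h5 : ((5 * 65536 * c * m ^ 4 : ℕ) : ℝ) ≤ d * (1 / ε) ^ 4 := by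
      have : (m : ℝ) ^ 4 ≤ (2 * (1 / ε)) ^ 4 := by gcongr
      rw [hd]
      push_cast
      calc _ ≤ 327680 * (c : ℝ) * (2 * (1 / ε)) ^ 4 := by gcongr
        _ = _ := by ring
    have h6 : (d : ℝ) ≤ C := by
      have : d ≤ C := by omega
      exact_mod_cast this
    calc ((5 * 65536 * c * m ^ 4 : ℕ) : ℝ) ≤ d * (1 / ε) ^ 4 := h5
      _ ≤ C * (1 / ε) ^ 4 := by gcongr
      _ ≤ _ := le_mul_of_one_le_right (by positivity) hlogC

end JRP

namespace JRP

/-! ### Lower bounds on the cost of feasible policies -/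

namespace Policy.Feasible

variable {P : Policy}

theorem finite_le (h : P.Feasible) (t : ℝ) : {k | P.τ k ≤ t}.Finite := by
  obtain ⟨N, hN⟩ := eventually_atTop.1 (h.tendsto.eventually_gt_atTop t)
  refine (Set.finite_Iio N).subset fun k hk => ?_
  by_contra hcon
  exact absurd hk (not_le.2 (hN k (not_lt.1 hcon)))

theorem finite_lt (h : P.Feasible) (t : ℝ) : {k | P.τ k < t}.Finite :=
  (h.finite_le t).subset fun _ (hk : _ < t) => hk.le

theorem nonneg (h : P.Feasible) (k : ℕ) : 0 ≤ P.τ k :=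
  h.zero ▸ h.strictMono.monotone (Nat.zero_le k)

/-- Without an order strictly between `u` and `v`, the inventory falls at unit rate and would
otherwise be negative shortly before `v`. -/
theorem sub_le_inventory (h : P.Feasible) {u v : ℝ} (hu : 0 ≤ u)
    (huv : ∀ k, ¬(u < P.τ k ∧ P.τ k < v)) : v - u ≤ P.inventory u := by
  by_contra hcon
  have h0 := h.inventory_nonneg u hu
  obtain ⟨v', h1, h2⟩ := exists_between (show u + P.inventory u < v by linarith)
  have heq : P.inventory v' = P.inventory u - (v' - u) := by
    have : ∀ k, (P.τ k ≤ v') = (P.τ k ≤ u) := fun k => by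
      apply propext
      constructor
      · intro hk
        by_contra hk'
        exact huv k ⟨not_le.1 hk', hk.trans_lt h2⟩
      · intro hk; linarith
    simp only [inventory, this]
    ring
  have := h.inventory_nonneg v' (by linarith)
  linarith

theorem integrableOn_inventory (h : P.Feasible) (t : ℝ) :
    IntegrableOn P.inventory (Set.Ico 0 t) := by
  classical
  have h1 : IntegrableOn (fun s : ℝ => (∑ k ∈ (h.finite_le t).toFinset,
      (Set.Ici (P.τ k)).indicator (fun _ => P.q k) s) - s) (Set.Ico 0 t) := by
    refine Integrable.sub (integrable_finsetSum _ fun k _ => ?_) ?_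
    · exact (integrable_const _).indicator measurableSet_Ici
    · exact (continuous_id.integrableOn_Icc (a := 0) (b := t)).mono_set Set.Ico_subset_Icc_self
  refine h1.congr_fun (fun s hs => ?_) measurableSet_Ico
  simp only [inventory, sub_left_inj]
  rw [finsum_eq_sum_of_support_subset (s := (h.finite_le t).toFinset)]
  · refine Finset.sum_congr rfl fun k _ => ?_
    rw [finsum_eq_if, Set.indicator_apply]
    rfl
  · intro k hk
    rw [Function.mem_support, finsum_eq_if] at hk
    simp only [Set.Finite.coe_toFinset, Set.mem_ofPred_eq]
    by_contra hcon
    exact hk (if_neg fun hks => hcon (hks.trans hs.2.le))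

end Policy.Feasible

/-- The inequality of arithmetic and geometric means, in the form of the economic order quantity: an
interval of length $d$ between orders costs at least $2\sqrt{KH}\,d$. -/
theorem mul_le_add_mul_sq {K H c d : ℝ} (hK : 0 ≤ K) (hH : 0 ≤ H) (hc : c ^ 2 ≤ 4 * K * H) :
    c * d ≤ K + H * d ^ 2 := by
  refine (abs_le_of_sq_le_sq' ?_ (by positivity)).2
  nlinarith [sq_nonneg (K - H * d ^ 2), sq_nonneg d, mul_le_mul_of_nonneg_right hc (sq_nonneg d)]

theorem setIntegral_Ico_sub {a b : ℝ} (hab : a ≤ b) :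
    ∫ s in Set.Ico a b, (b - s) = (b - a) ^ 2 / 2 := by
  rw [integral_Ico_eq_integral_Ioc, ← intervalIntegral.integral_of_le hab,
    intervalIntegral.integral_comp_sub_left (fun x => x) b]
  simp

theorem sq_le_two_mul_setIntegral {f : ℝ → ℝ} {H a b : ℝ} (hab : a ≤ b)
    (hf : IntegrableOn f (Set.Ico a b)) (h : ∀ s ∈ Set.Ico a b, H * (b - s) ≤ f s) :
    H * (b - a) ^ 2 ≤ 2 * ∫ s in Set.Ico a b, f s := by
  have h1 : ∫ s in Set.Ico a b, H * (b - s) = H * ((b - a) ^ 2 / 2) := by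
    rw [integral_const_mul, setIntegral_Ico_sub hab]
  have h2 : ∫ s in Set.Ico a b, H * (b - s) ≤ ∫ s in Set.Ico a b, f s := by
    refine setIntegral_mono_on ?_ hf measurableSet_Ico h
    exact ((by fun_prop : Continuous fun s : ℝ => H * (b - s)).integrableOn_Icc
      (a := a) (b := b)).mono_set Set.Ico_subset_Icc_self
  linarith

theorem setIntegral_Ico_add {f : ℝ → ℝ} {a b c : ℝ} (hab : a ≤ b) (hbc : b ≤ c)
    (hf : IntegrableOn f (Set.Ico a c)) :
    ∫ s in Set.Ico a c, f s = (∫ s in Set.Ico a b, f s) + ∫ s in Set.Ico b c, f s := by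
  rw [← Set.Ico_union_Ico_eq_Ico hab hbc]
  exact setIntegral_union (Set.disjoint_left.2 fun x h1 h2 => absurd h1.2 (not_lt.2 h2.1))
    measurableSet_Ico (hf.mono_set (Set.Ico_subset_Ico_right hbc))
    (hf.mono_set (Set.Ico_subset_Ico_left hab))

/-- If `f` is at least `H` times the time until the next one of the orders `O`, then paying `K` per
order and the integral of `2 * f` costs at least `c` per time unit. -/
theorem mul_le_card_add_integral {f : ℝ → ℝ} {K H c : ℝ} (hK : 0 ≤ K) (hH : 0 ≤ H)
    (hc : c ^ 2 ≤ 4 * K * H) (O : Finset ℝ) :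
    ∀ t : ℝ, 0 ∈ O → (∀ x ∈ O, 0 ≤ x ∧ x < t) → IntegrableOn f (Set.Ico 0 t) →
      (∀ u v, 0 ≤ u → u < v → v ≤ t → (∀ x ∈ O, ¬(u < x ∧ x < v)) → H * (v - u) ≤ f u) →
      c * t ≤ K * O.card + 2 * ∫ s in Set.Ico 0 t, f s := by
  -- Remove the last order `a`: the stretch from `a` to `t` pays for itself, and the induction
  -- hypothesis applies with horizon `a`. If `a` is `0`, nothing is left before it.
  induction O using Finset.induction_on_max with
  | empty => intro t h; simp at h
  | insert a O ha ih =>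
    intro t h0 hO hf h
    have hat : 0 ≤ a ∧ a < t := hO a (by simp)
    have hcard : (insert a O).card = O.card + 1 :=
      Finset.card_insert_of_notMem fun hmem => lt_irrefl a (ha a hmem)
    have hlast : H * (t - a) ^ 2 ≤ 2 * ∫ s in Set.Ico a t, f s := by
      refine sq_le_two_mul_setIntegral hat.2.le (hf.mono_set (Set.Ico_subset_Ico_left hat.1))
        fun s hs => ?_
      refine h s t (hat.1.trans hs.1) hs.2 le_rfl fun x hx hcon => ?_
      rcases Finset.mem_insert.1 hx with rfl | hx
      · exact absurd hcon.1 (not_lt.2 hs.1)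
      · linarith [ha x hx, hs.1, hcon.1]
    have hd := mul_le_add_mul_sq (d := t - a) hK hH hc
    rw [setIntegral_Ico_add hat.1 hat.2.le hf, hcard]
    push_cast
    rcases Finset.mem_insert.1 h0 with h0 | h0
    · subst h0
      have hempty : O = ∅ := Finset.eq_empty_of_forall_notMem fun x hx =>
        absurd (hO x (Finset.mem_insert_of_mem hx)).1 (not_le.2 (ha x hx))
      subst hempty
      simp only [Set.Ico_self, Measure.restrict_empty, integral_zero_measure, Finset.card_empty]
      simp only [sub_zero, Nat.cast_zero] at hd hlast ⊢
      linarith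
    · have := ih a h0 (fun x hx => ⟨(hO x (Finset.mem_insert_of_mem hx)).1, ha x hx⟩)
        (hf.mono_set (Set.Ico_subset_Ico_right hat.2.le))
        (fun u v hu huv hva hno => h u v hu huv (hva.trans hat.2.le) fun x hx hcon => by
          rcases Finset.mem_insert.1 hx with rfl | hx
          · linarith [hcon.2]
          · exact hno x hx hcon)
      nlinarith

/-- The times of the orders before `t`. -/
noncomputable def Policy.Feasible.times {P : Policy} (h : P.Feasible) (t : ℝ) : Finset ℝ :=
  (h.finite_lt t).toFinset.image P.τ

theorem Policy.Feasible.mem_times {P : Policy} (h : P.Feasible) {t s : ℝ} :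
    s ∈ h.times t ↔ s < t ∧ ∃ k, P.τ k = s := by
  simp only [times, Finset.mem_image, Set.Finite.mem_toFinset, Set.mem_ofPred_eq]
  constructor
  · rintro ⟨k, hk, rfl⟩; exact ⟨hk, k, rfl⟩
  · rintro ⟨hs, k, rfl⟩; exact ⟨k, hs, rfl⟩

theorem Policy.Feasible.card_times_le {P : Policy} (h : P.Feasible) (t : ℝ) :
    (h.times t).card ≤ P.orders t := by
  refine Finset.card_image_le.trans_eq ?_
  rw [Policy.orders, Set.ncard_eq_toFinset_card _ (h.finite_lt t)]

theorem Policy.Feasible.mul_le_costUpTo {P : Policy} (h : P.Feasible) {K H c t : ℝ} (hK : 0 ≤ K)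
    (hH : 0 ≤ H) (hc : c ^ 2 ≤ 4 * K * H) (ht : 0 < t) : c * t ≤ P.costUpTo K H t := by
  have h1 := mul_le_card_add_integral (f := fun s => H * P.inventory s) hK hH hc (h.times t) t
    (h.mem_times.2 ⟨ht, 0, h.zero⟩)
    (fun x hx => by
      obtain ⟨hxt, k, rfl⟩ := h.mem_times.1 hx
      exact ⟨h.nonneg k, hxt⟩)
    ((h.integrableOn_inventory t).const_mul H)
    (fun u v hu huv hvt hno => by
      refine mul_le_mul_of_nonneg_left (h.sub_le_inventory hu fun k hk => ?_) hH
      exact hno (P.τ k) (h.mem_times.2 ⟨hk.2.trans_le hvt, k, rfl⟩) hk)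
  have h2 : ((h.times t).card : ℝ) ≤ P.orders t := by exact_mod_cast h.card_times_le t
  rw [integral_const_mul] at h1
  have := mul_le_mul_of_nonneg_left h2 hK
  rw [Policy.costUpTo]
  linarith

section Joint

variable {n : ℕ} {Q : Fin n → Policy}

theorem jointOrders_finite (hQ : ∀ i, (Q i).Feasible) (t : ℝ) :
    {s : ℝ | 0 ≤ s ∧ s < t ∧ ∃ i k, (Q i).τ k = s}.Finite := by
  refine (Set.finite_iUnion fun i => ((hQ i).times t).finite_toSet).subset ?_
  rintro s ⟨-, hst, i, k, hk⟩
  exact Set.mem_iUnion.2 ⟨i, (hQ i).mem_times.2 ⟨hst, k, hk⟩⟩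

/-- All items merged into one: no item is ordered between joint orders, so the weighted sum of the
inventories covers the weighted demand until the next joint order. -/
theorem mul_le_jointOrders_add_integral [NeZero n] (hQ : ∀ i, (Q i).Feasible) {K c t : ℝ}
    {H : Fin n → ℝ} (hK : 0 ≤ K) (hH : ∀ i, 0 ≤ H i) (hc : c ^ 2 ≤ 4 * K * ∑ i, H i)
    (ht : 0 < t) :
    c * t ≤ K * jointOrders Q t + ∑ i, 2 * H i * ∫ s in Set.Ico 0 t, (Q i).inventory s := by
  have hfin := jointOrders_finite hQ t
  have h1 := mul_le_card_add_integral (f := fun s => ∑ i, H i * (Q i).inventory s) hK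
    (Finset.sum_nonneg fun i _ => hH i) hc hfin.toFinset t
    (by
      rw [Set.Finite.mem_toFinset]
      exact ⟨le_rfl, ht, 0, 0, (hQ 0).zero⟩)
    (fun x hx => by
      rw [Set.Finite.mem_toFinset] at hx
      exact ⟨hx.1, hx.2.1⟩)
    (integrable_finsetSum _ fun i _ => ((hQ i).integrableOn_inventory t).const_mul (H i))
    (fun u v hu huv hvt hno => by
      rw [Finset.sum_mul]
      refine Finset.sum_le_sum fun i _ => mul_le_mul_of_nonneg_left
        ((hQ i).sub_le_inventory hu fun k hk => ?_) (hH i)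
      exact hno ((Q i).τ k) ((Set.Finite.mem_toFinset _).2
        ⟨(hQ i).nonneg k, hk.2.trans_le hvt, i, k, rfl⟩) hk)
  rw [integral_finsetSum _ fun i _ => ((hQ i).integrableOn_inventory t).const_mul (H i),
    Finset.mul_sum, ← Set.ncard_eq_toFinset_card _ hfin] at h1
  refine h1.trans_eq ?_
  rw [jointOrders]
  congr 1
  refine Finset.sum_congr rfl fun i _ => ?_
  rw [integral_const_mul]
  ring

theorem jointOrders_le_sum_orders (hQ : ∀ i, (Q i).Feasible) (t : ℝ) :
    jointOrders Q t ≤ ∑ i, (Q i).orders t := by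
  classical
  have h1 : jointOrders Q t ≤ (Finset.univ.biUnion fun i => (hQ i).times t).card := by
    rw [jointOrders, ← Set.ncard_coe_finset]
    refine Set.ncard_le_ncard ?_ (Finset.finite_toSet _)
    rintro s ⟨-, hst, i, k, hk⟩
    simp only [Finset.coe_biUnion, Set.mem_iUnion]
    exact ⟨i, by simp, (hQ i).mem_times.2 ⟨hst, k, hk⟩⟩
  exact h1.trans (Finset.card_biUnion_le.trans
    (Finset.sum_le_sum fun i _ => (hQ i).card_times_le t))

end Joint

end JRP

namespace JRP

/-! ### The cost of cyclic policies -/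

theorem sum_range_getD_mod (L : List ℚ≥0) (g : ℚ≥0 → ℝ) (w i : ℕ) :
    ∑ j ∈ Finset.range (w * L.length + i), g (L.getD (j % L.length) 0)
      = w * (L.map g).sum + ∑ j ∈ Finset.range i, g (L.getD (j % L.length) 0) := by
  have hbase : ∑ j ∈ Finset.range L.length, g (L.getD (j % L.length) 0) = (L.map g).sum := by
    rw [← Fin.sum_univ_fun_getElem, Finset.sum_range]
    refine Finset.sum_congr rfl fun j _ => ?_
    rw [Nat.mod_eq_of_lt j.2, List.getD_eq_getElem _ _ j.2]
  induction w with
  | zero => simp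
  | succ w ih =>
    rw [show (w + 1) * L.length + i = L.length + (w * L.length + i) by ring, Finset.sum_range_add,
      hbase]
    simp only [Nat.add_mod_left]
    rw [ih]
    push_cast
    ring

section Cyclic

variable {L : List ℚ≥0}

theorem cyclicPolicy_τ_succ (k : ℕ) :
    (cyclicPolicy L).τ (k + 1) = (cyclicPolicy L).τ k + (cyclicPolicy L).q k :=
  Finset.sum_range_succ _ _

theorem cyclicPolicy_q_pos (hne : L ≠ []) (hpos : ∀ x ∈ L, 0 < x) (k : ℕ) :
    0 < (cyclicPolicy L).q k := by
  have hk : k % L.length < L.length := Nat.mod_lt _ (List.length_pos_iff.2 hne)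
  change 0 < ((L.getD (k % L.length) 0 : ℚ≥0) : ℝ)
  rw [List.getD_eq_getElem _ _ hk]
  exact_mod_cast hpos _ (List.getElem_mem hk)

/-- The length of a cycle. -/
def cycleTime (L : List ℚ≥0) : ℝ := (L.map fun x : ℚ≥0 => (x : ℝ)).sum

theorem cyclicPolicy_τ_mul_add (w i : ℕ) :
    (cyclicPolicy L).τ (w * L.length + i) = w * cycleTime L + (cyclicPolicy L).τ i :=
  sum_range_getD_mod L (fun x => (x : ℝ)) w i

theorem cyclicPolicy_τ_strictMono (hne : L ≠ []) (hpos : ∀ x ∈ L, 0 < x) :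
    StrictMono (cyclicPolicy L).τ := by
  refine strictMono_nat_of_lt_succ fun k => ?_
  rw [cyclicPolicy_τ_succ]
  linarith [cyclicPolicy_q_pos hne hpos k]

theorem cyclicPolicy_τ_zero : (cyclicPolicy L).τ 0 = 0 := by simp [cyclicPolicy]

theorem cycleTime_pos (hne : L ≠ []) (hpos : ∀ x ∈ L, 0 < x) : 0 < cycleTime L := by
  have h := cyclicPolicy_τ_mul_add (L := L) 1 0
  have h1 := cyclicPolicy_τ_strictMono hne hpos
    (show 0 < 1 * L.length + 0 by simpa using List.length_pos_iff.2 hne)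
  rw [cyclicPolicy_τ_zero] at h1 h
  simp only [Nat.cast_one, one_mul, add_zero] at h h1
  linarith

theorem cyclicPolicy_tendsto (hne : L ≠ []) (hpos : ∀ x ∈ L, 0 < x) :
    Tendsto (cyclicPolicy L).τ atTop atTop := by
  refine tendsto_atTop_atTop_of_monotone (cyclicPolicy_τ_strictMono hne hpos).monotone fun b => ?_
  obtain ⟨w, hw⟩ := exists_nat_ge (b / cycleTime L)
  refine ⟨w * L.length + 0, ?_⟩
  rw [cyclicPolicy_τ_mul_add, cyclicPolicy_τ_zero, add_zero]
  exact (div_le_iff₀ (cycleTime_pos hne hpos)).1 hw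

theorem cyclicPolicy_inventory (hne : L ≠ []) (hpos : ∀ x ∈ L, 0 < x) {t : ℝ} {k : ℕ}
    (h1 : (cyclicPolicy L).τ k ≤ t) (h2 : t < (cyclicPolicy L).τ (k + 1)) :
    (cyclicPolicy L).inventory t = (cyclicPolicy L).τ (k + 1) - t := by
  have hmono := cyclicPolicy_τ_strictMono hne hpos
  rw [Policy.inventory, finsum_cond_eq_sum_of_cond_iff (p := fun j => (cyclicPolicy L).τ j ≤ t)
    (t := Finset.range (k + 1)) (cyclicPolicy L).q]
  · rfl
  · intro j _
    rw [Finset.mem_range]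
    constructor
    · intro hj
      exact hmono.lt_iff_lt.1 (lt_of_le_of_lt hj h2)
    · intro hj
      exact (hmono.monotone (Nat.lt_succ_iff.1 hj)).trans h1

theorem cyclicPolicy_feasible (hne : L ≠ []) (hpos : ∀ x ∈ L, 0 < x) :
    (cyclicPolicy L).Feasible where
  zero := cyclicPolicy_τ_zero
  strictMono := cyclicPolicy_τ_strictMono hne hpos
  tendsto := cyclicPolicy_tendsto hne hpos
  inventory_nonneg t ht := by
    classical
    have hex : ∃ k, t < (cyclicPolicy L).τ k :=
      ((cyclicPolicy_tendsto hne hpos).eventually_gt_atTop t).exists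
    have hk := Nat.find_spec hex
    obtain ⟨k, hk'⟩ : ∃ k, Nat.find hex = k + 1 := Nat.exists_eq_succ_of_ne_zero fun h0 => by
      rw [h0, cyclicPolicy_τ_zero] at hk
      linarith
    rw [hk'] at hk
    rw [cyclicPolicy_inventory hne hpos
      (not_lt.1 (Nat.find_min hex (show k < Nat.find hex by omega))) hk]
    linarith

theorem cyclicPolicy_integral (hne : L ≠ []) (hpos : ∀ x ∈ L, 0 < x) (N : ℕ) :
    ∫ s in Set.Ico 0 ((cyclicPolicy L).τ N), (cyclicPolicy L).inventory s
      = ∑ k ∈ Finset.range N, (cyclicPolicy L).q k ^ 2 / 2 := by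
  have hF := cyclicPolicy_feasible hne hpos
  induction N with
  | zero => simp [cyclicPolicy_τ_zero]
  | succ N ih =>
    have hle : (cyclicPolicy L).τ N ≤ (cyclicPolicy L).τ (N + 1) :=
      (hF.strictMono (Nat.lt_succ_self N)).le
    rw [setIntegral_Ico_add (hF.nonneg N) hle (hF.integrableOn_inventory _), ih,
      Finset.sum_range_succ]
    congr 1
    rw [setIntegral_congr_fun measurableSet_Ico
      (fun s hs => cyclicPolicy_inventory hne hpos hs.1 hs.2), setIntegral_Ico_sub hle,
      cyclicPolicy_τ_succ, add_sub_cancel_left]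

/-- The cycle running at time `t` is charged in full. This constant excess disappears in the
long-run average. -/
theorem cyclicPolicy_costUpTo_le (hne : L ≠ []) (hpos : ∀ x ∈ L, 0 < x) {K H t : ℝ} (hK : 0 ≤ K)
    (hH : 0 ≤ H) (ht : 0 < t) :
    (cyclicPolicy L).costUpTo K H t
      ≤ (L.map fun x : ℚ≥0 => K + H * (x : ℝ) ^ 2).sum / cycleTime L * t
        + (L.map fun x : ℚ≥0 => K + H * (x : ℝ) ^ 2).sum := by
  have hF := cyclicPolicy_feasible hne hpos
  have hV := cycleTime_pos hne hpos
  have hlen : 0 < L.length := List.length_pos_iff.2 hne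
  set C := (L.map fun x : ℚ≥0 => K + H * (x : ℝ) ^ 2).sum with hC
  have hC0 : 0 ≤ C := by
    refine List.sum_nonneg fun y hy => ?_
    obtain ⟨x, -, rfl⟩ := List.mem_map.1 hy
    positivity
  obtain ⟨n, hn1, hn2⟩ := hF.strictMono.exists_between_of_tendsto_atTop hF.tendsto
    (show (cyclicPolicy L).τ 0 < t by rw [hF.zero]; exact ht)
  have horders : (cyclicPolicy L).orders t = n + 1 := by
    have : {k | (cyclicPolicy L).τ k < t} = ((Finset.range (n + 1) : Finset ℕ) : Set ℕ) := by
      ext k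
      simp only [Set.mem_ofPred_eq, Finset.coe_range, Set.mem_Iio]
      constructor
      · intro hk
        exact hF.strictMono.lt_iff_lt.1 (hk.trans_le hn2)
      · intro hk
        exact (hF.strictMono.monotone (Nat.lt_succ_iff.1 hk)).trans_lt hn1
    rw [Policy.orders, this, Set.ncard_coe_finset, Finset.card_range]
  have hint : ∫ s in Set.Ico 0 t, (cyclicPolicy L).inventory s
      ≤ ∑ k ∈ Finset.range (n + 1), (cyclicPolicy L).q k ^ 2 / 2 := by
    rw [← cyclicPolicy_integral hne hpos]
    refine setIntegral_mono_set (hF.integrableOn_inventory _) ?_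
      (Filter.Eventually.of_forall fun s hs => ⟨hs.1, hs.2.trans_le hn2⟩)
    exact (ae_restrict_iff' measurableSet_Ico).2
      (Filter.Eventually.of_forall fun s hs => hF.inventory_nonneg s hs.1)
  have hdiv := Nat.div_add_mod n L.length
  have hmod := Nat.mod_lt n hlen
  set w := n / L.length
  have hsum : ∑ k ∈ Finset.range (n + 1), (K + H * (cyclicPolicy L).q k ^ 2) ≤ (w + 1) * C := by
    have h1 := sum_range_getD_mod L (fun x => K + H * (x : ℝ) ^ 2) (w + 1) 0
    simp only [Finset.range_zero, Finset.sum_empty, add_zero] at h1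
    push_cast at h1
    rw [← hC] at h1
    rw [← h1]
    refine Finset.sum_le_sum_of_subset_of_nonneg (Finset.range_subset_range.2 ?_)
      fun k _ _ => by positivity
    rw [add_mul, mul_comm w]
    omega
  have hwt : w * cycleTime L ≤ t := by
    have h1 := cyclicPolicy_τ_mul_add (L := L) w 0
    have h2 : (cyclicPolicy L).τ (w * L.length + 0) ≤ (cyclicPolicy L).τ n :=
      hF.strictMono.monotone (by rw [mul_comm]; omega)
    rw [h1, hF.zero] at h2
    linarith
  have hwle : (w : ℝ) ≤ t / cycleTime L := (le_div_iff₀ hV).2 hwt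
  calc (cyclicPolicy L).costUpTo K H t
      ≤ K * (n + 1 : ℕ) + 2 * H * ∑ k ∈ Finset.range (n + 1), (cyclicPolicy L).q k ^ 2 / 2 := by
        rw [Policy.costUpTo, horders]
        gcongr
    _ = ∑ k ∈ Finset.range (n + 1), (K + H * (cyclicPolicy L).q k ^ 2) := by
        rw [Finset.sum_add_distrib, Finset.sum_const, Finset.card_range, nsmul_eq_mul,
          Finset.mul_sum, mul_comm K]
        congr 1
        refine Finset.sum_congr rfl fun k _ => ?_
        ring
    _ ≤ (w + 1) * C := hsum
    _ ≤ (t / cycleTime L + 1) * C := by gcongr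
    _ = _ := by ring

theorem limsup_div_le {f : ℝ → ℝ} {a b : ℝ} (h : ∀ t, 0 < t → f t ≤ a * t + b) :
    limsup (fun t : ℝ => ENNReal.ofReal (f t / t)) atTop ≤ ENNReal.ofReal a := by
  have h1 : Tendsto (fun t : ℝ => ENNReal.ofReal (a + b / t)) atTop (nhds (ENNReal.ofReal a)) := by
    refine ENNReal.tendsto_ofReal ?_
    have h2 : Tendsto (fun t : ℝ => b / t) atTop (nhds 0) :=
      tendsto_const_nhds.div_atTop tendsto_id
    simpa using h2.const_add a
  rw [← h1.limsup_eq]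
  refine limsup_le_limsup ?_
  filter_upwards [eventually_gt_atTop 0] with t ht
  refine ENNReal.ofReal_le_ofReal ?_
  rw [div_le_iff₀ ht, add_mul, div_mul_cancel₀ _ ht.ne']
  exact h t ht

theorem cyclicPolicy_cost_le (hne : L ≠ []) (hpos : ∀ x ∈ L, 0 < x) {K H : ℝ} (hK : 0 ≤ K)
    (hH : 0 ≤ H) : (cyclicPolicy L).cost K H
      ≤ ENNReal.ofReal ((L.map fun x : ℚ≥0 => K + H * (x : ℝ) ^ 2).sum / cycleTime L) :=
  limsup_div_le fun _ ht => cyclicPolicy_costUpTo_le hne hpos hK hH ht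

/-- Write `k` as a multiple of the length of `L` plus a remainder. As `L₂` is nonempty, the end of a
cycle counts as the start of the next one. -/
theorem exists_cyclicPolicy_τ_eq (hne : L ≠ []) (k : ℕ) :
    ∃ (w : ℕ) (L₁ L₂ : List ℚ≥0), L = L₁ ++ L₂ ∧ L₂ ≠ [] ∧
      (cyclicPolicy L).τ k = w * cycleTime L + cycleTime L₁ := by
  have hlt : k % L.length < L.length := Nat.mod_lt _ (List.length_pos_iff.2 hne)
  refine ⟨k / L.length, L.take (k % L.length), L.drop (k % L.length),
    (List.take_append_drop _ _).symm, ?_, ?_⟩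
  · rw [Ne, List.drop_eq_nil_iff]; omega
  · have h := cyclicPolicy_τ_mul_add (L := L) (k / L.length) (k % L.length)
    rw [Nat.div_add_mod'] at h
    rw [h]
    congr 1
    have : ∀ i ≤ L.length, (cyclicPolicy L).τ i = cycleTime (L.take i) := by
      intro i
      induction i with
      | zero => intro _; simp [cyclicPolicy_τ_zero, cycleTime]
      | succ i ih =>
        intro hi
        have hiL : i < L.length := hi
        rw [cyclicPolicy_τ_succ, ih hiL.le, cycleTime, cycleTime, List.take_add_one,
          List.getElem?_eq_getElem hiL]
        simp only [Option.toList_some, List.map_append, List.sum_append, List.map_cons,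
          List.map_nil, List.sum_singleton, add_right_inj]
        change ((L.getD (i % L.length) 0 : ℚ≥0) : ℝ) = _
        rw [Nat.mod_eq_of_lt hiL, List.getD_eq_getElem _ _ hiL]
    exact this _ hlt.le

end Cyclic

/-- Meant for short items, which are ordered at the offsets `A` in cycles of length `V`, and long
items, which are ordered at multiples of `W`. -/
theorem jointOrders_le {n : ℕ} {P : Fin n → Policy} {V W : ℝ} (hV : 0 < V) (hW : 0 < W)
    (A : Finset ℝ) (hA : ∀ a ∈ A, 0 ≤ a)
    (h : ∀ i k, (∃ w : ℕ, ∃ a ∈ A, (P i).τ k = w * V + a) ∨ ∃ j : ℕ, (P i).τ k = j * W)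
    {t : ℝ} (ht : 0 < t) :
    (jointOrders P t : ℝ) ≤ (A.card / V + 1 / W) * t + (A.card + 1) := by
  classical
  let B : Finset ℝ := (Finset.range ⌈t / V⌉₊ ×ˢ A).image (fun x : ℕ × ℝ => (x.1 : ℝ) * V + x.2)
    ∪ (Finset.range ⌈t / W⌉₊).image (fun j : ℕ => (j : ℝ) * W)
  have h1 : jointOrders P t ≤ B.card := by
    rw [jointOrders, ← Set.ncard_coe_finset]
    refine Set.ncard_le_ncard ?_ (Finset.finite_toSet _)
    rintro s ⟨-, hst, i, k, hk⟩
    rw [Finset.mem_coe, Finset.mem_union, Finset.mem_image, Finset.mem_image]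
    rcases h i k with ⟨w, a, ha, hw⟩ | ⟨j, hj⟩
    · refine Or.inl ⟨(w, a), ?_, by rw [← hw, hk]⟩
      rw [Finset.mem_product, Finset.mem_range]
      refine ⟨Nat.lt_ceil.2 ((lt_div_iff₀ hV).2 ?_), ha⟩
      have := hA a ha
      linarith
    · refine Or.inr ⟨j, ?_, by rw [← hj, hk]⟩
      rw [Finset.mem_range]
      exact Nat.lt_ceil.2 ((lt_div_iff₀ hW).2 (by linarith))
  have h2 : B.card ≤ ⌈t / V⌉₊ * A.card + ⌈t / W⌉₊ := by
    refine (Finset.card_union_le _ _).trans (add_le_add ?_ ?_)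
    · exact Finset.card_image_le.trans_eq (by rw [Finset.card_product, Finset.card_range])
    · exact Finset.card_image_le.trans_eq (Finset.card_range _)
  have h3 : (jointOrders P t : ℝ) ≤ ⌈t / V⌉₊ * A.card + ⌈t / W⌉₊ := by
    exact_mod_cast h1.trans h2
  have h4 := (Nat.ceil_lt_add_one (show 0 ≤ t / V by positivity)).le
  have h5 := (Nat.ceil_lt_add_one (show 0 ≤ t / W by positivity)).le
  calc (jointOrders P t : ℝ) ≤ ⌈t / V⌉₊ * A.card + ⌈t / W⌉₊ := h3
    _ ≤ (t / V + 1) * A.card + (t / W + 1) := by gcongr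
    _ = _ := by ring

end JRP

namespace JRP

/-! ### Masks and gaps -/

theorem mem_extendMasks {l : List (List ℕ)} {x : List ℕ} :
    x ∈ extendMasks l ↔ ∃ y ∈ l, x = 0 :: y ∨ x = 1 :: y := by
  have h : ∀ l b : List (List ℕ), x ∈ l.foldl (fun b x => (0 :: x) :: (1 :: x) :: b) b ↔
      x ∈ b ∨ ∃ y ∈ l, x = 0 :: y ∨ x = 1 :: y := by
    intro l
    induction l with
    | nil => simp
    | cons z l ih => intro b; rw [List.foldl_cons, ih]; grind
  simpa [extendMasks] using h l []

theorem masks_succ (k : ℕ) : masks (k + 1) = extendMasks (masks k) :=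
  Function.iterate_succ_apply' _ _ _

theorem length_of_mem_masks {k : ℕ} {x : List ℕ} (h : x ∈ masks k) : x.length = k := by
  induction k generalizing x with
  | zero => simp_all [masks]
  | succ k ih =>
    rw [masks_succ, mem_extendMasks] at h
    obtain ⟨y, hy, rfl | rfl⟩ := h <;> simp [ih hy]

theorem masks_ne_nil (k : ℕ) : masks k ≠ [] := by
  induction k with
  | zero => simp [masks]
  | succ k ih =>
    obtain ⟨y, hy⟩ := List.exists_mem_of_ne_nil _ ih
    rw [masks_succ]
    exact List.ne_nil_of_mem (mem_extendMasks.2 ⟨y, hy, Or.inl rfl⟩)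

theorem headD_mem_masks (k : ℕ) : (masks k).headD [] ∈ masks k := by
  cases h : masks k with
  | nil => exact absurd h (masks_ne_nil k)
  | cons a l => simp

open Classical in
/-- The mask of the positions `1, …, k` with property `p`. -/
noncomputable def mask (p : ℕ → Prop) : ℕ → List ℕ
  | 0 => []
  | k + 1 => (if p (k + 1) then 1 else 0) :: mask p k

theorem mask_mem_masks (p : ℕ → Prop) (k : ℕ) : mask p k ∈ masks k := by
  induction k with
  | zero => simp [masks, mask]
  | succ k ih =>
    rw [masks_succ, mem_extendMasks]
    refine ⟨_, ih, ?_⟩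
    by_cases h : p (k + 1) <;> simp [mask, h]

open Classical in
theorem mask_sum (p : ℕ → Prop) (k : ℕ) :
    (mask p k).sum = ∑ j ∈ Finset.range k, if p (j + 1) then 1 else 0 := by
  induction k with
  | zero => simp [mask]
  | succ k ih => rw [mask, List.sum_cons, ih, Finset.sum_range_succ, add_comm]

theorem gapsFrom_nil (S : List ℕ) (c : ℕ) (g : List ℕ) : gapsFrom (S, c, g) [] = (c + 1) :: g := rfl

theorem gapsFrom_cons_cons (s : ℕ) (S : List ℕ) (c : ℕ) (g : List ℕ) (b : ℕ) (R : List ℕ) :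
    gapsFrom (s :: S, c, g) (b :: R)
      = if 0 < b * s then gapsFrom (S, 0, (c + 1) :: g) R else gapsFrom (S, c + 1, g) R := by
  split_ifs with h <;> simp [gapsFrom, gapStep, h]

theorem gapsFrom_sum_and_pos {S R : List ℕ} (hSR : S.length = R.length) (c : ℕ) (g : List ℕ)
    (hg : ∀ x ∈ g, 0 < x) :
    (gapsFrom (S, c, g) R).sum = R.length + 1 + c + g.sum ∧
      ∀ x ∈ gapsFrom (S, c, g) R, 0 < x := by
  induction R generalizing S c g with
  | nil =>
    rw [gapsFrom_nil]
    refine ⟨by simp; ring, ?_⟩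
    simpa using hg
  | cons b R ih =>
    cases S with
    | nil => simp at hSR
    | cons s S =>
      rw [gapsFrom_cons_cons]
      have hSR' : S.length = R.length := by simpa using hSR
      split_ifs
      · obtain ⟨h1, h2⟩ := ih hSR' 0 ((c + 1) :: g) (by simpa using hg)
        refine ⟨?_, h2⟩
        rw [h1]; simp; ring
      · obtain ⟨h1, h2⟩ := ih hSR' (c + 1) g hg
        refine ⟨?_, h2⟩
        rw [h1]; simp; ring

/-- Position `0` and the positions that are marked in a mask. -/
def marked : List ℕ → Finset ℕ
  | [] => {0}
  | b :: S => if 0 < b then insert (S.length + 1) (marked S) else marked S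

theorem card_marked_le (S : List ℕ) : (marked S).card ≤ 1 + S.sum := by
  induction S with
  | nil => simp [marked]
  | cons b S ih =>
    rw [marked, List.sum_cons]
    split_ifs with h
    · have := Finset.card_insert_le (S.length + 1) (marked S)
      omega
    · omega

/-- Prefix sums of the gaps are the order positions within a cycle, so a short item is ordered only
where `S` allows it. In the invariant, `R.length + 1 + c` is the marked position at which the gaps
`g` begin. -/
theorem prefix_sum_gapsFrom_mem {A : Finset ℕ} {S R : List ℕ} (hSR : S.length = R.length)
    (hA : marked S ⊆ A) (c : ℕ) (g : List ℕ)
    (hg : ∀ g₁ g₂, g = g₁ ++ g₂ → g₂ ≠ [] → R.length + 1 + c + g₁.sum ∈ A) (l₁ l₂ : List ℕ)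
    (hl : gapsFrom (S, c, g) R = l₁ ++ l₂) (hl₂ : l₂ ≠ []) : l₁.sum ∈ A := by
  induction R generalizing S c g with
  | nil =>
    obtain rfl : S = [] := List.length_eq_zero_iff.1 hSR
    rw [gapsFrom_nil] at hl
    cases l₁ with
    | nil => exact hA (by simp [marked])
    | cons a l₁ =>
      rw [List.cons_append, List.cons.injEq] at hl
      have := hg l₁ l₂ hl.2 hl₂
      rw [← hl.1, List.sum_cons]
      simpa [add_comm, add_left_comm, add_assoc] using this
  | cons b R ih =>
    cases S with
    | nil => simp at hSR
    | cons s S =>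
      rw [gapsFrom_cons_cons] at hl
      have hSR' : S.length = R.length := by simpa using hSR
      rw [marked] at hA
      split_ifs at hl with h
      · rw [if_pos (Nat.pos_of_mul_pos_left h)] at hA
        refine ih hSR' ((Finset.subset_insert _ _).trans hA) 0 ((c + 1) :: g) ?_ hl
        intro g₁ g₂ hgg hg₂
        cases g₁ with
        | nil =>
          have := hA (Finset.mem_insert_self _ _)
          simpa [hSR'] using this
        | cons a g₁ =>
          rw [List.cons_append, List.cons.injEq] at hgg
          have := hg g₁ g₂ hgg.2 hg₂
          rw [← hgg.1, List.sum_cons]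
          convert this using 1
          simp only [List.length_cons]
          ring
      · have hA' : marked S ⊆ A := by
          split_ifs at hA with hs
          · exact (Finset.subset_insert _ _).trans hA
          · exact hA
        refine ih hSR' hA' (c + 1) g (fun g₁ g₂ hgg hg₂ => ?_) hl
        have := hg g₁ g₂ hgg hg₂
        convert this using 1
        simp only [List.length_cons]
        ring

theorem gapsFrom_mask_succ {p q : ℕ → Prop} (hqp : ∀ j, q j → p j) (k c : ℕ) (g : List ℕ)
    [Decidable (q (k + 1))] :
    gapsFrom (mask p (k + 1), c, g) (mask q (k + 1))
      = if q (k + 1) then gapsFrom (mask p k, 0, (c + 1) :: g) (mask q k)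
        else gapsFrom (mask p k, c + 1, g) (mask q k) := by
  rw [mask, mask, gapsFrom_cons_cons]
  by_cases h : q (k + 1)
  · simp [h, hqp _ h]
  · simp [h]

theorem length_gapsFrom_mask {p q : ℕ → Prop} (hqp : ∀ j, q j → p j) (k c : ℕ) (g : List ℕ) :
    (gapsFrom (mask p k, c, g) (mask q k)).length = 1 + g.length + (mask q k).sum := by
  classical
  induction k generalizing c g with
  | zero => simp [mask, gapsFrom_nil, add_comm]
  | succ k ih =>
    rw [gapsFrom_mask_succ hqp, mask, List.sum_cons]
    split_ifs with h
    · rw [ih, List.length_cons]; ring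
    · rw [ih]; ring

def sumSq (g : List ℕ) : ℕ := (g.map fun x => x * x).sum

theorem cycleCost_eq (it : ℕ × ℕ) (g : List ℕ) :
    cycleCost it g = it.1 * g.length + it.2 * sumSq g := by
  induction g with
  | nil => simp [cycleCost, sumSq]
  | cons a g ih =>
    simp only [cycleCost, sumSq, List.map_cons, List.sum_cons, List.length_cons] at ih ⊢
    rw [ih]
    ring

/-- Rounding the orders of a policy down to a grid of step `δ`. -/
theorem sumSq_gapsFrom_mask_le {P : Policy} (hP : P.Feasible) {δ T : ℝ} (hδ : 0 < δ) (hT : 0 ≤ T)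
    {p q : ℕ → Prop} (hqp : ∀ j, q j → p j)
    (hq : ∀ (j i : ℕ), T + j * δ ≤ P.τ i → P.τ i < T + (j + 1) * δ → q j) (k c : ℕ) (g : List ℕ)
    (hc : ∀ i, ¬(T + (k + 1) * δ ≤ P.τ i ∧ P.τ i < T + (k + 1 + c) * δ)) :
    δ ^ 2 * (sumSq (gapsFrom (mask p k, c, g) (mask q k)) : ℝ)
      ≤ δ ^ 2 * (sumSq g + c ^ 2 + 2 * c + 1 + 3 * k)
        + 2 * ∫ s in Set.Ico (T + δ) (T + (k + 1) * δ), P.inventory s := by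
  classical
  induction k generalizing c g with
  | zero =>
    simp only [mask, gapsFrom_nil, sumSq, List.map_cons, List.sum_cons, Nat.cast_zero, zero_add,
      one_mul, Set.Ico_self, Measure.restrict_empty, integral_zero_measure]
    push_cast
    apply le_of_eq
    ring
  | succ k ih =>
    have hk1 : T + δ ≤ T + (k + 1) * δ := by nlinarith [Nat.cast_nonneg (α := ℝ) k]
    have hk2 : T + (k + 1) * δ ≤ T + (k + 1 + 1) * δ := by nlinarith
    have hint : IntegrableOn P.inventory (Set.Ico (T + δ) (T + (k + 1 + 1) * δ)) :=
      (hP.integrableOn_inventory _).mono_set (Set.Ico_subset_Ico_left (by linarith))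
    rw [gapsFrom_mask_succ hqp]
    push_cast at hc ⊢
    rw [setIntegral_Ico_add hk1 hk2 hint]
    have hnonneg : ∀ s ∈ Set.Ico (T + (k + 1) * δ) (T + (k + 1 + 1) * δ), 0 ≤ s := fun s hs => by
      have := hs.1; linarith
    split_ifs with h
    -- The term $c^2+2c+1=(c+1)^2$ anticipates the open gap. Closing it here leaves a new open gap
    -- of square 1, covered by the allowance of 3 for this cell.
    · have h1 := ih 0 ((c + 1) :: g) (fun i hi => by
        have := hi.1.trans_lt hi.2
        simp at this)
      have h2 : 0 ≤ ∫ s in Set.Ico (T + (k + 1) * δ) (T + (k + 1 + 1) * δ), P.inventory s :=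
        setIntegral_nonneg measurableSet_Ico fun s hs => hP.inventory_nonneg s (hnonneg s hs)
      simp only [sumSq, List.map_cons, List.sum_cons, Nat.cast_zero] at h1 ⊢
      push_cast at h1 ⊢
      nlinarith [sq_nonneg δ]
    · have hno : ∀ i, ¬(T + (k + 1) * δ ≤ P.τ i ∧ P.τ i < T + (k + 1 + 1 + c) * δ) := by
        rintro i ⟨hi1, hi2⟩
        by_cases hi : P.τ i < T + (k + 1 + 1) * δ
        · exact h (hq (k + 1) i (by push_cast; exact hi1) (by push_cast; exact hi))
        · exact hc i ⟨not_lt.1 hi, hi2⟩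
      have h1 := ih (c + 1) g (fun i hi => hno i ⟨hi.1, by
        have := hi.2
        push_cast at this
        rwa [show (k + 1 + (c + 1) : ℝ) = k + 1 + 1 + c by ring] at this⟩)
      -- An empty cell raises the square of the open gap by $2c+3$. The allowance pays 3, and $2c$
      -- is paid by the inventory, which is at least $c\delta$ throughout this cell because `c`
      -- further cells contain no order.
      have h2 : c * δ ^ 2
          ≤ ∫ s in Set.Ico (T + (k + 1) * δ) (T + (k + 1 + 1) * δ), P.inventory s := by
        have h3 : ∫ _ in Set.Ico (T + (k + 1) * δ) (T + (k + 1 + 1) * δ), (c * δ : ℝ)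
            = c * δ ^ 2 := by
          rw [setIntegral_const, Measure.real, Real.volume_Ico, ENNReal.toReal_ofReal (by linarith),
            smul_eq_mul]
          ring
        rw [← h3]
        refine setIntegral_mono_on (integrableOn_const (by simp)) (hint.mono_set
          (Set.Ico_subset_Ico_left hk1)) measurableSet_Ico fun s hs => ?_
        have h4 := hP.sub_le_inventory (u := s) (v := T + (k + 1 + 1 + c) * δ) (hnonneg s hs)
          (fun i hi => hno i ⟨hs.1.trans hi.1.le, hi.2⟩)
        have := hs.2
        linarith
      push_cast at h1
      nlinarith [sq_nonneg δ]

open Classical in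
/-- The number of occupied grid cells is at most the number of orders. -/
theorem sum_mask_le_card {δ : ℝ} (hδ : 0 < δ) {occ : ℕ → Prop} (O : Finset ℝ) (L N : ℕ)
    (h : ∀ k < N * (L + 1), occ k → ∃ s ∈ O, k * δ ≤ s ∧ s < (k + 1) * δ) :
    ∑ w ∈ Finset.range N, (mask (fun j => occ (w * (L + 1) + j)) L).sum ≤ O.card := by
  have h1 : ∑ w ∈ Finset.range N, (mask (fun j => occ (w * (L + 1) + j)) L).sum
      ≤ ∑ k ∈ Finset.range (N * (L + 1)), if occ k then 1 else 0 := by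
    clear h
    induction N with
    | zero => simp
    | succ N ih =>
      rw [Finset.sum_range_succ, add_mul, one_mul, Finset.sum_range_add, mask_sum]
      refine add_le_add ih ?_
      rw [Finset.sum_range_succ']
      omega
  refine h1.trans ?_
  rw [← Finset.card_filter]
  -- An order determines its cell, so distinct occupied cells contain distinct orders.
  have h2 : (Finset.range (N * (L + 1))).filter occ ⊆ O.image fun s => ⌊s / δ⌋₊ := by
    intro k hk
    rw [Finset.mem_filter, Finset.mem_range] at hk
    obtain ⟨s, hs, h3, h4⟩ := h k hk.1 hk.2
    refine Finset.mem_image.2 ⟨s, hs, ?_⟩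
    rw [Nat.floor_eq_iff (div_nonneg (le_trans (by positivity) h3) hδ.le), le_div_iff₀ hδ,
      div_lt_iff₀ hδ]
    exact ⟨h3, h4⟩
  exact (Finset.card_le_card h2).trans Finset.card_image_le

end JRP

namespace JRP

/-! ### The approximation guarantee in grid units -/

/-- Some order is placed during the grid cell `k`. -/
def Policy.Occ (P : Policy) (δ : ℝ) (k : ℕ) : Prop := ∃ i, k * δ ≤ P.τ i ∧ P.τ i < (k + 1) * δ

/-- The rounding estimate summed over `N` windows; in each, $1+3L\le 3(L+1)$, so the loss is at most
$3\delta^2$ per cell. -/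
theorem Policy.Feasible.sum_sumSq_gaps_le {P : Policy} (hP : P.Feasible) {δ : ℝ} (hδ : 0 < δ)
    {occ : ℕ → Prop} (hocc : ∀ k, P.Occ δ k → occ k) (L N : ℕ) :
    δ ^ 2 * ∑ w ∈ Finset.range N, (sumSq (gaps (mask (fun j => occ (w * (L + 1) + j)) L)
        (mask (fun j => P.Occ δ (w * (L + 1) + j)) L)) : ℝ)
      ≤ 3 * δ ^ 2 * (L + 1) * N
        + 2 * ∫ s in Set.Ico 0 (N * ((L + 1) * δ)), P.inventory s := by
  induction N with
  | zero => simp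
  | succ N ih =>
    have hle : (N : ℝ) * ((L + 1) * δ) ≤ (N + 1 : ℕ) * ((L + 1) * δ) := by
      have : (0 : ℝ) ≤ (L + 1) * δ := by positivity
      push_cast
      linarith
    have h0 : (0 : ℝ) ≤ N * ((L + 1) * δ) := by positivity
    rw [Finset.sum_range_succ, mul_add, setIntegral_Ico_add h0 hle (hP.integrableOn_inventory _)]
    have h1 := sumSq_gapsFrom_mask_le hP hδ h0 (p := fun j => occ (N * (L + 1) + j))
      (q := fun j => P.Occ δ (N * (L + 1) + j)) (fun j => hocc _)
      (fun j i hj1 hj2 => ⟨i, by push_cast; linarith, by push_cast; linarith⟩) L 0 []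
      (fun i hi => by
        have := hi.1.trans_lt hi.2
        simp at this)
    have h2 : ∫ s in Set.Ico (N * ((L + 1) * δ) + δ) (N * ((L + 1) * δ) + (L + 1) * δ), P.inventory s
        ≤ ∫ s in Set.Ico (N * ((L + 1) * δ)) ((N + 1 : ℕ) * ((L + 1) * δ)), P.inventory s := by
      refine setIntegral_mono_set ((hP.integrableOn_inventory _).mono_set
        (Set.Ico_subset_Ico_left h0)) ?_ (Filter.Eventually.of_forall fun s hs => ?_)
      · exact (ae_restrict_iff' measurableSet_Ico).2
          (Filter.Eventually.of_forall fun s hs => hP.inventory_nonneg s (h0.trans hs.1))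
      · refine ⟨le_trans (by linarith) hs.1, hs.2.trans_eq ?_⟩
        push_cast
        ring
    rw [show sumSq [] = 0 from rfl] at h1
    push_cast at h1 h2 ih ⊢
    have h3 := sq_nonneg δ
    rw [gaps]
    nlinarith

theorem Policy.Feasible.sum_mask_occ_le {P : Policy} (hP : P.Feasible) {δ : ℝ} (hδ : 0 < δ)
    (L N : ℕ) :
    ∑ w ∈ Finset.range N, (mask (fun j => P.Occ δ (w * (L + 1) + j)) L).sum
      ≤ P.orders (N * ((L + 1) * δ)) := by
  refine (sum_mask_le_card hδ (hP.times (N * ((L + 1) * δ))) L N ?_).trans (hP.card_times_le _)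
  rintro k hk ⟨i, hi1, hi2⟩
  refine ⟨P.τ i, hP.mem_times.2 ⟨hi2.trans_le ?_, i, rfl⟩, hi1, hi2⟩
  rw [← mul_assoc]
  gcongr
  exact_mod_cast hk

theorem sum_mask_joint_le {n : ℕ} {Q : Fin n → Policy} (hQ : ∀ i, (Q i).Feasible) {δ : ℝ}
    (hδ : 0 < δ) (L N : ℕ) :
    ∑ w ∈ Finset.range N, (mask (fun j => ∃ i, (Q i).Occ δ (w * (L + 1) + j)) L).sum
      ≤ jointOrders Q (N * ((L + 1) * δ)) := by
  have hfin := jointOrders_finite hQ (N * ((L + 1) * δ))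
  rw [jointOrders, Set.ncard_eq_toFinset_card _ hfin]
  refine sum_mask_le_card (occ := fun k => ∃ i, (Q i).Occ δ k) hδ hfin.toFinset L N ?_
  rintro k hk ⟨i, l, hi1, hi2⟩
  refine ⟨(Q i).τ l, (Set.Finite.mem_toFinset _).2
    ⟨(hQ i).nonneg l, hi2.trans_le ?_, i, l, rfl⟩, hi1, hi2⟩
  rw [← mul_assoc]
  gcongr
  exact_mod_cast hk

theorem exists_itemGaps_eq {k : ℕ} (S : List ℕ) (it : ℕ × ℕ) :
    ∃ R ∈ masks k, itemGaps (masks k) S it = gaps S R := by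
  refine ⟨_, ?_, rfl⟩
  rcases argmin_mem (fun R => cycleCost it (gaps S R)) ((masks k).headD []) (masks k) with h | h
  · rw [h]; exact headD_mem_masks k
  · exact h

theorem cycleCost_itemGaps_le {k : ℕ} (S : List ℕ) (it : ℕ × ℕ) {R : List ℕ} (hR : R ∈ masks k) :
    cycleCost it (itemGaps (masks k) S it) ≤ cycleCost it (gaps S R) :=
  (argmin_le (fun R => cycleCost it (gaps S R)) ((masks k).headD []) (masks k)).2 R hR

theorem bestMask_mem {k : ℕ} (u₀ M : ℕ) (items : List (ℕ × ℕ)) :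
    bestMask u₀ M items (masks k) ∈ masks k := by
  rcases argmin_mem (totalCost u₀ M items (masks k)) ((masks k).headD []) (masks k) with h | h
  · rw [bestMask, h]; exact headD_mem_masks k
  · exact h

theorem totalCost_bestMask_le {k : ℕ} (u₀ M : ℕ) (items : List (ℕ × ℕ)) {S : List ℕ}
    (hS : S ∈ masks k) : totalCost u₀ M items (masks k) (bestMask u₀ M items (masks k))
      ≤ totalCost u₀ M items (masks k) S :=
  (argmin_le (totalCost u₀ M items (masks k)) ((masks k).headD []) (masks k)).2 S hS

/-- The cycle found by the search costs at most as much as the average of any other policy, up to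
the cost of starting a new cycle and of rounding to the grid. -/
theorem mul_totalCost_le {n : ℕ} {Q : Fin n → Policy} (hQ : ∀ i, (Q i).Feasible) {δ : ℝ}
    (hδ : 0 < δ) (u₀ M : ℕ) (its : Fin n → ℕ × ℕ) (L N : ℕ) :
    (N : ℝ) * totalCost u₀ M (List.ofFn its) (masks L) (bestMask u₀ M (List.ofFn its) (masks L))
      ≤ u₀ * (N + jointOrders Q (N * ((L + 1) * δ)))
        + ∑ i, if IsShort M (its i) then
            ((its i).1 : ℝ) * (N + (Q i).orders (N * ((L + 1) * δ)))
              + (its i).2 / δ ^ 2 * (3 * δ ^ 2 * (L + 1) * N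
                + 2 * ∫ s in Set.Ico 0 (N * ((L + 1) * δ)), (Q i).inventory s)
          else 0 := by
  let S : ℕ → List ℕ := fun w => mask (fun j => ∃ i, (Q i).Occ δ (w * (L + 1) + j)) L
  let R : Fin n → ℕ → List ℕ := fun i w => mask (fun j => (Q i).Occ δ (w * (L + 1) + j)) L
  -- The grid cells occupied during window `w`, jointly and by each item, form a candidate in the
  -- search.
  have h1 : ∀ w, totalCost u₀ M (List.ofFn its) (masks L) (bestMask u₀ M (List.ofFn its) (masks L))
      ≤ u₀ * (1 + (S w).sum) + ∑ i, if IsShort M (its i) then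
        (its i).1 * (1 + (R i w).sum) + (its i).2 * sumSq (gaps (S w) (R i w)) else 0 := by
    intro w
    refine (totalCost_bestMask_le u₀ M _
      (mask_mem_masks (fun j => ∃ i, (Q i).Occ δ (w * (L + 1) + j)) L)).trans ?_
    rw [totalCost, List.map_ofFn, List.sum_ofFn]
    refine Nat.add_le_add_left (Finset.sum_le_sum fun i _ => ?_) _
    simp only [Function.comp, shortCost]
    split_ifs
    · refine (cycleCost_itemGaps_le _ _
        (mask_mem_masks (fun j => (Q i).Occ δ (w * (L + 1) + j)) L)).trans_eq ?_
      rw [cycleCost_eq, gaps, length_gapsFrom_mask (fun j hj => ⟨i, hj⟩)]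
      simp [R]
    · exact le_rfl
  have h2 := Finset.sum_le_sum fun w (_ : w ∈ Finset.range N) => h1 w
  rw [Finset.sum_const, Finset.card_range, smul_eq_mul, Finset.sum_add_distrib,
    Finset.sum_comm] at h2
  have h3 : ((N * totalCost u₀ M (List.ofFn its) (masks L)
      (bestMask u₀ M (List.ofFn its) (masks L)) : ℕ) : ℝ) ≤ _ := Nat.cast_le.2 h2
  simp only [Nat.cast_sum, Nat.cast_add, Nat.cast_mul, Nat.cast_ite, Nat.cast_one,
    Nat.cast_zero] at h3
  refine h3.trans (add_le_add ?_ (Finset.sum_le_sum fun i _ => ?_))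
  · rw [← Finset.mul_sum, Finset.sum_add_distrib]
    simp only [Finset.sum_const, Finset.card_range, nsmul_eq_mul, mul_one]
    gcongr
    exact_mod_cast sum_mask_joint_le hQ hδ L N
  · by_cases hi : IsShort M (its i)
    · simp only [if_pos hi]
      rw [Finset.sum_add_distrib, ← Finset.mul_sum, ← Finset.mul_sum, Finset.sum_add_distrib]
      simp only [Finset.sum_const, Finset.card_range, nsmul_eq_mul, mul_one]
      have h4 := (hQ i).sum_sumSq_gaps_le hδ (occ := fun k => ∃ i, (Q i).Occ δ k)
        (fun k hk => ⟨i, hk⟩) L N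
      have h5 : ∑ w ∈ Finset.range N, ((R i w).sum : ℝ) ≤ (Q i).orders (N * ((L + 1) * δ)) := by
        exact_mod_cast (hQ i).sum_mask_occ_le hδ L N
      have hδ2 : 0 < δ ^ 2 := by positivity
      have h6 : ∑ w ∈ Finset.range N, (sumSq (gaps (S w) (R i w)) : ℝ)
          ≤ (3 * δ ^ 2 * (L + 1) * N
            + 2 * ∫ s in Set.Ico 0 (N * ((L + 1) * δ)), (Q i).inventory s) / δ ^ 2 := by
        rw [le_div_iff₀ hδ2, mul_comm]
        exact h4
      refine add_le_add (by gcongr) ?_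
      rw [div_mul_eq_mul_div, mul_div_assoc]
      gcongr
    · simp [hi]

end JRP

/-! ### The approximation guarantee for integral costs. -/

namespace JRP

/-- The durations in a plan that is given in grid steps. -/
def durations (d : ℚ≥0) (g : List ℕ) : List ℚ≥0 := g.map fun x : ℕ => (x : ℚ≥0) * d

theorem cycleTime_durations (d : ℚ≥0) (g : List ℕ) :
    cycleTime (durations d g) = g.sum * (d : ℝ) := by
  induction g with
  | nil => simp [cycleTime, durations]
  | cons a g ih =>
    simp only [cycleTime, durations, List.map_cons, List.sum_cons] at ih ⊢
    rw [ih]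
    push_cast
    ring

theorem sum_cost_durations (d : ℚ≥0) (g : List ℕ) (K H : ℝ) :
    ((durations d g).map fun x : ℚ≥0 => K + H * (x : ℝ) ^ 2).sum
      = K * g.length + H * (d : ℝ) ^ 2 * sumSq g := by
  induction g with
  | nil => simp [durations, sumSq]
  | cons a g ih =>
    simp only [durations, sumSq, List.map_cons, List.sum_cons, List.length_cons,
      Nat.cast_add] at ih ⊢
    rw [ih]
    push_cast
    ring

theorem sqrt_bounds {a : ℕ} (ha : 1 ≤ a) :
    1 ≤ Nat.sqrt a ∧ Nat.sqrt a * Nat.sqrt a ≤ a ∧ a ≤ 4 * (Nat.sqrt a * Nat.sqrt a) := by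
  have h1 : 1 ≤ Nat.sqrt a := Nat.le_sqrt.2 (by omega)
  refine ⟨h1, Nat.sqrt_le a, ?_⟩
  have h2 : a < (Nat.sqrt a + 1) * (Nat.sqrt a + 1) := Nat.lt_succ_sqrt a
  nlinarith

/-- The number of grid steps between the orders of an item with a long ideal order interval. -/
def longPlan (M : ℕ) (it : ℕ × ℕ) : ℕ :=
  Nat.sqrt (it.1 / (it.2 * (M * M * (M * M)))) * (M * M)

theorem longPlan_bounds {M : ℕ} {it : ℕ × ℕ} (hM : 1 ≤ M) (hv : 1 ≤ it.2) (h : ¬IsShort M it) :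
    1 ≤ longPlan M it ∧ it.2 * (longPlan M it) ^ 2 ≤ it.1 ∧
      (it.1 : ℝ) ≤ it.2 * ((longPlan M it : ℝ) * (1 + 1 / M)) ^ 2 := by
  set v := it.2 * (M * M * (M * M)) with hvdef
  have hv0 : 0 < v := by positivity
  set j := Nat.sqrt (it.1 / v) with hj
  have hx : longPlan M it = j * (M * M) := rfl
  -- This is where being long is used: $j\ge M$ makes rounding down to `j` lose at most the factor
  -- $1+1/M$.
  have hMj : M ≤ j := by
    rw [hj, Nat.le_sqrt, Nat.le_div_iff_mul_le hv0]
    rw [IsShort, not_lt] at h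
    calc M * M * v = it.2 * (M * M * M * (M * M * M)) := by rw [hvdef]; ring
      _ ≤ it.1 := h
  have h1 : j * j * v ≤ it.1 := (Nat.le_div_iff_mul_le hv0).1 (Nat.sqrt_le _)
  have h2 : it.1 < (j + 1) * (j + 1) * v := (Nat.div_lt_iff_lt_mul hv0).1 (Nat.lt_succ_sqrt _)
  refine ⟨?_, ?_, ?_⟩
  · rw [hx]
    have hj0 : 0 < j := hM.trans hMj
    exact Nat.one_le_iff_ne_zero.2 (by positivity)
  · calc it.2 * (longPlan M it) ^ 2 = j * j * v := by rw [hx, hvdef]; ring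
      _ ≤ it.1 := h1
  · have hM0 : (0 : ℝ) < M := by exact_mod_cast hM
    have h3 : (it.1 : ℝ) ≤ (j + 1) * (j + 1) * v := by exact_mod_cast h2.le
    refine h3.trans ?_
    have h4 : (j + 1 : ℝ) ≤ j * (1 + 1 / M) := by
      have : (1 : ℝ) ≤ j / M := by rw [one_le_div hM0]; exact_mod_cast hMj
      have h5 : (j : ℝ) * (1 + 1 / M) = j + j / M := by ring
      linarith
    calc ((j : ℝ) + 1) * (j + 1) * v ≤ (j * (1 + 1 / M)) * (j * (1 + 1 / M)) * v := by gcongr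
      _ = it.2 * ((longPlan M it : ℝ) * (1 + 1 / M)) ^ 2 := by
        rw [hx, hvdef]; push_cast; ring

/-- Every policy costs at least $2\sqrt{KH}\ge 2Hx$ per time unit, while the interval $x$ costs at
most $Hx(1+(1+1/m)^2)\le 2Hx(1+3/(2m))$. -/
theorem long_cost_le {P : Policy} (hP : P.Feasible) {K H x m t : ℝ} (hK : 0 ≤ K) (hH : 0 ≤ H)
    (hx : 0 < x) (hm : 1 ≤ m) (h1 : H * x ^ 2 ≤ K) (h2 : K ≤ H * (x * (1 + 1 / m)) ^ 2)
    (ht : 0 < t) :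
    (K + H * x ^ 2) / x * t ≤ (1 + 3 / (2 * m)) * P.costUpTo K H t := by
  have h3 : 2 * H * x * t ≤ P.costUpTo K H t :=
    hP.mul_le_costUpTo hK hH (by nlinarith) ht
  have hm' : 1 / m ≤ 1 := by rw [div_le_one (by linarith)]; exact hm
  have hm0 : 0 ≤ 1 / m := by positivity
  have h4 : (K + H * x ^ 2) / x ≤ (1 + 3 / (2 * m)) * (2 * H * x) := by
    rw [div_le_iff₀ hx]
    have h5 : (3 : ℝ) / (2 * m) = 3 / 2 * (1 / m) := by
      field_simp
    rw [h5]
    have h6 : 0 ≤ H * x ^ 2 := by positivity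
    have h7 : (1 / m) ^ 2 ≤ 1 / m := by nlinarith
    have h8 := mul_le_mul_of_nonneg_left h7 h6
    nlinarith
  calc (K + H * x ^ 2) / x * t ≤ (1 + 3 / (2 * m)) * (2 * H * x) * t := by gcongr
    _ = (1 + 3 / (2 * m)) * (2 * H * x * t) := by ring
    _ ≤ _ := by gcongr

/-- One extra order per time $m^2w$ is cheap for an item of ideal interval at most $mw$, whose cost
is at least $2\sqrt{KH}\ge 2K/(mw)$ per time unit. In the application $w=M^2\delta$ and $m=M$, so
that $m^2w$ is the cycle length. -/
theorem short_restart_le {P : Policy} (hP : P.Feasible) {K H w m t : ℝ} (hK : 0 ≤ K) (hH : 0 ≤ H)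
    (hw : 0 < w) (hm : 1 ≤ m) (h : K ≤ H * (m * w) ^ 2) (ht : 0 < t) :
    K / (m ^ 2 * w) * t ≤ 3 / (2 * m) * P.costUpTo K H t := by
  have h1 : 2 * K / (m * w) * t ≤ P.costUpTo K H t := by
    refine hP.mul_le_costUpTo hK hH ?_ ht
    rw [div_pow, div_le_iff₀ (by positivity)]
    nlinarith
  have h0 : 0 ≤ P.costUpTo K H t := le_trans (by positivity) h1
  calc K / (m ^ 2 * w) * t = 1 / (2 * m) * (2 * K / (m * w) * t) := by field_simp
    _ ≤ 1 / (2 * m) * P.costUpTo K H t := by gcongr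
    _ ≤ _ := by gcongr; norm_num

section Integral

variable {n : ℕ} (k₀ M : ℕ) (K h : Fin n → ℕ)

/-- The square root that determines the grid. -/
def gridRoot : ℕ := Nat.sqrt (k₀ * ∑ i, h i)

def gridItem (i : Fin n) : ℕ × ℕ :=
  (K i * ((∑ i, h i) * M * ((∑ i, h i) * M)), h i * (gridRoot k₀ h * gridRoot k₀ h))

def gridMask : List ℕ :=
  bestMask (k₀ * ((∑ i, h i) * M * ((∑ i, h i) * M))) M (List.ofFn (gridItem k₀ M K h))
    (masks (cycleLength M - 1))

def gridPlan (i : Fin n) : List ℕ :=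
  itemPlan M (masks (cycleLength M - 1)) (gridMask k₀ M K h) (gridItem k₀ M K h i)

/-- The length of a grid step. -/
def gridStep : ℚ≥0 := (gridRoot k₀ h : ℚ≥0) / ((∑ i, h i) * M : ℕ)

theorem solveInt_eq :
    solveInt k₀ M (List.ofFn fun i => (K i, h i)) (masks (cycleLength M - 1))
      = List.ofFn fun i => (gridPlan k₀ M K h i).map
          fun x => (x * gridRoot k₀ h, (∑ i, h i) * M) := by
  have hH : totalHolding (List.ofFn fun i => (K i, h i)) = ∑ i, h i := by
    rw [totalHolding, List.map_ofFn, List.sum_ofFn]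
    rfl
  have hits : gridItems (∑ i, h i) M (gridRoot k₀ h) (List.ofFn fun i => (K i, h i))
      = List.ofFn (gridItem k₀ M K h) := by
    rw [gridItems, List.map_ofFn]
    rfl
  simp only [solveInt, hH]
  rw [← gridRoot, hits, List.map_ofFn]
  rfl

variable {k₀ M K h}

/-- The average cost of the plan of an item. -/
noncomputable def planRate (k₀ M : ℕ) (K h : Fin n → ℕ) (i : Fin n) : ℝ :=
  ((durations (gridStep k₀ M h) (gridPlan k₀ M K h i)).map
      fun x : ℚ≥0 => (K i : ℝ) + h i * (x : ℝ) ^ 2).sum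
    / cycleTime (durations (gridStep k₀ M h) (gridPlan k₀ M K h i))

/-- The average number of joint orders. -/
noncomputable def jointRate (k₀ M : ℕ) (K h : Fin n → ℕ) : ℝ :=
  (1 + (gridMask k₀ M K h).sum) / (cycleLength M * (gridStep k₀ M h : ℝ))
    + 1 / (M ^ 2 * (gridStep k₀ M h : ℝ))

theorem sum_pos_of_one_le [NeZero n] (hh : ∀ i, 1 ≤ h i) : 1 ≤ ∑ i, h i :=
  (hh 0).trans (Finset.single_le_sum (f := h) (fun _ _ => Nat.zero_le _) (Finset.mem_univ 0))

theorem one_le_cycleLength (hM : 1 ≤ M) : 1 ≤ cycleLength M :=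
  Nat.one_le_iff_ne_zero.2 (by rw [cycleLength]; positivity)

theorem one_le_gridRoot [NeZero n] (hk : 1 ≤ k₀) (hh : ∀ i, 1 ≤ h i) : 1 ≤ gridRoot k₀ h :=
  (sqrt_bounds (Nat.one_le_iff_ne_zero.2 (by
    have := sum_pos_of_one_le hh; positivity))).1

theorem gridStep_pos [NeZero n] (hk : 1 ≤ k₀) (hM : 1 ≤ M) (hh : ∀ i, 1 ≤ h i) :
    0 < gridStep k₀ M h := by
  have h1 := one_le_gridRoot hk hh
  have h2 := sum_pos_of_one_le hh
  rw [gridStep]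
  positivity

theorem gridMask_length : (gridMask k₀ M K h).length = cycleLength M - 1 :=
  length_of_mem_masks (bestMask_mem _ _ _)

theorem gridPlan_short {i : Fin n} (hi : IsShort M (gridItem k₀ M K h i)) (hM : 1 ≤ M) :
    (gridPlan k₀ M K h i).sum = cycleLength M ∧ (∀ x ∈ gridPlan k₀ M K h i, 0 < x) ∧
      ∀ l₁ l₂, gridPlan k₀ M K h i = l₁ ++ l₂ → l₂ ≠ [] → l₁.sum ∈ marked (gridMask k₀ M K h) := by
  obtain ⟨R, hR, hgR⟩ := exists_itemGaps_eq (k := cycleLength M - 1) (gridMask k₀ M K h)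
    (gridItem k₀ M K h i)
  have hp : gridPlan k₀ M K h i = gapsFrom (gridMask k₀ M K h, 0, []) R := by
    rw [gridPlan, itemPlan, if_pos hi, hgR, gaps]
  have hlen : (gridMask k₀ M K h).length = R.length := by
    rw [gridMask_length, length_of_mem_masks hR]
  obtain ⟨h1, h2⟩ := gapsFrom_sum_and_pos hlen 0 [] (by simp)
  rw [hp]
  refine ⟨?_, h2, fun l₁ l₂ hl hl₂ => prefix_sum_gapsFrom_mem hlen le_rfl 0 [] ?_ l₁ l₂ hl hl₂⟩
  · rw [h1, length_of_mem_masks hR]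
    have := one_le_cycleLength hM
    simp
    omega
  · intro g₁ g₂ hg hg₂
    exact absurd (List.append_eq_nil_iff.1 hg.symm).2 hg₂

theorem gridPlan_long {i : Fin n} (hi : ¬IsShort M (gridItem k₀ M K h i)) :
    gridPlan k₀ M K h i = [longPlan M (gridItem k₀ M K h i)] := by
  rw [gridPlan, itemPlan, if_neg hi, longPlan]

theorem one_le_gridItem_snd [NeZero n] (hk : 1 ≤ k₀) (hh : ∀ i, 1 ≤ h i) (i : Fin n) :
    1 ≤ (gridItem k₀ M K h i).2 := by
  have h1 := one_le_gridRoot hk hh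
  have h2 := hh i
  exact Nat.one_le_iff_ne_zero.2 (by rw [gridItem]; positivity)

theorem gridPlan_pos [NeZero n] (hk : 1 ≤ k₀) (hM : 1 ≤ M) (hh : ∀ i, 1 ≤ h i) (i : Fin n) :
    gridPlan k₀ M K h i ≠ [] ∧ ∀ x ∈ gridPlan k₀ M K h i, 0 < x := by
  by_cases hi : IsShort M (gridItem k₀ M K h i)
  · obtain ⟨h1, h2, -⟩ := gridPlan_short hi hM
    refine ⟨fun h0 => ?_, h2⟩
    have := one_le_cycleLength hM
    rw [h0, List.sum_nil] at h1
    omega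
  · rw [gridPlan_long hi]
    refine ⟨by simp, ?_⟩
    simpa [Nat.one_le_iff_ne_zero, Nat.pos_iff_ne_zero] using (longPlan_bounds hM (one_le_gridItem_snd hk hh i) hi).1

theorem durations_pos [NeZero n] (hk : 1 ≤ k₀) (hM : 1 ≤ M) (hh : ∀ i, 1 ≤ h i) (i : Fin n) :
    durations (gridStep k₀ M h) (gridPlan k₀ M K h i) ≠ [] ∧
      ∀ x ∈ durations (gridStep k₀ M h) (gridPlan k₀ M K h i), 0 < x := by
  obtain ⟨h1, h2⟩ := gridPlan_pos (K := K) hk hM hh i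
  refine ⟨fun h0 => h1 (List.map_eq_nil_iff.1 h0), fun x hx => ?_⟩
  obtain ⟨y, hy, rfl⟩ := List.mem_map.1 hx
  have h3 := h2 y hy
  have h4 := gridStep_pos hk hM hh
  positivity

theorem jointOrders_plan_le [NeZero n] (hk : 1 ≤ k₀) (hM : 1 ≤ M) (hh : ∀ i, 1 ≤ h i) {t : ℝ}
    (ht : 0 < t) :
    (jointOrders (fun i => cyclicPolicy (durations (gridStep k₀ M h) (gridPlan k₀ M K h i))) t : ℝ)
      ≤ jointRate k₀ M K h * t + (2 + (gridMask k₀ M K h).sum) := by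
  classical
  have hd : 0 < (gridStep k₀ M h : ℝ) := by exact_mod_cast gridStep_pos hk hM hh
  have hG : (0 : ℝ) < cycleLength M := by exact_mod_cast one_le_cycleLength hM
  have hM0 : (0 : ℝ) < M := by exact_mod_cast hM
  set d : ℝ := (gridStep k₀ M h : ℝ) with hddef
  let A : Finset ℝ := (marked (gridMask k₀ M K h)).image fun a : ℕ => (a : ℝ) * d
  have hcard : (A.card : ℝ) ≤ 1 + (gridMask k₀ M K h).sum := by
    exact_mod_cast Finset.card_image_le.trans (card_marked_le _)
  have h1 := jointOrders_le
    (P := fun i => cyclicPolicy (durations (gridStep k₀ M h) (gridPlan k₀ M K h i)))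
    (V := cycleLength M * d) (W := M ^ 2 * d) (by positivity) (by positivity) A
    (fun a ha => by
      obtain ⟨b, -, rfl⟩ := Finset.mem_image.1 ha
      positivity)
    (fun i k => by
      obtain ⟨w, L₁, L₂, hL, hL₂, hτ⟩ :=
        exists_cyclicPolicy_τ_eq (durations_pos (K := K) hk hM hh i).1 k
      obtain ⟨l₁, l₂, hl, rfl, rfl⟩ := List.map_eq_append_iff.1 hL
      have hl₂ : l₂ ≠ [] := by rintro rfl; exact hL₂ rfl
      change _ = _ + cycleTime (durations (gridStep k₀ M h) l₁) at hτ
      rw [cycleTime_durations, cycleTime_durations] at hτ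
      by_cases hi : IsShort M (gridItem k₀ M K h i)
      · obtain ⟨h2, -, h3⟩ := gridPlan_short hi hM
        refine Or.inl ⟨w, _, Finset.mem_image.2 ⟨_, h3 l₁ l₂ hl hl₂, rfl⟩, ?_⟩
        rw [hτ, h2]
      · right
        rw [gridPlan_long hi] at hl
        obtain rfl : l₁ = [] := by
          cases l₁ with
          | nil => rfl
          | cons a l =>
            rw [List.cons_append, List.cons.injEq] at hl
            exact absurd (List.append_eq_nil_iff.1 hl.2.symm).2 hl₂
        refine ⟨w * Nat.sqrt ((gridItem k₀ M K h i).1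
          / ((gridItem k₀ M K h i).2 * (M * M * (M * M)))), ?_⟩
        rw [hτ, gridPlan_long hi, longPlan]
        simp only [List.sum_cons, List.sum_nil]
        push_cast
        ring) ht
  refine h1.trans ?_
  rw [jointRate]
  have h4 : (A.card : ℝ) / (cycleLength M * d) + 1 / (M ^ 2 * d)
      ≤ (1 + (gridMask k₀ M K h).sum) / (cycleLength M * d) + 1 / (M ^ 2 * d) := by gcongr
  have h5 := mul_le_mul_of_nonneg_right h4 ht.le
  linarith

/-- The integral costs of the search are the true costs times $q^2$, since $dq=r$. -/
theorem mul_sq_eq_totalCost {d q : ℝ} (hq : q = ((∑ i, h i) * M : ℕ))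
    (hd : d * q = gridRoot k₀ h) :
    q ^ 2 * (k₀ * (1 + (gridMask k₀ M K h).sum) + ∑ i, if IsShort M (gridItem k₀ M K h i) then
        (K i * (gridPlan k₀ M K h i).length + h i * d ^ 2 * sumSq (gridPlan k₀ M K h i) : ℝ) else 0)
      = totalCost (k₀ * ((∑ i, h i) * M * ((∑ i, h i) * M))) M (List.ofFn (gridItem k₀ M K h))
          (masks (cycleLength M - 1)) (gridMask k₀ M K h) := by
  rw [totalCost, List.map_ofFn, List.sum_ofFn, Nat.cast_add, Nat.cast_sum, mul_add, Finset.mul_sum]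
  congr 1
  · simp only [Nat.cast_mul, Nat.cast_add, Nat.cast_one] at hq ⊢
    rw [hq]
    ring
  · refine Finset.sum_congr rfl fun i _ => ?_
    simp only [Function.comp, shortCost]
    by_cases hi : IsShort M (gridItem k₀ M K h i)
    · rw [if_pos hi, if_pos hi, gridPlan, itemPlan, if_pos hi, cycleCost_eq]
      simp only [gridItem, Nat.cast_mul, Nat.cast_add] at hq ⊢
      rw [← hd, hq]
      ring
    · rw [if_neg hi, if_neg hi, mul_zero, Nat.cast_zero]

theorem planRate_short {i : Fin n} (hi : IsShort M (gridItem k₀ M K h i)) (hM : 1 ≤ M) :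
    planRate k₀ M K h i = (K i * (gridPlan k₀ M K h i).length
      + h i * (gridStep k₀ M h : ℝ) ^ 2 * sumSq (gridPlan k₀ M K h i))
        / (cycleLength M * (gridStep k₀ M h : ℝ)) := by
  rw [planRate, sum_cost_durations, cycleTime_durations, (gridPlan_short hi hM).1]

theorem planRate_nonneg (i : Fin n) : 0 ≤ planRate k₀ M K h i := by
  refine div_nonneg (List.sum_nonneg fun y hy => ?_) (List.sum_nonneg fun y hy => ?_)
  · obtain ⟨x, -, rfl⟩ := List.mem_map.1 hy
    positivity
  · obtain ⟨x, -, rfl⟩ := List.mem_map.1 hy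
    positivity

/-- The losses per time unit are $3r/M$ for rounding and at most $4r/M$ each for joint restarts and
for the joint orders of long items. As $Q$ costs at least $2r$, these are $11/(2M)$ of its cost.
Another $3/(2M)$ of the item costs covers item restarts and the intervals of long items, giving
$7/M$. -/
theorem rate_le [NeZero n] (hk : 1 ≤ k₀) (hM : 1 ≤ M) (hh : ∀ i, 1 ≤ h i) {Q : Fin n → Policy}
    (hQ : ∀ i, (Q i).Feasible) {N : ℕ} (hN : 1 ≤ N) {t : ℝ}
    (ht : t = N * (cycleLength M * (gridStep k₀ M h : ℝ))) :
    (k₀ * jointRate k₀ M K h + ∑ i, planRate k₀ M K h i) * t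
      ≤ (1 + 7 / M) * (k₀ * jointOrders Q t + ∑ i, (Q i).costUpTo (K i) (h i) t) := by
  have hr1 := one_le_gridRoot hk hh
  have hH1 := sum_pos_of_one_le hh
  obtain ⟨-, hrle, hrge⟩ := sqrt_bounds (a := k₀ * ∑ i, h i) (Nat.one_le_iff_ne_zero.2 (by
    positivity))
  rw [← gridRoot] at hrle hrge
  obtain ⟨q, hq⟩ : ∃ q : ℝ, q = ((∑ i, h i) * M : ℕ) := ⟨_, rfl⟩
  obtain ⟨r, hr⟩ : ∃ r : ℝ, r = gridRoot k₀ h := ⟨_, rfl⟩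
  obtain ⟨m, hm⟩ : ∃ m : ℝ, m = M := ⟨_, rfl⟩
  obtain ⟨B, hB⟩ : ∃ B : ℝ, B = ∑ i, (h i : ℝ) := ⟨_, rfl⟩
  have hm1 : 1 ≤ m := by rw [hm]; exact_mod_cast hM
  have hm0 : 0 < m := by linarith
  have hB0 : 0 < B := by rw [hB]; exact_mod_cast hH1
  have hqB : q = B * m := by rw [hq, hB, hm]; push_cast; ring
  have hq0 : 0 < q := by rw [hqB]; positivity
  have hr0 : 0 < r := by rw [hr]; exact_mod_cast hr1
  have hrle' : r ^ 2 ≤ k₀ * B := by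
    rw [hr, hB, sq]; exact_mod_cast hrle
  have hrge' : k₀ * B ≤ 4 * r ^ 2 := by
    rw [hr, hB, sq]; exact_mod_cast hrge
  obtain ⟨d, hddef⟩ : ∃ d : ℝ, d = (gridStep k₀ M h : ℝ) := ⟨_, rfl⟩
  have hd0 : 0 < d := by rw [hddef]; exact_mod_cast gridStep_pos hk hM hh
  have hdq : d * q = r := by
    have : d = r / q := by rw [hddef, gridStep, hr, hq]; push_cast; rfl
    rw [this, div_mul_cancel₀ _ hq0.ne']
  have hG : (cycleLength M : ℝ) = m ^ 4 := by rw [cycleLength, hm]; push_cast; ring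
  have hGL : ((cycleLength M - 1 : ℕ) : ℝ) + 1 = m ^ 4 := by
    rw [← hG]
    exact_mod_cast Nat.sub_add_cancel (one_le_cycleLength hM)
  rw [← hddef, hG] at ht
  have hN0 : (0 : ℝ) < N := by exact_mod_cast hN
  have ht0 : 0 < t := by rw [ht]; positivity
  have hNt : (N : ℝ) = t / (m ^ 4 * d) := by rw [ht]; field_simp
  have hdm : B * d = r / m := by rw [← hdq, hqB]; field_simp
  set J : ℝ := ((jointOrders Q t : ℕ) : ℝ) with hJ
  set c : Fin n → ℝ := fun i => (Q i).costUpTo (K i) (h i) t with hc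
  set A : Fin n → ℝ := fun i =>
    K i * (gridPlan k₀ M K h i).length + h i * d ^ 2 * sumSq (gridPlan k₀ M K h i) with hA
  have hlower : 2 * r * t ≤ k₀ * J + ∑ i, c i := by
    refine (mul_le_jointOrders_add_integral hQ (K := k₀) (H := fun i => (h i : ℝ)) (by positivity)
      (fun i => by positivity) (c := 2 * r) ?_ ht0).trans ?_
    · rw [← hB]; nlinarith
    · refine add_le_add le_rfl (Finset.sum_le_sum fun i _ => ?_)
      simp only [hc, Policy.costUpTo]
      have : (0 : ℝ) ≤ K i * (Q i).orders t := by positivity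
      linarith
  -- The averaging bound, divided by the scaling factor $q^2$.
  have hwindow : (N : ℝ) * (k₀ * (1 + (gridMask k₀ M K h).sum)
        + ∑ i, if IsShort M (gridItem k₀ M K h i) then A i else 0)
      ≤ k₀ * (N + J) + ∑ i, if IsShort M (gridItem k₀ M K h i) then
        K i * N + 3 * h i * d * t + c i else 0 := by
    have h1 := mul_totalCost_le hQ hd0 (k₀ * ((∑ i, h i) * M * ((∑ i, h i) * M))) M
      (gridItem k₀ M K h) (cycleLength M - 1) N
    rw [← gridMask, ← mul_sq_eq_totalCost (d := d) hq (by rw [hdq, hr]), hGL, ← ht] at h1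
    have h2 : ∀ i, (if IsShort M (gridItem k₀ M K h i) then
          ((gridItem k₀ M K h i).1 : ℝ) * (N + (Q i).orders t)
            + (gridItem k₀ M K h i).2 / d ^ 2 * (3 * d ^ 2 * m ^ 4 * N
              + 2 * ∫ s in Set.Ico 0 t, (Q i).inventory s) else 0)
        = q ^ 2 * if IsShort M (gridItem k₀ M K h i) then
          K i * N + 3 * h i * d * t + c i else 0 := by
      intro i
      split_ifs
      · have h3 : ((gridItem k₀ M K h i).1 : ℝ) = K i * q ^ 2 := by
          rw [gridItem, hq]; push_cast; ring
        have h4 : ((gridItem k₀ M K h i).2 : ℝ) / d ^ 2 = h i * q ^ 2 := by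
          rw [div_eq_iff (by positivity)]
          calc ((gridItem k₀ M K h i).2 : ℝ) = h i * r ^ 2 := by rw [gridItem, hr]; push_cast; ring
            _ = _ := by rw [← hdq]; ring
        rw [h3, h4]
        simp only [hc, Policy.costUpTo]
        rw [ht]
        ring
      · ring
    have h5 : ((k₀ * ((∑ i, h i) * M * ((∑ i, h i) * M)) : ℕ) : ℝ) = q ^ 2 * k₀ := by
      rw [hq]; push_cast; ring
    rw [Finset.sum_congr rfl fun i _ => h2 i, h5, ← Finset.mul_sum] at h1
    refine le_of_mul_le_mul_left ?_ (show 0 < q ^ 2 by positivity)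
    calc _ = _ := by ring
      _ ≤ _ := h1
      _ = _ := by ring
  have hsplit : (k₀ * jointRate k₀ M K h + ∑ i, planRate k₀ M K h i) * t
      = (N : ℝ) * (k₀ * (1 + (gridMask k₀ M K h).sum)
          + ∑ i, if IsShort M (gridItem k₀ M K h i) then A i else 0)
        + k₀ / (m ^ 2 * d) * t
        + ∑ i, if IsShort M (gridItem k₀ M K h i) then 0 else planRate k₀ M K h i * t := by
    have h1 : ∀ i, planRate k₀ M K h i * t
        = N * (if IsShort M (gridItem k₀ M K h i) then A i else 0)
          + if IsShort M (gridItem k₀ M K h i) then 0 else planRate k₀ M K h i * t := by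
      intro i
      split_ifs with hi
      · rw [planRate_short hi hM, ← hddef, hG, hNt]
        simp only [hA]
        field_simp
        ring
      · ring
    rw [add_mul, Finset.sum_mul, Finset.sum_congr rfl fun i _ => h1 i, Finset.sum_add_distrib,
      ← Finset.mul_sum, jointRate, ← hddef, hG, ← hm, hNt]
    field_simp
    ring
  -- A short item pays for restarts and rounding, a long one for its rounded interval; the common
  -- bound covers both.
  have hitem : ∀ i, (if IsShort M (gridItem k₀ M K h i) then
        K i * N + 3 * h i * d * t + c i else 0)
      + (if IsShort M (gridItem k₀ M K h i) then 0 else planRate k₀ M K h i * t)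
      ≤ (1 + 3 / (2 * m)) * c i + 3 * d * t * h i := by
    intro i
    split_ifs with hi
    · have h1 : (K i : ℝ) ≤ h i * (m * (m ^ 2 * d)) ^ 2 := by
        have h2 : K i * q ^ 2 ≤ h i * r ^ 2 * m ^ 6 := by
          have : ((gridItem k₀ M K h i).1 : ℝ)
              ≤ (gridItem k₀ M K h i).2 * (M * M * M * (M * M * M)) := by exact_mod_cast hi.le
          rw [gridItem] at this
          push_cast at this
          push_cast at hq
          rw [hq, hr, hm]
          linarith
        refine le_of_mul_le_mul_right ?_ (show 0 < q ^ 2 by positivity)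
        refine h2.trans_eq ?_
        rw [← hdq]
        ring
      have h3 := short_restart_le (hQ i) (K := K i) (H := h i) (w := m ^ 2 * d) (m := m) (t := t)
        (by positivity) (by positivity) (by positivity) hm1 h1 ht0
      have h4 : (K i : ℝ) * N = K i / (m ^ 2 * (m ^ 2 * d)) * t := by
        rw [hNt]; field_simp
      rw [← h4] at h3
      simp only [hc] at h3 ⊢
      linarith
    · obtain ⟨h1, h2, h3⟩ := longPlan_bounds hM (one_le_gridItem_snd (K := K) hk hh i) hi
      set x := longPlan M (gridItem k₀ M K h i) with hx
      have hx0 : (0 : ℝ) < x := by exact_mod_cast h1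
      have hu : ((gridItem k₀ M K h i).1 : ℝ) = K i * q ^ 2 := by
        rw [gridItem, hq]; push_cast; ring
      have hv : ((gridItem k₀ M K h i).2 : ℝ) = h i * d ^ 2 * q ^ 2 := by
        calc ((gridItem k₀ M K h i).2 : ℝ) = h i * r ^ 2 := by rw [gridItem, hr]; push_cast; ring
          _ = _ := by rw [← hdq]; ring
      have h2' : ((gridItem k₀ M K h i).2 : ℝ) * x ^ 2 ≤ (gridItem k₀ M K h i).1 := by
        exact_mod_cast h2
      rw [hu, hv] at h2' h3
      have h4 := long_cost_le (hQ i) (K := K i) (H := h i) (x := x * d) (m := m) (t := t)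
        (by positivity) (by positivity) (by positivity) hm1
        (le_of_mul_le_mul_right (by linarith) (show 0 < q ^ 2 by positivity))
        (le_of_mul_le_mul_right (by rw [← hm] at h3; linarith) (show 0 < q ^ 2 by positivity)) ht0
      have h5 : planRate k₀ M K h i = (K i + h i * (x * d) ^ 2) / (x * d) := by
        rw [planRate, sum_cost_durations, cycleTime_durations, gridPlan_long hi, ← hddef]
        simp only [sumSq, List.map_cons, List.map_nil, List.sum_cons, List.sum_nil,
          List.length_singleton, ← hx]
        push_cast
        ring
      rw [h5, zero_add]
      have h6 : 0 ≤ 3 * d * t * h i := by positivity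
      linarith
  have hsum := Finset.sum_le_sum fun i (_ : i ∈ Finset.univ) => hitem i
  rw [Finset.sum_add_distrib, Finset.sum_add_distrib, ← Finset.mul_sum, ← Finset.mul_sum,
    ← hB] at hsum
  have hround : 3 * d * t * B = 3 / m * (r * t) := by
    calc 3 * d * t * B = 3 * (B * d) * t := by ring
      _ = _ := by rw [hdm]; ring
  -- From $dBm=r$ and $k_0B\le4r^2$: $k_0/(m^2d)=k_0B/(mr)\le 4r/m$.
  have hjoint : k₀ / (m ^ 2 * d) * t ≤ 4 / m * (r * t) := by
    have h1 : (k₀ : ℝ) / (m ^ 2 * d) ≤ 4 / m * r := by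
      rw [div_le_iff₀ (by positivity)]
      have h2 : 4 / m * r * (m ^ 2 * d) * B = 4 * r ^ 2 := by
        calc 4 / m * r * (m ^ 2 * d) * B = 4 * r * (d * (B * m)) := by field_simp
          _ = _ := by rw [← hqB, hdq]; ring
      refine le_of_mul_le_mul_right ?_ hB0
      rw [h2]
      exact hrge'
    calc _ ≤ 4 / m * r * t := by gcongr
      _ = _ := by ring
  have hrestart : k₀ * (N : ℝ) ≤ 4 / m * (r * t) := by
    refine le_trans ?_ hjoint
    rw [hNt, mul_div_assoc', div_mul_eq_mul_div]
    gcongr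
    norm_num
  rw [hsplit, ← hm]
  have hfin : 3 / (2 * m) = 3 / 2 * (1 / m) := by field_simp
  have hi0 : 0 < 1 / m := by positivity
  have hJ0 : 0 ≤ k₀ * J := by positivity
  have e1 : 3 / m * (r * t) = 3 * (1 / m) * (r * t) := by ring
  have e2 : 4 / m * (r * t) = 4 * (1 / m) * (r * t) := by ring
  have e3 : 7 / m = 7 * (1 / m) := by ring
  rw [hround, e1, hfin] at hsum
  rw [e2] at hjoint hrestart
  rw [e3]
  have h8 := mul_le_mul_of_nonneg_left hlower hi0.le
  have h9 := mul_nonneg hi0.le hJ0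
  linarith

end Integral

end JRP

namespace JRP

open Enc

/-! ### From integral to rational costs -/

theorem limsup_add_le_ennreal {α : Type} {f : Filter α} (u v : α → ℝ≥0∞) :
    limsup (fun x => u x + v x) f ≤ limsup u f + limsup v f := by
  refine ENNReal.le_of_forall_pos_le_add fun η hη hlt => ?_
  obtain ⟨hu, hv⟩ := ENNReal.add_lt_top.1 hlt
  have hη' : (η / 2 : ℝ≥0∞) ≠ 0 := by simpa using hη.ne'
  have h1 := eventually_lt_of_limsup_lt (ENNReal.lt_add_right hu.ne hη')
  have h2 := eventually_lt_of_limsup_lt (ENNReal.lt_add_right hv.ne hη')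
  refine limsup_le_of_le (h := ?_)
  filter_upwards [h1, h2] with x hx1 hx2
  calc u x + v x ≤ (limsup u f + η / 2) + (limsup v f + η / 2) := add_le_add hx1.le hx2.le
    _ = limsup u f + limsup v f + (η / 2 + η / 2) := by ring
    _ = _ := by rw [ENNReal.add_halves]

theorem limsup_sum_le_ennreal {α ι : Type} {f : Filter α} (s : Finset ι) (u : ι → α → ℝ≥0∞) :
    limsup (fun x => ∑ i ∈ s, u i x) f ≤ ∑ i ∈ s, limsup (u i) f := by
  classical
  induction s using Finset.induction_on with
  | empty => simpa using limsup_le_of_le (f := f) (u := fun _ => (0 : ℝ≥0∞)) (a := 0) (h := by simp)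
  | insert a s ha ih =>
    simp only [Finset.sum_insert ha]
    exact (limsup_add_le_ennreal _ _).trans (add_le_add le_rfl ih)

/-- Total costs along `[0,t)`. -/
noncomputable def Inst.costUpTo (I : Inst) (Q : Fin I.n → Policy) (t : ℝ) : ℝ :=
  I.K₀ * jointOrders Q t + ∑ i, (Q i).costUpTo (I.K i) (I.H i) t

theorem Policy.Feasible.costUpTo_ge {P : Policy} (h : P.Feasible) {K H t : ℝ} (hH : 0 ≤ H) :
    K * P.orders t ≤ P.costUpTo K H t := by
  have : 0 ≤ ∫ s in Set.Ico 0 t, P.inventory s :=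
    setIntegral_nonneg measurableSet_Ico fun s hs => h.inventory_nonneg s hs.1
  rw [Policy.costUpTo]
  have := mul_nonneg (mul_nonneg zero_le_two hH) this
  linarith

/-- A sum of upper limits is at least the upper limit of the sum, so arbitrarily late times suffice,
in particular the ends of windows. -/
theorem Inst.le_F (I : Inst) {Q : Fin I.n → Policy} (hQ : ∀ i, (Q i).Feasible) {b : ℝ}
    (hb : ∃ᶠ t in atTop, b * t ≤ I.costUpTo Q t) : ENNReal.ofReal b ≤ I.F Q := by
  have h1 : limsup (fun t : ℝ => ENNReal.ofReal (I.K₀ : ℝ) * ENNReal.ofReal (jointOrders Q t / t)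
      + ∑ i, ENNReal.ofReal ((Q i).costUpTo (I.K i) (I.H i) t / t)) atTop ≤ I.F Q := by
    refine (limsup_add_le_ennreal _ _).trans (add_le_add (le_of_eq ?_) (limsup_sum_le_ennreal _ _))
    exact ENNReal.limsup_const_mul_of_ne_top ENNReal.ofReal_ne_top
  refine le_trans (le_limsup_of_frequently_le' ?_) h1
  refine (hb.and_eventually (eventually_gt_atTop 0)).mono fun t ⟨ht, ht0⟩ => ?_
  have h2 : ∀ i, 0 ≤ (Q i).costUpTo (I.K i) (I.H i) t / t := fun i =>
    div_nonneg (le_trans (by positivity) ((hQ i).costUpTo_ge (K := I.K i) (by positivity))) ht0.le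
  rw [← ENNReal.ofReal_mul (by positivity), ← ENNReal.ofReal_sum_of_nonneg fun i _ => h2 i,
    ← ENNReal.ofReal_add (by positivity) (Finset.sum_nonneg fun i _ => h2 i)]
  refine ENNReal.ofReal_le_ofReal ?_
  rw [← Finset.sum_div, mul_div_assoc', ← add_div, le_div_iff₀ ht0]
  exact ht

/-- The instance as the machine receives it. -/
def Inst.raw (I : Inst) : RawInst :=
  ((I.K₀.num, I.K₀.den), List.ofFn fun i => (((I.K i).num, (I.K i).den), ((I.H i).num, (I.H i).den)))

theorem Inst.enc_raw (I : Inst) (m : ℕ) : enc (m, I.raw) = .pair (.num m) I.encode := by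
  have h : enc I.raw.2 = encodeList (List.ofFn fun i =>
      Data.pair (encodeRat (I.K i)) (encodeRat (I.H i))) := by
    change encodeList ((List.ofFn _).map enc) = _
    rw [List.map_ofFn]
    rfl
  change Data.pair _ (Data.pair _ (enc I.raw.2)) = _
  rw [h]
  rfl

theorem decodeList_enc {α : Type} [Enc α] (l : List α) : decodeList (enc l) = l.map enc := by
  induction l with
  | nil => rfl
  | cons a l ih => exact congrArg (enc a :: ·) ih

theorem decodePolicy_enc {n : ℕ} (l : Fin n → List (ℕ × ℕ)) (i : Fin n) :
    decodePolicy n (enc (List.ofFn l)) i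
      = cyclicPolicy ((l i).map fun x => (x.1 : ℚ≥0) / (x.2 : ℚ≥0)) := by
  have h : (decodeList (enc (List.ofFn l))).getD i (.num 0) = enc (l i) := by
    rw [decodeList_enc, List.map_ofFn, List.getD_eq_getElem _ _ (by simp), List.getElem_ofFn]
    rfl
  rw [decodePolicy, h, decodeList_enc, List.map_map]
  rfl

/-! ### Clearing denominators and making the joint ordering cost positive. -/

namespace Inst

variable (I : Inst)

def den : ℕ := commonDen I.raw

def natJoint (M : ℕ) : ℕ := intJoint M I.raw

def natK (M : ℕ) (i : Fin I.n) : ℕ := M * clearDen I.den ((I.K i).num, (I.K i).den)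

def natH (M : ℕ) (i : Fin I.n) : ℕ := M * clearDen I.den ((I.H i).num, (I.H i).den)

theorem intItems_raw (M : ℕ) : intItems M I.raw = List.ofFn fun i => (I.natK M i, I.natH M i) := by
  rw [intItems, raw, List.map_ofFn]
  rfl

theorem den_eq : I.den = I.K₀.den * ∏ i, ((I.K i).den * (I.H i).den) := by
  rw [den, commonDen, raw, List.map_ofFn, List.prod_ofFn]
  rfl

theorem den_pos : 0 < I.den := by
  rw [den_eq]
  exact Nat.mul_pos I.K₀.den_pos
    (Finset.prod_pos fun i _ => Nat.mul_pos (I.K i).den_pos (I.H i).den_pos)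

theorem clearDen_eq {D : ℕ} {x : ℚ≥0} (h : x.den ∣ D) :
    (clearDen D (x.num, x.den) : ℝ) = D * (x : ℝ) := by
  have hx : (x.den : ℝ) ≠ 0 := by exact_mod_cast x.den_ne_zero
  rw [clearDen, Nat.cast_mul, Nat.cast_div h hx, NNRat.cast_def x]
  field_simp

theorem clearDen_pos {D : ℕ} (hD : 0 < D) {x : ℚ≥0} (h : x.den ∣ D) (hx : 0 < x) :
    1 ≤ clearDen D (x.num, x.den) :=
  Nat.mul_pos (NNRat.num_pos.2 hx) (Nat.div_pos (Nat.le_of_dvd hD h) x.den_pos)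

theorem den_dvd (i : Fin I.n) : (I.K i).den ∣ I.den ∧ (I.H i).den ∣ I.den := by
  have h : (I.K i).den * (I.H i).den ∣ I.den := by
    rw [den_eq]
    exact Dvd.dvd.mul_left (Finset.dvd_prod_of_mem
      (fun i => (I.K i).den * (I.H i).den) (Finset.mem_univ i)) _
  exact ⟨(dvd_mul_right _ _).trans h, (dvd_mul_left _ _).trans h⟩

theorem joint_den_dvd : I.K₀.den ∣ I.den := by
  rw [den_eq]; exact dvd_mul_right _ _

theorem natK_eq (M : ℕ) (i : Fin I.n) : (I.natK M i : ℝ) = M * I.den * (I.K i : ℝ) := by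
  rw [natK, Nat.cast_mul, clearDen_eq (I.den_dvd i).1]
  ring

theorem natH_eq (M : ℕ) (i : Fin I.n) : (I.natH M i : ℝ) = M * I.den * (I.H i : ℝ) := by
  rw [natH, Nat.cast_mul, clearDen_eq (I.den_dvd i).2]
  ring

theorem natJoint_cases (M : ℕ) : (I.K₀ = 0 ∧ I.natJoint M = 1) ∨
    (0 < I.K₀ ∧ (I.natJoint M : ℝ) = M * I.den * (I.K₀ : ℝ) ∧ (0 < M → 1 ≤ I.natJoint M)) := by
  have hdef : I.natJoint M = M * clearDen I.den (I.K₀.num, I.K₀.den)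
      + (1 - clearDen I.den (I.K₀.num, I.K₀.den)) := rfl
  rcases eq_or_lt_of_le (show 0 ≤ I.K₀ from zero_le) with h | h
  · refine Or.inl ⟨h.symm, ?_⟩
    rw [hdef, clearDen, ← h]
    simp
  · have h1 := clearDen_pos I.den_pos I.joint_den_dvd h
    have h2 : I.natJoint M = M * clearDen I.den (I.K₀.num, I.K₀.den) := by rw [hdef]; omega
    refine Or.inr ⟨h, ?_, fun hM => ?_⟩
    · rw [h2, Nat.cast_mul, clearDen_eq I.joint_den_dvd]
      ring
    · rw [h2]
      exact Nat.mul_pos hM h1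

variable {I}

theorem one_le_natJoint {M : ℕ} (hM : 1 ≤ M) : 1 ≤ I.natJoint M := by
  rcases I.natJoint_cases M with ⟨-, h⟩ | ⟨-, -, h⟩
  · exact h.ge
  · exact h hM

theorem mul_le_natJoint {M : ℕ} : M * I.den * (I.K₀ : ℝ) ≤ I.natJoint M := by
  rcases I.natJoint_cases M with ⟨h0, -⟩ | ⟨-, h, -⟩
  · rw [h0]; simp
  · exact h.ge

theorem one_le_natH (hI : I.Valid) {M : ℕ} (hM : 1 ≤ M) (i : Fin I.n) : 1 ≤ I.natH M i :=
  Nat.mul_pos hM (clearDen_pos I.den_pos (I.den_dvd i).2 (hI i).2)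

/-- If $K_0=0$, the joint cost is replaced by 1. All $K_i$ are then positive, so their integral
multiples are at least $M$; each joint order contains an item order of at least this cost, and the
artificial cost adds at most the fraction $1/M$. -/
theorem natCost_le (hI : I.Valid) {M : ℕ} (hM : 1 ≤ M) {Q : Fin I.n → Policy}
    (hQ : ∀ i, (Q i).Feasible) (t : ℝ) :
    I.natJoint M * (jointOrders Q t : ℝ) + ∑ i, (Q i).costUpTo (I.natK M i) (I.natH M i) t
      ≤ (1 + 1 / M) * (M * I.den * I.costUpTo Q t) := by
  have hM0 : (0 : ℝ) < M := by exact_mod_cast hM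
  have hc : ∀ i, (Q i).costUpTo (I.natK M i) (I.natH M i) t
      = M * I.den * (Q i).costUpTo (I.K i) (I.H i) t := by
    intro i
    rw [natK_eq, natH_eq, Policy.costUpTo, Policy.costUpTo]
    ring
  have hc0 : ∀ i, 0 ≤ (Q i).costUpTo (I.K i) (I.H i) t := fun i =>
    le_trans (by positivity) ((hQ i).costUpTo_ge (K := I.K i) (by positivity))
  have hs0 : 0 ≤ ∑ i, (Q i).costUpTo (I.K i) (I.H i) t := Finset.sum_nonneg fun i _ => hc0 i
  rw [Finset.sum_congr rfl fun i _ => hc i, ← Finset.mul_sum, Inst.costUpTo]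
  rcases I.natJoint_cases M with ⟨h0, h⟩ | ⟨-, h, -⟩
  · rw [h0, h]
    have h1 : (M : ℝ) * jointOrders Q t ≤ M * I.den * ∑ i, (Q i).costUpTo (I.K i) (I.H i) t := by
      calc (M : ℝ) * jointOrders Q t ≤ M * ∑ i, ((Q i).orders t : ℝ) := by
            gcongr
            exact_mod_cast jointOrders_le_sum_orders hQ t
        _ = ∑ i, (M : ℝ) * (Q i).orders t := Finset.mul_sum _ _ _
        _ ≤ ∑ i, (Q i).costUpTo (I.natK M i) (I.natH M i) t := by
            refine Finset.sum_le_sum fun i _ => ?_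
            refine le_trans ?_ ((hQ i).costUpTo_ge (by positivity))
            gcongr
            have hK : 0 < I.K i := by simpa [h0] using (hI i).1
            have := clearDen_pos I.den_pos (I.den_dvd i).1 hK
            exact_mod_cast Nat.le_mul_of_pos_right M this
        _ = _ := by rw [Finset.sum_congr rfl fun i _ => hc i, ← Finset.mul_sum]
    have h2 : (jointOrders Q t : ℝ)
        ≤ 1 / M * (M * I.den * ∑ i, (Q i).costUpTo (I.K i) (I.H i) t) := by
      rw [div_mul_eq_mul_div, one_mul, le_div_iff₀ hM0]
      linarith
    push_cast
    linarith
  · rw [h]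
    have h1 : 0 ≤ 1 / (M : ℝ) * (M * I.den * (I.K₀ * jointOrders Q t
        + ∑ i, (Q i).costUpTo (I.K i) (I.H i) t)) := by positivity
    linarith

end Inst

/-- The policy computed by the algorithm. -/
def outPolicy (I : Inst) (M : ℕ) (i : Fin I.n) : Policy :=
  cyclicPolicy (durations (gridStep (I.natJoint M) M (I.natH M))
    (gridPlan (I.natJoint M) M (I.natK M) (I.natH M) i))

theorem decodePolicy_solve (I : Inst) (M : ℕ) :
    decodePolicy I.n (enc (solve M I.raw (masks (cycleLength M - 1)))) = outPolicy I M := by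
  funext i
  rw [solve, Inst.intItems_raw, ← Inst.natJoint, solveInt_eq, decodePolicy_enc, outPolicy,
    durations, List.map_map]
  congr 2
  funext x
  simp only [Function.comp, gridStep]
  push_cast
  rw [mul_div_assoc]

theorem outPolicy_feasible {I : Inst} (hI : I.Valid) {M : ℕ} (hM : 1 ≤ M) (i : Fin I.n) :
    (outPolicy I M i).Feasible := by
  have : NeZero I.n := ⟨fun h => by have := i.2; omega⟩
  obtain ⟨h1, h2⟩ := durations_pos (K := I.natK M) (Inst.one_le_natJoint hM) hM
    (Inst.one_le_natH hI hM) i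
  exact cyclicPolicy_feasible h1 h2

/-- The joint rate is weighted with the true $K_0$, not with the artificial one. Item rates refer to
the integral costs and are scaled back. -/
theorem outPolicy_F_le {I : Inst} (hI : I.Valid) {M : ℕ} (hM : 1 ≤ M) [NeZero I.n] :
    I.F (outPolicy I M) ≤ ENNReal.ofReal
      (I.K₀ * jointRate (I.natJoint M) M (I.natK M) (I.natH M)
        + ∑ i, planRate (I.natJoint M) M (I.natK M) (I.natH M) i / (M * I.den)) := by
  have hk := Inst.one_le_natJoint (I := I) hM
  have hh := Inst.one_le_natH hI hM
  have hM0 : (0 : ℝ) < M := by exact_mod_cast hM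
  have hD0 : (0 : ℝ) < I.den := by exact_mod_cast I.den_pos
  have hj0 : 0 ≤ jointRate (I.natJoint M) M (I.natK M) (I.natH M) := by
    rw [jointRate]; positivity
  rw [ENNReal.ofReal_add (by positivity) (Finset.sum_nonneg fun i _ =>
      div_nonneg (planRate_nonneg i) (by positivity)), ENNReal.ofReal_mul (by positivity),
    ENNReal.ofReal_sum_of_nonneg fun i _ => div_nonneg (planRate_nonneg i) (by positivity), Inst.F]
  refine add_le_add (mul_le_mul_right (limsup_div_le
    fun t ht => jointOrders_plan_le hk hM hh ht) _) (Finset.sum_le_sum fun i _ => ?_)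
  obtain ⟨h1, h2⟩ := durations_pos (K := I.natK M) hk hM hh i
  refine (cyclicPolicy_cost_le h1 h2 (by positivity) (by positivity)).trans_eq ?_
  congr 1
  rw [planRate, div_right_comm]
  congr 1
  rw [eq_div_iff (by positivity), mul_comm, ← List.sum_map_mul_left]
  congr 2
  funext x
  rw [Inst.natK_eq, Inst.natH_eq]
  ring

theorem outPolicy_approx {I : Inst} (hI : I.Valid) {ε : ℝ} {M : ℕ} (hM : 1 ≤ M)
    (hε : 15 ≤ ε * M) {Q : Fin I.n → Policy} (hQ : ∀ i, (Q i).Feasible) :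
    I.F (outPolicy I M) ≤ ENNReal.ofReal (1 + ε) * I.F Q := by
  have hM0 : (1 : ℝ) ≤ M := by exact_mod_cast hM
  have hε0 : 0 < ε := by
    by_contra hcon
    nlinarith
  -- Without items there is only one policy vector.
  rcases Nat.eq_zero_or_pos I.n with h0 | hpos
  · have : IsEmpty (Fin I.n) := by rw [h0]; infer_instance
    rw [Subsingleton.elim (outPolicy I M) Q]
    exact le_mul_of_one_le_left zero_le (by
      rw [← ENNReal.ofReal_one]; exact ENNReal.ofReal_le_ofReal (by linarith))
  · have : NeZero I.n := ⟨hpos.ne'⟩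
    have hk := Inst.one_le_natJoint (I := I) hM
    have hh := Inst.one_le_natH hI hM
    have hD0 : (0 : ℝ) < I.den := by exact_mod_cast I.den_pos
    refine (outPolicy_F_le hI hM).trans ?_
    set b := I.K₀ * jointRate (I.natJoint M) M (I.natK M) (I.natH M)
        + ∑ i, planRate (I.natJoint M) M (I.natK M) (I.natH M) i / (M * I.den) with hb
    have hj0 : 0 ≤ jointRate (I.natJoint M) M (I.natK M) (I.natH M) := by
      rw [jointRate]; positivity
    have hstep : 0 < cycleLength M * (gridStep (I.natJoint M) M (I.natH M) : ℝ) := by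
      have h1 : 0 < (gridStep (I.natJoint M) M (I.natH M) : ℝ) := by
        exact_mod_cast gridStep_pos hk hM hh
      have h2 : (0 : ℝ) < cycleLength M := by exact_mod_cast one_le_cycleLength hM
      positivity
    have hmain : ENNReal.ofReal (b / (1 + ε)) ≤ I.F Q := by
      refine I.le_F hQ (frequently_atTop.2 fun a => ?_)
      obtain ⟨N, hN⟩ := exists_nat_ge
        (a / (cycleLength M * (gridStep (I.natJoint M) M (I.natH M) : ℝ)))
      refine ⟨(N + 1 : ℕ) * (cycleLength M * (gridStep (I.natJoint M) M (I.natH M) : ℝ)), ?_, ?_⟩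
      · rw [← div_le_iff₀ hstep]
        push_cast
        linarith
      · have h1 := rate_le (K := I.natK M) hk hM hh hQ (N := N + 1) (by omega) rfl
        set t := ((N + 1 : ℕ) : ℝ) * (cycleLength M * (gridStep (I.natJoint M) M (I.natH M) : ℝ))
          with ht
        have ht0 : 0 < t := by rw [ht]; positivity
        have h2 := Inst.natCost_le hI hM hQ t
        have hc0 : 0 ≤ I.costUpTo Q t := by
          rw [Inst.costUpTo]
          have : 0 ≤ ∑ i, (Q i).costUpTo (I.K i) (I.H i) t := Finset.sum_nonneg fun i _ =>
            le_trans (by positivity) ((hQ i).costUpTo_ge (K := I.K i) (by positivity))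
          positivity
        have h3 : M * I.den * b ≤ I.natJoint M * jointRate (I.natJoint M) M (I.natK M) (I.natH M)
            + ∑ i, planRate (I.natJoint M) M (I.natK M) (I.natH M) i := by
          rw [hb, ← Finset.sum_div, mul_add, mul_div_cancel₀ _ (by positivity), ← mul_assoc]
          gcongr
          exact Inst.mul_le_natJoint
        -- The product is at most $1+15/M$, which explains the hypothesis `15 ≤ ε * M`.
        have h4 : (1 + 7 / M) * (1 + 1 / M) ≤ (1 + ε : ℝ) := by
          have h5 : 1 / (M : ℝ) ≤ ε / 15 := by
            rw [div_le_div_iff₀ (by linarith) (by norm_num)]; linarith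
          have h6 : 1 / (M : ℝ) ≤ 1 := by rw [div_le_one (by linarith)]; exact hM0
          have h7 : 0 ≤ 1 / (M : ℝ) := by positivity
          have h8 : 7 / (M : ℝ) = 7 * (1 / M) := by ring
          rw [h8]
          nlinarith
        rw [div_mul_eq_mul_div, div_le_iff₀ (by linarith)]
        refine le_of_mul_le_mul_left ?_ (show (0 : ℝ) < M * I.den by positivity)
        calc M * I.den * (b * t) = M * I.den * b * t := by ring
          _ ≤ _ := mul_le_mul_of_nonneg_right h3 ht0.le
          _ ≤ _ := h1
          _ ≤ (1 + 7 / M) * ((1 + 1 / M) * (M * I.den * I.costUpTo Q t)) := by gcongr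
          _ = (1 + 7 / M) * (1 + 1 / M) * (M * I.den * I.costUpTo Q t) := by ring
          _ ≤ (1 + ε) * (M * I.den * I.costUpTo Q t) := by gcongr
          _ = _ := by ring
    calc ENNReal.ofReal b = ENNReal.ofReal (1 + ε) * ENNReal.ofReal (b / (1 + ε)) := by
          rw [← ENNReal.ofReal_mul (by linarith), mul_div_cancel₀ _ (by linarith)]
      _ ≤ _ := mul_le_mul_right hmain _

end JRP

theorem theorem1 :
    ∃ (A : JRP.Prog) (C : ℕ), ∀ ε : ℝ, 0 < ε → ∀ I : JRP.Inst, I.Valid →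
      ∃ (out : JRP.Data) (t : ℕ),
        JRP.Eval A (.pair (.num ⌈1 / ε⌉₊) I.encode) out t ∧
        (t : ℝ) ≤ C * (2 : ℝ) ^ ((C : ℝ) * (1 / ε) ^ 4 * Real.log (2 + 1 / ε) ^ C)
          * (I.size : ℝ) ^ C ∧
        (∀ i, (JRP.decodePolicy I.n out i).Feasible) ∧
        ∀ Q : Fin I.n → JRP.Policy, (∀ i, (Q i).Feasible) →
          I.F (JRP.decodePolicy I.n out) ≤ ENNReal.ofReal (1 + ε) * I.F Q := by
  obtain ⟨A, c, hA⟩ := JRP.exists_program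
  obtain ⟨C, hC⟩ := JRP.exists_time_bound c
  refine ⟨A, C, fun ε hε I hI => ?_⟩
  obtain ⟨t, ht, htle⟩ := hA ⌈1 / ε⌉₊ I.raw
  have hm1 : 1 ≤ ⌈1 / ε⌉₊ := Nat.one_le_ceil_iff.2 (by positivity)
  have hM : 1 ≤ 16 * ⌈1 / ε⌉₊ := by omega
  -- The choice $M=16\lceil1/\epsilon\rceil$ even gives $\epsilon M\ge16$.
  have hεM : 15 ≤ ε * (16 * ⌈1 / ε⌉₊ : ℕ) := by
    have h1 : 1 ≤ ε * (⌈1 / ε⌉₊ : ℝ) := by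
      have := mul_le_mul_of_nonneg_left (Nat.le_ceil (1 / ε)) hε.le
      rwa [mul_one_div_cancel hε.ne'] at this
    push_cast
    linarith
  rw [I.enc_raw] at ht
  refine ⟨_, t, ht, ?_, ?_, ?_⟩
  · refine hC ε I.size t hε (JRP.Data.one_le_size _) (htle.trans_eq ?_)
    rw [JRP.esize, I.enc_raw]
    rfl
  · rw [JRP.decodePolicy_solve]
    exact JRP.outPolicy_feasible hI hM
  · rw [JRP.decodePolicy_solve]
    exact fun Q hQ => JRP.outPolicy_approx hI hM hεM hQ
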